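/- Let $c\in\{0,1,2,\dots\}\cup\{\infty\}$. A marked lattice path in $\mathrm{Lat}_c(k_1,\dots,k_n;l)$ is a lattice path from $(0,\dots,0)$ to $(k_1+1,\dots,k_n+1)$ in the grid $\prod_i\{0,\dots,k_i+1\}$ (each step increases exactly one coordinate by $1$), with a non-negative integer mark at each of its points, the marks adding up to $l$, such that for all $i<j$ the projection of the path to the $(i,j)$-plane changes its direction at most $c$ times. Equivalently, it is an endpoint-preserving functor from $\{0<\dots<l+1\}$ to the free category on the grid; composition of functors makes these sets a coloured operad, with $p\circ_i q$ defined for $p\in\mathrm{Lat}_c(a_1,\dots,a_n;l)$, $q\in\mathrm{Lat}_c(b_1,\dots,b_m;a_i)$. Write $|p|=l-\sum_r k_r$ for $p\in \mathrm{Lat}_c(k_1,\dots,k_n;l)$. The $i$-th face $\partial^r_i p$ ($k_r\ge 1$, $0\le i\le k_r$) removes the step of $p$ from $i$ to $i+1$ in the $r$-th coordinate and adds the marks of its two ends; the $i$-th coface $\delta^i p$ ($0\le i\le l+1$) increases by $1$ the mark at the point $\varphi(i)$, where $\varphi$ is the functor $p$. Let $|\mathrm{Lat}_c|(n)$, $n\ge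 0$, be the cochain complex of abelian groups with $|\mathrm{Lat}_c|^a(n)=\prod_{l\ge0}\bigoplus_{l-\sum k_r=a}\mathbb Z\,\mathrm{Lat}_c(k_1,\dots,k_n;l)$ and differential $d=\partial+\delta$, where $\partial p=\sum_{r:\,k_r\ge1}\sum_{i=0}^{k_r}(-1)^{k_1+\dots+k_{r-1}+i}\partial^r_ip$ and $\delta p=\sum_{i=0}^{l+1}(-1)^{|p|+1+i}\delta^ip$. Define its partial compositions from those of the coloured operad (terms with non-matching colours compose to $0$), with the sign $(-1)^{|p||q|+|q|(a_1+\dots+a_{i-1})}$ in front of $p\circ_iq$. Let the symmetric groups permute coordinates, with the Koszul sign for degrees $k_1,\dots,k_n$, and let the unit be the sum over $l\ge 0$ of the paths $0\to1\to\dots\to l+1$ with mark $1$ at every interior point and mark $0$ at both ends. Then $|\mathrm{Lat}_c|$ is a (unital, symmetric) dg-operad. Let $\mathrm{Br}_c(n)$, $n\ge0$, be the complex with $\mathrm{Br}_c^a(n)=\bigoplus_{-\sum k_r=a}\mathbb Z\,\mathrm{Lat}_c(k_1,\dots,k_n;0)$ and differential $\partial$, with the same symmetric group actions and with unit the one-step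 path. For a choice of signs, define the whiskering $w=\prod_{s\ge0}w_s:\mathrm{Br}_c(n)\to|\mathrm{Lat}_c|(n)$, where $w_s(p)$ is the signed sum of all marked paths obtained from $p$ by inserting exactly $s$ new points inside steps of $p$, each being an internal point (one at which the path does not change its direction) with mark $1$ (so that a step with $t$ new points becomes $t+1$ steps in the same direction). Define on $\mathrm{Br}_c$ the compositions $p'\circ_ip'':=p'\circ_iw_{a_i}(p'')$ for $p'\in\mathrm{Lat}_c(a_1,\dots,a_n;0)$, the right-hand side being composed as in $|\mathrm{Lat}_c|$. The signs in the whiskering can be chosen such that these compositions make $\mathrm{Br}_c$ a dg-operad and $w:\mathrm{Br}_c\hookrightarrow|\mathrm{Lat}_c|$ is an inclusion (injective morphism) of dg-operads. -/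

import Mathlib

/-! ### Symmetric dg-operads, presented by partial compositions -/

namespace Operadic

/-- Where the input `j` of the inner operation goes in `f ∘ᵢ g`
(`f` of arity `n`, `g` of arity `m`, `f ∘ᵢ g` of arity `r = n + m - 1`; inputs start at `0`). -/
def innerIdx {n m r : ℕ} (h : n + m = r + 1) (i : Fin n) (j : Fin m) : Fin r :=
  ⟨i + j, by omega⟩

/-- Where the input `j ≠ i` of the outer operation goes in `f ∘ᵢ g`. -/
def outerIdx {n m r : ℕ} (h : n + m = r + 1) (i j : Fin n) (hj : j ≠ i) : Fin r :=
  ⟨if j < i then j else j + m - 1, by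
    have := Fin.val_ne_of_ne hj
    split_ifs with h1
    · have := Fin.lt_def.mp h1
      omega
    · have : ¬ (j : ℕ) < i := fun h2 => h1 (Fin.lt_def.mpr h2)
      omega⟩

/-- The data underlying a dg-operad of abelian groups. The component of arity `n` and
(cohomological) degree `a` is the subgroup `deg n a` of an ambient abelian group `X n`; the
operations are given by formulas on the ambient groups, and only their values on the
components `deg n a` matter. The `Σₙ`-action is written from the left:
`perm σ f` has as its input `σ i` the input `i` of `f`. -/
structure OperadData where
  X : ℕ → Type
  [grp : ∀ n, AddCommGroup (X n)]
  deg : ∀ n, ℤ → AddSubgroup (X n)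
  d : ∀ {n}, X n → X n
  one : X 1
  perm : ∀ {n}, Equiv.Perm (Fin n) → X n → X n
  comp : ∀ {n m r}, n + m = r + 1 → Fin n → X n → X m → X r

attribute [instance] OperadData.grp

/-- The laws of a unital symmetric dg-operad (differential of degree `+1`, Koszul signs). -/
structure IsDGOperad (P : OperadData) : Prop where
  -- the components form complexes of abelian groups
  d_mem : ∀ {n a} {f : P.X n}, f ∈ P.deg n a → P.d f ∈ P.deg n (a + 1)
  d_add : ∀ {n a} {f g : P.X n}, f ∈ P.deg n a → g ∈ P.deg n a → P.d (f + g) = P.d f + P.d g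
  d_d : ∀ {n a} {f : P.X n}, f ∈ P.deg n a → P.d (P.d f) = 0
  -- the symmetric groups act by maps of complexes
  perm_mem : ∀ {n a} (σ : Equiv.Perm (Fin n)) {f : P.X n},
    f ∈ P.deg n a → P.perm σ f ∈ P.deg n a
  perm_add : ∀ {n a} (σ : Equiv.Perm (Fin n)) {f g : P.X n}, f ∈ P.deg n a → g ∈ P.deg n a →
    P.perm σ (f + g) = P.perm σ f + P.perm σ g
  perm_one : ∀ {n a} {f : P.X n}, f ∈ P.deg n a → P.perm 1 f = f
  perm_mul : ∀ {n a} (σ τ : Equiv.Perm (Fin n)) {f : P.X n}, f ∈ P.deg n a →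
    P.perm (σ * τ) f = P.perm σ (P.perm τ f)
  d_perm : ∀ {n a} (σ : Equiv.Perm (Fin n)) {f : P.X n}, f ∈ P.deg n a →
    P.d (P.perm σ f) = P.perm σ (P.d f)
  -- the compositions are bilinear, of degree `0`, and maps of complexes
  comp_mem : ∀ {n m r a b} (h : n + m = r + 1) (i : Fin n) {f : P.X n} {g : P.X m},
    f ∈ P.deg n a → g ∈ P.deg m b → P.comp h i f g ∈ P.deg r (a + b)
  comp_add_left : ∀ {n m r a b} (h : n + m = r + 1) (i : Fin n) {f f' : P.X n} {g : P.X m},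
    f ∈ P.deg n a → f' ∈ P.deg n a → g ∈ P.deg m b →
    P.comp h i (f + f') g = P.comp h i f g + P.comp h i f' g
  comp_add_right : ∀ {n m r a b} (h : n + m = r + 1) (i : Fin n) {f : P.X n} {g g' : P.X m},
    f ∈ P.deg n a → g ∈ P.deg m b → g' ∈ P.deg m b →
    P.comp h i f (g + g') = P.comp h i f g + P.comp h i f g'
  d_comp : ∀ {n m r a b} (h : n + m = r + 1) (i : Fin n) {f : P.X n} {g : P.X m},
    f ∈ P.deg n a → g ∈ P.deg m b →
    P.d (P.comp h i f g) = P.comp h i (P.d f) g + (a.negOnePow : ℤ) • P.comp h i f (P.d g)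
  -- the unit
  one_mem : P.one ∈ P.deg 1 0
  d_one : P.d P.one = 0
  one_comp : ∀ {n a} (h : 1 + n = n + 1) {f : P.X n}, f ∈ P.deg n a →
    P.comp h 0 P.one f = f
  comp_one : ∀ {n a} (i : Fin n) {f : P.X n}, f ∈ P.deg n a →
    P.comp (rfl : n + 1 = n + 1) i f P.one = f
  -- sequential and parallel associativity
  assoc_seq : ∀ {n m p r s t a b e} (h₁ : n + m = r + 1) (h₂ : r + p = t + 1)
    (h₃ : m + p = s + 1) (h₄ : n + s = t + 1) (i : Fin n) (j : Fin m)
    {f : P.X n} {g : P.X m} {k : P.X p}, f ∈ P.deg n a → g ∈ P.deg m b → k ∈ P.deg p e →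
    P.comp h₂ (innerIdx h₁ i j) (P.comp h₁ i f g) k = P.comp h₄ i f (P.comp h₃ j g k)
  assoc_par : ∀ {n m p r s t a b e} (h₁ : n + m = r + 1) (h₂ : r + p = t + 1)
    (h₃ : n + p = s + 1) (h₄ : s + m = t + 1) (i j : Fin n) (hij : i ≠ j)
    {f : P.X n} {g : P.X m} {k : P.X p}, f ∈ P.deg n a → g ∈ P.deg m b → k ∈ P.deg p e →
    P.comp h₂ (outerIdx h₁ i j hij.symm) (P.comp h₁ i f g) k =
      ((b * e).negOnePow : ℤ) • P.comp h₄ (outerIdx h₃ j i hij) (P.comp h₃ j f k) g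
  -- equivariance; `ρ` is the permutation of the inputs of `f ∘ᵢ g` induced by `σ` and `τ`
  equivariance : ∀ {n m r a b} (h : n + m = r + 1) (i : Fin n) (σ : Equiv.Perm (Fin n))
    (τ : Equiv.Perm (Fin m)) (ρ : Equiv.Perm (Fin r)),
    (∀ j, ρ (innerIdx h i j) = innerIdx h (σ i) (τ j)) →
    (∀ j (hj : j ≠ i), ρ (outerIdx h i j hj) = outerIdx h (σ i) (σ j) (σ.injective.ne hj)) →
    ∀ {f : P.X n} {g : P.X m}, f ∈ P.deg n a → g ∈ P.deg m b →
    P.comp h (σ i) (P.perm σ f) (P.perm τ g) = P.perm ρ (P.comp h i f g)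

/-- Morphisms of dg-operads. -/
structure IsDGOperadHom (P Q : OperadData) (φ : ∀ n, P.X n → Q.X n) : Prop where
  map_mem : ∀ {n a} {f : P.X n}, f ∈ P.deg n a → φ n f ∈ Q.deg n a
  map_add : ∀ {n a} {f g : P.X n}, f ∈ P.deg n a → g ∈ P.deg n a →
    φ n (f + g) = φ n f + φ n g
  map_d : ∀ {n a} {f : P.X n}, f ∈ P.deg n a → φ n (P.d f) = Q.d (φ n f)
  map_one : φ 1 P.one = Q.one
  map_perm : ∀ {n a} (σ : Equiv.Perm (Fin n)) {f : P.X n}, f ∈ P.deg n a →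
    φ n (P.perm σ f) = Q.perm σ (φ n f)
  map_comp : ∀ {n m r a b} (h : n + m = r + 1) (i : Fin n) {f : P.X n} {g : P.X m},
    f ∈ P.deg n a → g ∈ P.deg m b →
    φ r (P.comp h i f g) = Q.comp h i (φ n f) (φ m g)

/-- Inclusions of dg-operads: morphisms that are injective on every component. -/
structure IsDGOperadInclusion (P Q : OperadData) (φ : ∀ n, P.X n → Q.X n) : Prop
    extends IsDGOperadHom P Q φ where
  injOn : ∀ n a, Set.InjOn (φ n) (P.deg n a)

end Operadic

/-! ### The lattice path operad -/

namespace LatticePath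

open Operadic

/-- A marked lattice path in an `n`-dimensional grid, starting at the origin, read from its start
to its end: `some i` is a step that increases the `i`-th coordinate by one, and `none` is one unit
of marking at the point reached so far. Thus `m₀` times `none`, `some u₁`, `m₁` times `none`,
`some u₂`, … is the path with steps `u₁, u₂, …` whose points are marked by `m₀, m₁, …`.
Equivalently, the `l` letters `none` cut the path into the `l + 1` consecutive edge-paths that are
the values of a functor from `[l + 1]` to the free category on the grid. -/
abbrev Word (n : ℕ) := List (Option (Fin n))

variable {n m r : ℕ}

/-- The sum of the markings. -/
def marks (w : Word n) : ℕ := w.count none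

/-- The number `kᵢ`, where `kᵢ + 1` is the length of the grid in the direction `i`. -/
def dim (w : Word n) (i : Fin n) : ℕ := w.count (some i) - 1

/-- The degree `l - (k₁ + ⋯ + kₙ)` of a marked path. -/
def wdeg (w : Word n) : ℤ := (marks w : ℤ) - ∑ i, (dim w i : ℤ)

/-- The projection of a path to the `(i, j)`-face (the marking is discarded). -/
def proj (i j : Fin n) (w : Word n) : Word n :=
  w.filter fun x => x = some i ∨ x = some j

/-- The number of angles of an unmarked path: the points at which it changes its direction. -/
def angles (w : Word n) : ℕ := (w.zip w.tail).countP fun x => x.1 ≠ x.2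

/-- `Lat c k l` is the set of marked lattice paths from `(0, …, 0)` to `(k₁ + 1, …, kₙ + 1)`, with
total marking `l` and complexity at most `c` (with `c = ∞` allowed). -/
def Lat (c : ℕ∞) (k : Fin n → ℕ) (l : ℕ) : Set (Word n) :=
  {w | (∀ i, w.count (some i) = k i + 1) ∧ w.count none = l ∧
    ∀ i j, i < j → (angles (proj i j w) : ℕ∞) ≤ c}

/-- The union of the sets `Lat c k l` over all `k` with `l - (k₁ + ⋯ + kₙ) = a`. -/
def LatDeg (c : ℕ∞) (n l : ℕ) (a : ℤ) : Set (Word n) :=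
  {w | ∃ k : Fin n → ℕ, (l : ℤ) - ∑ i, (k i : ℤ) = a ∧ w ∈ Lat c k l}

/-- The composition `p ∘ᵢ q` in the coloured operad of lattice paths, as composition of functors:
the marks of `q` cut it into segments, and the successive steps of `p` in the direction `i` are
replaced by the successive segments. The other steps are renumbered. -/
def substWord (h : n + m = r + 1) (i : Fin n) : Word n → List (Word m) → Word r
  | [], _ => []
  | none :: w, S => none :: substWord h i w S
  | some j :: w, S =>
    if hj : j = i then (S.headD []).map (Option.map (innerIdx h i)) ++ substWord h i w S.tail
    else some (outerIdx h i j hj) :: substWord h i w S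

def compWord (h : n + m = r + 1) (i : Fin n) (p : Word n) (q : Word m) : Word r :=
  substWord h i p (q.splitOn none)

/-- The action of permutations on paths, permuting the coordinates. -/
def permWord (σ : Equiv.Perm (Fin n)) (w : Word n) : Word n := w.map (Option.map σ)

/-- The `i`-th simplicial boundary in the direction `s` contracts the `i`-th column, i.e. it removes
the `i`-th step (counted from `0`) in the direction `s` and adds the markings of its ends. -/
def faceWord (s : Fin n) : ℕ → Word n → Word n
  | _, [] => []
  | 0, x :: w => if x = some s then w else x :: faceWord s 0 w
  | i + 1, x :: w => if x = some s then x :: faceWord s i w else x :: faceWord s (i + 1) w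

/-- The `i`-th cosimplicial boundary increases by one the marking of the point `φ(i)`, i.e.
of the starting point if `i = 0`, of the point bearing the `i`-th mark if `1 ≤ i ≤ l`, and of the
end point if `i = l + 1`. -/
def cofaceWord : ℕ → Word n → Word n
  | 0, w => none :: w
  | _ + 1, [] => [none]
  | i + 1, none :: w => none :: cofaceWord i w
  | i + 1, some a :: w => some a :: cofaceWord (i + 1) w

noncomputable section

/-- The differential `∂ = ∂¹ + ⋯ + ∂ⁿ` of the simplicial totalization. -/
def bdry (x : Word n →₀ ℤ) : Word n →₀ ℤ :=
  x.sum fun w a => ∑ s : Fin n, if dim w s = 0 then 0 else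
    ∑ i ∈ Finset.range (dim w s + 1),
      Finsupp.single (faceWord s i w) (a * (-1) ^ (∑ t ∈ Finset.Iio s, dim w t + i))

/-- The cosimplicial differential `δ`, an alternating sum of the cosimplicial boundaries, with the
overall sign `-(-1)^|w|` of the second term of `df - (-1)^|f| fd`. -/
def cobdry (x : Word n →₀ ℤ) : Word n →₀ ℤ :=
  x.sum fun w a => ∑ i ∈ Finset.range (marks w + 2),
    Finsupp.single (cofaceWord i w) (a * ((wdeg w + 1 + i).negOnePow : ℤ))

/-- The symmetric group action, with the Koszul sign of the permutation of `n` elements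
of degrees `k₁, …, kₙ`. -/
def permLin (σ : Equiv.Perm (Fin n)) (x : Word n →₀ ℤ) : Word n →₀ ℤ :=
  x.sum fun w a => Finsupp.single (permWord σ w)
    (a * (-1) ^ (∑ i, ∑ j, if i < j ∧ σ j < σ i then dim w i * dim w j else 0))

/-- `∑ₚ p ∘ᵢ y_{kᵢ(p)}`, the composition in the coloured operad of the terms `p` of `x` with the
component of `y` of the matching colour `kᵢ(p)`, with the Koszul sign
`(-1)^(|p||q|) (-1)^(|q|(k₁ + ⋯ + k_{i-1}))` of the dg-setting. -/
def circ (h : n + m = r + 1) (i : Fin n) (x : Word n →₀ ℤ) (y : ℕ → Word m →₀ ℤ) :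
    Word r →₀ ℤ :=
  x.sum fun p a => (y (dim p i)).sum fun q b => Finsupp.single (compWord h i p q)
    (a * b * ((wdeg q * (wdeg p + ∑ j ∈ Finset.Iio i, (dim p j : ℤ))).negOnePow : ℤ))

/-- The unit `i ↦ i` of colour `l` of the coloured operad: the path of length `l + 1` in direction
`0`, all of whose interior points are marked by one. -/
def unitWord (l : ℕ) : Word 1 := some 0 :: (List.replicate l [none, some 0]).flatten

/-- The operad `|Lat_c|`: its component of arity `n` and degree `a` is the product over `l` of the
direct sums of the free abelian groups on `Lat c k l`, `l - (k₁ + ⋯ + kₙ) = a`. The operations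
are those of the coendomorphism operad (condensation): an element `f = (f_l)` of arity `n` is the
map that sends the fundamental chain `e_l` of the `l`-simplex to the sum of the terms
`p ⊗ (e_{k₁} ⊗ ⋯ ⊗ e_{kₙ})`, `p` running over the terms of `f_l`; the differential is
`df - (-1)^|f| fd`, and `f ∘ᵢ g` is `(-1)^(|f||g|) (1 ⊗ ⋯ ⊗ g ⊗ ⋯ ⊗ 1) f`. -/
def latTot (c : ℕ∞) : OperadData where
  X n := ℕ → Word n →₀ ℤ
  deg n a := AddSubgroup.pi Set.univ
    fun l => (Finsupp.supported ℤ ℤ (LatDeg c n l a)).toAddSubgroup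
  d x
    | 0 => bdry (x 0)
    | l + 1 => bdry (x (l + 1)) + cobdry (x l)
  one l := Finsupp.single (unitWord l) 1
  perm σ x l := permLin σ (x l)
  comp h i x y l := circ h i (x l) y

/-- The marked path obtained from an unmarked path `p` by inserting, for each `j`, `s j` new
internal points, marked by one, inside the `j`-th step of `p`. -/
def insertPoints (p : Word n) (s : Fin p.length → ℕ) : Word n :=
  (List.ofFn fun j => p.get j :: (List.replicate (s j) [none, p.get j]).flatten).flatten

/-- All marked paths obtained from `p` by inserting precisely `s` new internal points
marked by one. -/
def whiskers (s : ℕ) (p : Word n) : Finset (Word n) :=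
  (Finset.piAntidiag Finset.univ s).image (insertPoints p)

/-- The `s`-th component `w_s` of the whiskering, where the sign of the term `q` of `w_s(p)` is
`ε n p q`. -/
def whiskS (ε : (n : ℕ) → Word n → Word n → ℤˣ) (s : ℕ) (x : Word n →₀ ℤ) : Word n →₀ ℤ :=
  x.sum fun p a => ∑ q ∈ whiskers s p, Finsupp.single q (a * (ε n p q : ℤ))

/-- The whiskering `w = ∏ w_s`. -/
def whisk (ε : (n : ℕ) → Word n → Word n → ℤˣ) (n : ℕ) (x : Word n →₀ ℤ) : ℕ → Word n →₀ ℤ :=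
  fun s => whiskS ε s x

/-- `Br_c`: the simplicial totalization of `Lat c k 0`, with the compositions
`p ∘ᵢ w_{aᵢ}(q)`. -/
def brace (c : ℕ∞) (ε : (n : ℕ) → Word n → Word n → ℤˣ) : OperadData where
  X n := Word n →₀ ℤ
  deg n a := (Finsupp.supported ℤ ℤ (LatDeg c n 0 a)).toAddSubgroup
  d x := bdry x
  one := Finsupp.single [some 0] 1
  perm σ x := permLin σ x
  comp h i x y := circ h i x (whisk ε _ y)

end

end LatticePath

/-!
All operations are signed sums of words, and each sign depends on the degrees in a complicated way.
The signs become transparent after a change of basis: every word `w` is multiplied by the sign with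
exponent `twist w`, a linear involution `tw`. In the new basis all letters of a word, steps as well
as marks, are odd elements of a free algebra, and

* the simplicial differential is the superderivation `rm` that sends every step to `1`, followed by
  the projection `pr` to the words in which all directions occur (`bdry_bas`);
* the cosimplicial differential is the superderivation `dup` that sends a step `a` to
  `none * a + a * none` and `none` to its square (`cobdry_bas`);
* permutations act by renumbering the letters, up to the sign of the permutation (`permLin_bas`);
* the composition `p ∘ᵢ q` is the substitution `mul` of `q * none` into `p`, which carries the
  Koszul sign for odd letters, up to a global sign `compSign` that depends only on the degrees and
  arities (`circ_eq`).

The laws of a dg-operad for `latTot` now follow letter by letter. The differential squares to zero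
since `rm` and `dup` are anticommuting derivations of square zero (`rm_rm`, `dup_dup`, `rm_dup`).
The Leibniz rule is `rm_mul_app` and `dup_mul`, associativity is `mul_mul_app` and `mul_mul_comm`,
and equivariance is `mul_rel`; what remains in each case is an identity between the global signs,
modulo two. The elements of `latTot` have infinitely many components, but only finitely many of them
contribute to a composition, and therefore it suffices to work with truncated sums. The bound on the
complexity is preserved because the projections of the results arise from those of the arguments by
deleting and repeating letters (`Thins`).

With the signs `whiskerSign`, the whiskering is in the new basis the multiplicative extension `wh`
of `a ↦ a - a * none * a + a * none * a * none * a - ⋯`. Since `rm` sends `a * none * a` to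
`none * a + a * none`, which is the value of `dup` on `a`, the whiskering is a map of complexes
(`wh_rm`). Since it is multiplicative, it is compatible with substitutions of whiskered words
(`mul_wh_whT`). Its component `0` is the identity, hence it is injective, and the laws for `brace`
are inherited from those for `latTot` (`IsDGOperadInclusion.isDGOperad`).
-/

/-! ### Transfer of the laws along an inclusion -/

namespace Operadic

/-- A collection of complexes that is closed under operations that an injective map identifies with
those of a dg-operad is a dg-operad. -/
theorem IsDGOperadInclusion.isDGOperad {P Q : OperadData} {φ : ∀ n, P.X n → Q.X n}
    (hφ : IsDGOperadInclusion P Q φ) (hQ : IsDGOperad Q)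
    (d_mem : ∀ {n a} {f : P.X n}, f ∈ P.deg n a → P.d f ∈ P.deg n (a + 1))
    (perm_mem : ∀ {n a} (σ : Equiv.Perm (Fin n)) {f : P.X n},
      f ∈ P.deg n a → P.perm σ f ∈ P.deg n a)
    (comp_mem : ∀ {n m r a b} (h : n + m = r + 1) (i : Fin n) {f : P.X n} {g : P.X m},
      f ∈ P.deg n a → g ∈ P.deg m b → P.comp h i f g ∈ P.deg r (a + b))
    (one_mem : P.one ∈ P.deg 1 0) : IsDGOperad P := by
  have map_zero : ∀ n, φ n 0 = 0 := fun n => by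
    have := hφ.map_add (P.deg n 0).zero_mem (P.deg n 0).zero_mem
    rwa [add_zero, left_eq_add] at this
  have map_zsmul : ∀ {n a} (k : ℤ) {f : P.X n}, f ∈ P.deg n a → φ n (k • f) = k • φ n f :=
    fun {n a} k f hf => map_zsmul (AddMonoidHom.mk' (fun g : P.deg n a => φ n g)
      fun g g' => hφ.map_add g.2 g'.2) k ⟨f, hf⟩
  constructor
  case d_mem => exact d_mem
  case perm_mem => exact perm_mem
  case comp_mem => exact comp_mem
  case one_mem => exact one_mem
  case d_add =>
    intro n a f g hf hg
    refine hφ.injOn n (a + 1) (d_mem (add_mem hf hg)) (add_mem (d_mem hf) (d_mem hg)) ?_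
    rw [hφ.map_d (add_mem hf hg), hφ.map_add (d_mem hf) (d_mem hg), hφ.map_d hf, hφ.map_d hg,
      hφ.map_add hf hg, hQ.d_add (hφ.map_mem hf) (hφ.map_mem hg)]
  case d_d =>
    intro n a f hf
    refine hφ.injOn n _ (d_mem (d_mem hf)) (zero_mem _) ?_
    rw [hφ.map_d (d_mem hf), hφ.map_d hf, hQ.d_d (hφ.map_mem hf), map_zero]
  case perm_add =>
    intro n a σ f g hf hg
    refine hφ.injOn n a (perm_mem σ (add_mem hf hg)) (add_mem (perm_mem σ hf) (perm_mem σ hg)) ?_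
    rw [hφ.map_perm σ (add_mem hf hg), hφ.map_add (perm_mem σ hf) (perm_mem σ hg),
      hφ.map_perm σ hf, hφ.map_perm σ hg, hφ.map_add hf hg,
      hQ.perm_add σ (hφ.map_mem hf) (hφ.map_mem hg)]
  case perm_one =>
    intro n a f hf
    refine hφ.injOn n a (perm_mem 1 hf) hf ?_
    rw [hφ.map_perm 1 hf, hQ.perm_one (hφ.map_mem hf)]
  case perm_mul =>
    intro n a σ τ f hf
    refine hφ.injOn n a (perm_mem _ hf) (perm_mem σ (perm_mem τ hf)) ?_
    rw [hφ.map_perm _ hf, hφ.map_perm σ (perm_mem τ hf), hφ.map_perm τ hf,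
      hQ.perm_mul σ τ (hφ.map_mem hf)]
  case d_perm =>
    intro n a σ f hf
    refine hφ.injOn n _ (d_mem (perm_mem σ hf)) (perm_mem σ (d_mem hf)) ?_
    rw [hφ.map_d (perm_mem σ hf), hφ.map_perm σ hf, hφ.map_perm σ (d_mem hf), hφ.map_d hf,
      hQ.d_perm σ (hφ.map_mem hf)]
  case comp_add_left =>
    intro n m r a b h i f f' g hf hf' hg
    refine hφ.injOn r (a + b) (comp_mem h i (add_mem hf hf') hg)
      (add_mem (comp_mem h i hf hg) (comp_mem h i hf' hg)) ?_
    rw [hφ.map_comp h i (add_mem hf hf') hg,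
      hφ.map_add (comp_mem h i hf hg) (comp_mem h i hf' hg), hφ.map_comp h i hf hg,
      hφ.map_comp h i hf' hg, hφ.map_add hf hf',
      hQ.comp_add_left h i (hφ.map_mem hf) (hφ.map_mem hf') (hφ.map_mem hg)]
  case comp_add_right =>
    intro n m r a b h i f g g' hf hg hg'
    refine hφ.injOn r (a + b) (comp_mem h i hf (add_mem hg hg'))
      (add_mem (comp_mem h i hf hg) (comp_mem h i hf hg')) ?_
    rw [hφ.map_comp h i hf (add_mem hg hg'),
      hφ.map_add (comp_mem h i hf hg) (comp_mem h i hf hg'), hφ.map_comp h i hf hg,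
      hφ.map_comp h i hf hg', hφ.map_add hg hg',
      hQ.comp_add_right h i (hφ.map_mem hf) (hφ.map_mem hg) (hφ.map_mem hg')]
  case d_comp =>
    intro n m r a b h i f g hf hg
    have h₁ : P.comp h i (P.d f) g ∈ P.deg r (a + b + 1) := by
      have := comp_mem h i (d_mem hf) hg
      rwa [add_right_comm] at this
    have h₂ : P.comp h i f (P.d g) ∈ P.deg r (a + b + 1) := by
      have := comp_mem h i hf (d_mem hg)
      rwa [← add_assoc] at this
    refine hφ.injOn r (a + b + 1) (d_mem (comp_mem h i hf hg))
      (add_mem h₁ (zsmul_mem h₂ _)) ?_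
    rw [hφ.map_d (comp_mem h i hf hg), hφ.map_comp h i hf hg, hφ.map_add h₁ (zsmul_mem h₂ _),
      map_zsmul _ h₂, hφ.map_comp h i (d_mem hf) hg, hφ.map_comp h i hf (d_mem hg), hφ.map_d hf,
      hφ.map_d hg, hQ.d_comp h i (hφ.map_mem hf) (hφ.map_mem hg)]
  case d_one =>
    refine hφ.injOn 1 _ (d_mem one_mem) (zero_mem _) ?_
    rw [hφ.map_d one_mem, hφ.map_one, hQ.d_one, map_zero]
  case one_comp =>
    intro n a h f hf
    have h₁ : P.comp h 0 P.one f ∈ P.deg n a := by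
      have := comp_mem h 0 one_mem hf
      rwa [zero_add] at this
    refine hφ.injOn n a h₁ hf ?_
    rw [hφ.map_comp h 0 one_mem hf, hφ.map_one, hQ.one_comp h (hφ.map_mem hf)]
  case comp_one =>
    intro n a i f hf
    have h₁ : P.comp rfl i f P.one ∈ P.deg n a := by
      have := comp_mem (rfl : n + 1 = n + 1) i hf one_mem
      rwa [add_zero] at this
    refine hφ.injOn n a h₁ hf ?_
    rw [hφ.map_comp rfl i hf one_mem, hφ.map_one, hQ.comp_one i (hφ.map_mem hf)]
  case assoc_seq =>
    intro n m p r s t a b e h₁ h₂ h₃ h₄ i j f g k hf hg hk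
    have hl := comp_mem h₂ (innerIdx h₁ i j) (comp_mem h₁ i hf hg) hk
    rw [add_assoc] at hl
    refine hφ.injOn t _ hl (comp_mem h₄ i hf (comp_mem h₃ j hg hk)) ?_
    rw [hφ.map_comp h₂ _ (comp_mem h₁ i hf hg) hk, hφ.map_comp h₁ i hf hg,
      hφ.map_comp h₄ i hf (comp_mem h₃ j hg hk), hφ.map_comp h₃ j hg hk,
      hQ.assoc_seq h₁ h₂ h₃ h₄ i j (hφ.map_mem hf) (hφ.map_mem hg) (hφ.map_mem hk)]
  case assoc_par =>
    intro n m p r s t a b e h₁ h₂ h₃ h₄ i j hij f g k hf hg hk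
    have hr := comp_mem h₄ (outerIdx h₃ j i hij) (comp_mem h₃ j hf hk) hg
    rw [add_right_comm] at hr
    refine hφ.injOn t _ (comp_mem h₂ _ (comp_mem h₁ i hf hg) hk) (zsmul_mem hr _) ?_
    rw [map_zsmul _ hr, hφ.map_comp h₂ _ (comp_mem h₁ i hf hg) hk, hφ.map_comp h₁ i hf hg,
      hφ.map_comp h₄ _ (comp_mem h₃ j hf hk) hg, hφ.map_comp h₃ j hf hk,
      hQ.assoc_par h₁ h₂ h₃ h₄ i j hij (hφ.map_mem hf) (hφ.map_mem hg) (hφ.map_mem hk)]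
  case equivariance =>
    intro n m r a b h i σ τ ρ hin hout f g hf hg
    refine hφ.injOn r (a + b) (comp_mem h (σ i) (perm_mem σ hf) (perm_mem τ hg))
      (perm_mem ρ (comp_mem h i hf hg)) ?_
    rw [hφ.map_comp h (σ i) (perm_mem σ hf) (perm_mem τ hg), hφ.map_perm σ hf, hφ.map_perm τ hg,
      hφ.map_perm ρ (comp_mem h i hf hg), hφ.map_comp h i hf hg,
      hQ.equivariance h i σ τ ρ hin hout (hφ.map_mem hf) (hφ.map_mem hg)]

end Operadic

namespace LatticePath
open Operadic
noncomputable section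
variable {n m r : ℕ}

/-! ### Signs -/

/-- The nontrivial character `ZMod 2 → {±1}`. All sign exponents are computed in `ZMod 2`. -/
def sgn (e : ZMod 2) : ℤ := if e = 0 then 1 else -1

@[simp] theorem sgn_zero : sgn 0 = 1 := rfl

theorem sgn_one : sgn 1 = -1 := rfl

theorem sgn_add : ∀ a b : ZMod 2, sgn (a + b) = sgn a * sgn b := by decide

theorem sgn_mul_self : ∀ a : ZMod 2, sgn a * sgn a = 1 := by decide

theorem sgn_add_one (a : ZMod 2) : sgn (a + 1) = -sgn a := by
  rw [sgn_add, sgn_one, mul_neg, mul_one]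

theorem sgn_smul_sgn_smul {M : Type*} [AddCommGroup M] (a b : ZMod 2) (v : M) :
    sgn a • sgn b • v = sgn (a + b) • v := by
  rw [smul_smul, sgn_add]

theorem neg_one_pow_eq_sgn (k : ℕ) : (-1 : ℤ) ^ k = sgn k := by
  induction k with
  | zero => rfl
  | succ k ih => rw [pow_succ, ih, Nat.cast_succ, sgn_add_one, mul_neg, mul_one]

theorem negOnePow_eq_sgn (k : ℤ) : (k.negOnePow : ℤ) = sgn k := by
  rcases Int.even_or_odd k with h | h
  · rw [Int.negOnePow_even k h, (ZMod.intCast_eq_zero_iff_even).2 h]; rfl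
  · rw [Int.negOnePow_odd k h, (ZMod.intCast_eq_one_iff_odd).2 h]; rfl

/-! ### Formal sums of words -/

/-- Formal sums of marked paths. -/
abbrev Chain (n : ℕ) := Word n →₀ ℤ

/-- The word `w` as a basis element. -/
def bas (w : Word n) : Chain n := Finsupp.single w 1

/-- Linear extension of a map defined on words. -/
def lift {M : Type*} [AddCommGroup M] (f : Word n → M) : Chain n →ₗ[ℤ] M :=
  Finsupp.linearCombination ℤ f

@[simp] theorem lift_bas {M : Type*} [AddCommGroup M] (f : Word n → M) (w : Word n) :
    lift f (bas w) = f w := by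
  simp [lift, bas]

theorem single_eq_smul_bas (w : Word n) (a : ℤ) : Finsupp.single w a = a • bas w := by
  simp [bas]

theorem eq_of_bas {M : Type*} [AddCommGroup M] (f g : Chain n →ₗ[ℤ] M)
    (h : ∀ w, f (bas w) = g (bas w)) (v : Chain n) : f v = g v := by
  have : f = g := by
    refine Finsupp.lhom_ext' fun w => LinearMap.ext_ring (h w)
  rw [this]

/-- An additive map is determined by its values on the support. -/
theorem eq_of_bas_of_supported {M : Type*} [AddCommGroup M] {S : Set (Word n)}
    (f g : Chain n →ₗ[ℤ] M) (h : ∀ w ∈ S, f (bas w) = g (bas w)) {v : Chain n}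
    (hv : v ∈ Finsupp.supported ℤ ℤ S) : f v = g v := by
  rw [Finsupp.supported_eq_span_single] at hv
  refine LinearMap.eqOn_span (f := f) (g := g) ?_ hv
  rintro _ ⟨w, hw, rfl⟩
  exact h w hw

theorem bas_mem_supported {S : Set (Word n)} {w : Word n} (hw : w ∈ S) :
    bas w ∈ Finsupp.supported ℤ ℤ S :=
  Finsupp.single_mem_supported ℤ 1 hw

theorem map_mem_supported {f : Chain n →ₗ[ℤ] Chain m} {S : Set (Word n)} {T : Set (Word m)}
    (H : ∀ w ∈ S, f (bas w) ∈ Finsupp.supported ℤ ℤ T) {v : Chain n}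
    (hv : v ∈ Finsupp.supported ℤ ℤ S) : f v ∈ Finsupp.supported ℤ ℤ T := by
  rw [Finsupp.supported_eq_span_single] at hv
  have : Submodule.span ℤ ((fun w => Finsupp.single w (1 : ℤ)) '' S) ≤
      (Finsupp.supported ℤ ℤ T).comap f :=
    Submodule.span_le.2 (by rintro _ ⟨w, hw, rfl⟩; exact H w hw)
  exact this hv

/-- Left multiplication by a letter. -/
def consL (x : Option (Fin n)) : Chain n →ₗ[ℤ] Chain n := Finsupp.lmapDomain ℤ ℤ (List.cons x)

@[simp] theorem bas_cons (x : Option (Fin n)) (w : Word n) : bas (x :: w) = consL x (bas w) := by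
  simp [consL, bas]

/-- Right multiplication by the letter `none`. -/
def app : Chain n →ₗ[ℤ] Chain n := Finsupp.lmapDomain ℤ ℤ (· ++ [none])

theorem app_bas (w : Word n) : app (bas w) = bas (w ++ [none]) := by
  simp [app, bas]

@[simp] theorem app_nil : app (bas ([] : Word n)) = consL none (bas []) := by
  rw [app_bas, List.nil_append, bas_cons]

@[simp] theorem app_consL (x : Option (Fin n)) (v : Chain n) : app (consL x v) = consL x (app v) :=
  eq_of_bas (app ∘ₗ consL x) (consL x ∘ₗ app) (fun w => by
    rw [LinearMap.comp_apply, LinearMap.comp_apply, ← bas_cons, app_bas, app_bas, List.cons_append,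
      bas_cons]) v

/-- The parity operator: `w` is multiplied by `(-1)` to its length. -/
def par : Chain n →ₗ[ℤ] Chain n := lift fun w => sgn w.length • bas w

theorem par_bas (w : Word n) : par (bas w) = sgn w.length • bas w := by
  simp [par]

@[simp] theorem par_nil : par (bas ([] : Word n)) = bas [] := by simp [par_bas]

@[simp] theorem par_consL (x : Option (Fin n)) (v : Chain n) :
    par (consL x v) = -consL x (par v) :=
  eq_of_bas (par ∘ₗ consL x) (-(consL x ∘ₗ par)) (fun w => by
    simp [par_bas, sgn_add_one, ← bas_cons]) v

@[simp] theorem par_par (v : Chain n) : par (par v) = v :=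
  eq_of_bas (par ∘ₗ par) LinearMap.id (fun w => by
    simp [par_bas, smul_smul, sgn_mul_self]) v

/-! ### The differential as a derivation -/

/-- The superderivation of the free algebra on the letters, all of which are odd, that sends each
step to `1` and kills `none`. -/
def rmW : Word n → Chain n
  | [] => 0
  | none :: w => -consL none (rmW w)
  | some a :: w => bas w - consL (some a) (rmW w)

/-- The linear extension of `rmW`: up to a change of signs and the faces that are not full, the
differential `bdry`. -/
def rm : Chain n →ₗ[ℤ] Chain n := lift rmW

/-- The superderivation of the free algebra on the letters that sends a step `a` to the
supercommutator of `none` and `a`, and `none` to its square. -/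
def dupW : Word n → Chain n
  | [] => 0
  | none :: w => bas (none :: none :: w) - consL none (dupW w)
  | some a :: w => bas (none :: some a :: w) + bas (some a :: none :: w) - consL (some a) (dupW w)

/-- The linear extension of `dupW`: up to a change of signs, the differential `cobdry`. -/
def dup : Chain n →ₗ[ℤ] Chain n := lift dupW

@[simp] theorem rm_nil : rm (bas ([] : Word n)) = 0 := by simp [rm, rmW]

@[simp] theorem rm_none (v : Chain n) : rm (consL none v) = -consL none (rm v) :=
  eq_of_bas (rm ∘ₗ consL none) (-(consL none ∘ₗ rm)) (fun w => by simp [rm, rmW, ← bas_cons]) v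

@[simp] theorem rm_some (a : Fin n) (v : Chain n) :
    rm (consL (some a) v) = v - consL (some a) (rm v) :=
  eq_of_bas (rm ∘ₗ consL (some a)) (LinearMap.id - (consL (some a) ∘ₗ rm))
    (fun w => by simp [rm, rmW, ← bas_cons]) v

@[simp] theorem dup_nil : dup (bas ([] : Word n)) = 0 := by simp [dup, dupW]

@[simp] theorem dup_none (v : Chain n) :
    dup (consL none v) = consL none (consL none v) - consL none (dup v) :=
  eq_of_bas (dup ∘ₗ consL none) ((consL none ∘ₗ consL none) - (consL none ∘ₗ dup))
    (fun w => by simp [dup, dupW, ← bas_cons]) v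

@[simp] theorem dup_some (a : Fin n) (v : Chain n) :
    dup (consL (some a) v) =
      consL none (consL (some a) v) + consL (some a) (consL none v) - consL (some a) (dup v) :=
  eq_of_bas (dup ∘ₗ consL (some a)) ((consL none ∘ₗ consL (some a)) +
    (consL (some a) ∘ₗ consL none) - (consL (some a) ∘ₗ dup))
    (fun w => by simp [dup, dupW, ← bas_cons]) v

theorem rm_rm (v : Chain n) : rm (rm v) = 0 := by
  refine eq_of_bas (rm ∘ₗ rm) 0 (fun w => ?_) v
  induction w with
  | nil => simp
  | cons x w ih =>
    rcases x with _ | a <;> simp_all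

theorem dup_dup (v : Chain n) : dup (dup v) = 0 := by
  refine eq_of_bas (dup ∘ₗ dup) 0 (fun w => ?_) v
  induction w with
  | nil => simp
  | cons x w ih =>
    rcases x with _ | a <;> simp_all
    abel

theorem rm_dup (v : Chain n) : rm (dup v) = -dup (rm v) := by
  refine eq_of_bas (rm ∘ₗ dup) (-(dup ∘ₗ rm)) (fun w => ?_) v
  induction w with
  | nil => simp
  | cons x w ih =>
    rcases x with _ | a <;> simp_all
    abel

/-! ### Compositions -/

/-- Substitution of the first segment of a word (of which every segment ends with `none`) for a
step, `f` being the substitution of the remaining segments in the rest of the path. -/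
def emitW (ι : Fin m → Fin r) (f : Word m → Chain r) : Word m → Chain r
  | [] => 0
  | none :: Q => sgn Q.length • f Q
  | some y :: Q => -consL (some (ι y)) (emitW ι f Q)

/-- The substitution of the successive segments of the second word for the successive steps in the
direction `i` of the first one, with the Koszul sign that results from moving the second word
through the first one, all letters being odd. A step that is replaced cancels with the letter
`none` that ends the segment. The result is `0` if the numbers of steps and segments differ. -/
def mulW (h : n + m = r + 1) (i : Fin n) : Word n → Word m → Chain r
  | [], Q => if Q = [] then bas [] else 0
  | none :: p, Q => sgn Q.length • consL none (mulW h i p Q)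
  | some j :: p, Q =>
    if hj : j = i then emitW (innerIdx h i) (mulW h i p) Q
    else sgn Q.length • consL (some (outerIdx h i j hj)) (mulW h i p Q)

/-- The bilinear extension of `mulW`. -/
def mul (h : n + m = r + 1) (i : Fin n) : Chain n →ₗ[ℤ] Chain m →ₗ[ℤ] Chain r :=
  lift fun p => lift (mulW h i p)

section
variable (h : n + m = r + 1) (i : Fin n)

theorem mul_bas_bas (p : Word n) (Q : Word m) : mul h i (bas p) (bas Q) = mulW h i p Q := by
  simp [mul]

theorem eq_of_bas₂ {M : Type*} [AddCommGroup M] (f g : Chain n →ₗ[ℤ] Chain m →ₗ[ℤ] M)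
    (H : ∀ p Q, f (bas p) (bas Q) = g (bas p) (bas Q)) (u : Chain n) (v : Chain m) :
    f u v = g u v :=
  DFunLike.congr_fun (eq_of_bas f g (fun p => LinearMap.ext (eq_of_bas _ _ (H p))) u) v

@[simp] theorem mul_nil_nil : mul h i (bas []) (bas []) = bas [] := by
  simp [mul_bas_bas, mulW]

@[simp] theorem mul_nil_cons (x : Option (Fin m)) (v : Chain m) :
    mul h i (bas []) (consL x v) = 0 :=
  eq_of_bas (mul h i (bas []) ∘ₗ consL x) 0
    (fun w => by simp [← bas_cons, mul_bas_bas, mulW]) v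

@[simp] theorem mul_none (u : Chain n) (v : Chain m) :
    mul h i (consL none u) v = consL none (mul h i u (par v)) :=
  eq_of_bas₂ (mul h i ∘ₗ consL none) (((mul h i).compl₂ par).compr₂ (consL none))
    (fun w => by simp [← bas_cons, mul_bas_bas, mulW, par_bas]) u v

theorem mul_outer {j : Fin n} (hj : j ≠ i) (u : Chain n) (v : Chain m) :
    mul h i (consL (some j) u) v = consL (some (outerIdx h i j hj)) (mul h i u (par v)) :=
  eq_of_bas₂ (mul h i ∘ₗ consL (some j)) (((mul h i).compl₂ par).compr₂ (consL _))
    (fun w => by simp [← bas_cons, mul_bas_bas, mulW, par_bas, hj]) u v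

@[simp] theorem mul_inner_nil (u : Chain n) : mul h i (consL (some i) u) (bas []) = 0 :=
  eq_of_bas ((mul h i).flip (bas []) ∘ₗ consL (some i)) 0
    (fun w => by simp [← bas_cons, mul_bas_bas, mulW, emitW]) u

@[simp] theorem mul_inner_none (u : Chain n) (v : Chain m) :
    mul h i (consL (some i) u) (consL none v) = mul h i u (par v) :=
  eq_of_bas₂ ((mul h i ∘ₗ consL (some i)).compl₂ (consL none)) ((mul h i).compl₂ par)
    (fun w => by simp [← bas_cons, mul_bas_bas, mulW, emitW, par_bas]) u v

@[simp] theorem mul_inner_some (u : Chain n) (y : Fin m) (v : Chain m) :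
    mul h i (consL (some i) u) (consL (some y) v) =
      -consL (some (innerIdx h i y)) (mul h i (consL (some i) u) v) :=
  eq_of_bas₂ ((mul h i ∘ₗ consL (some i)).compl₂ (consL (some y)))
    (-(mul h i ∘ₗ consL (some i)).compr₂ (consL _))
    (fun w => by simp [← bas_cons, mul_bas_bas, mulW, emitW]) u v

theorem par_mul (u : Chain n) (v : Chain m) : par (mul h i u v) = mul h i (par u) (par v) := by
  refine eq_of_bas₂ ((mul h i).compr₂ par) ((mul h i ∘ₗ par).compl₂ par) (fun p Q => ?_) u v
  simp only [LinearMap.compr₂_apply, LinearMap.compl₂_apply, LinearMap.comp_apply]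
  induction p generalizing Q with
  | nil => cases Q <;> simp
  | cons x p ih =>
    replace ih := eq_of_bas (par ∘ₗ mul h i (bas p)) (mul h i (par (bas p)) ∘ₗ par) ih
    simp only [LinearMap.comp_apply] at ih
    rcases x with _ | j
    · simp [ih]
    by_cases hj : j = i
    · subst hj
      induction Q with
      | nil => simp
      | cons y Q ihQ => rcases y with _ | y <;> simp_all
    · simp [mul_outer h i hj, ih]

theorem dup_mul (u : Chain n) (v : Chain m) : dup (mul h i u v) = mul h i (dup u) (par v) := by
  refine eq_of_bas₂ ((mul h i).compr₂ dup) ((mul h i ∘ₗ dup).compl₂ par) (fun p Q => ?_) u v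
  simp only [LinearMap.compr₂_apply, LinearMap.compl₂_apply, LinearMap.comp_apply]
  induction p generalizing Q with
  | nil => cases Q <;> simp
  | cons x p ih =>
    replace ih := eq_of_bas (dup ∘ₗ mul h i (bas p)) (mul h i (dup (bas p)) ∘ₗ par) ih
    simp only [LinearMap.comp_apply] at ih
    rcases x with _ | j
    · simp [ih]
    by_cases hj : j = i
    · subst hj
      induction Q with
      | nil => simp
      | cons y Q ihQ =>
        rcases y with _ | y
        · simp [ih]
        · simp only [bas_cons, map_neg, map_add, map_sub, mul_inner_some, par_consL, dup_some,
            LinearMap.add_apply, LinearMap.sub_apply, mul_none, par_par] at ihQ ⊢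
          rw [ihQ]
          simp
          abel
    · simp [mul_outer h i hj, ih]

/-- The differential of words every segment of which ends with `none`, such that it corresponds
to the differential of the words obtained by removing the last letter, see `app_diff`. -/
def diffTW : Word n → Chain n
  | [] => bas [none]
  | none :: w => bas (none :: none :: w) - consL none (diffTW w)
  | some a :: w => bas w + bas (none :: some a :: w) + bas (some a :: none :: w) -
      consL (some a) (diffTW w)

/-- The linear extension of `diffTW`. -/
def diffT : Chain n →ₗ[ℤ] Chain n := lift diffTW

@[simp] theorem diffT_nil : diffT (bas ([] : Word n)) = consL none (bas []) := by
  simp [diffT, diffTW]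

@[simp] theorem diffT_none (v : Chain n) :
    diffT (consL none v) = consL none (consL none v) - consL none (diffT v) :=
  eq_of_bas (diffT ∘ₗ consL none) ((consL none ∘ₗ consL none) - (consL none ∘ₗ diffT))
    (fun w => by simp [diffT, diffTW, ← bas_cons]) v

@[simp] theorem diffT_some (a : Fin n) (v : Chain n) :
    diffT (consL (some a) v) =
      v + consL none (consL (some a) v) + consL (some a) (consL none v) -
        consL (some a) (diffT v) :=
  eq_of_bas (diffT ∘ₗ consL (some a)) (LinearMap.id + (consL none ∘ₗ consL (some a)) +
    (consL (some a) ∘ₗ consL none) - (consL (some a) ∘ₗ diffT))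
    (fun w => by simp [diffT, diffTW, ← bas_cons]) v

theorem app_diff (v : Chain n) : app (rm v + dup v) = diffT (app v) := by
  refine eq_of_bas (app ∘ₗ (rm + dup)) (diffT ∘ₗ app) (fun w => ?_) v
  induction w with
  | nil => simp
  | cons x w ih =>
    simp only [LinearMap.comp_apply, LinearMap.add_apply, map_add] at ih
    rcases x with _ | a
    · simp [← ih]; abel
    · simp [← ih]; abel

theorem par_diffT (v : Chain n) : par (diffT v) = -diffT (par v) := by
  refine eq_of_bas (par ∘ₗ diffT) (-(diffT ∘ₗ par)) (fun w => ?_) v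
  induction w with
  | nil => simp
  | cons x w ih => rcases x with _ | a <;> simp_all

theorem mul_nil_diffT (w : Word m) : mul h i (bas []) (diffT (app (bas w))) = 0 := by
  rcases w with _ | ⟨_ | a, w⟩
  · simp
  · simp
  · rcases w with _ | ⟨x, w⟩ <;> simp

/-- Every segment of a word that is empty or ends with `none` ends with `none`. -/
def Terminated (w : Word n) : Prop := w = [] ∨ ∃ q, w = q ++ [none]

theorem Terminated.tail {x : Option (Fin n)} {w : Word n} (hw : Terminated (x :: w)) :
    Terminated w := by
  rcases hw with hw | ⟨_ | ⟨z, q⟩, hq⟩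
  · simp at hw
  · simp at hq; exact .inl hq.2
  · simp at hq; exact .inr ⟨q, hq.2⟩

/-- The Leibniz rule for `rm`. The steps of `u` in the direction `i` do not occur in the product,
and the terms of `rm u` in which one of them is removed cancel with the cofaces contained in
`diffT (app v)`. -/
theorem rm_mul_app (u : Chain n) (v : Chain m) :
    rm (mul h i u (app v)) = mul h i (rm u) (par (app v)) - mul h i u (diffT (app v)) := by
  suffices H : ∀ (p : Word n) (Q : Word m), Terminated Q →
      rm (mul h i (bas p) (bas Q)) =
        mul h i (rm (bas p)) (par (bas Q)) - mul h i (bas p) (diffT (bas Q)) by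
    refine eq_of_bas₂ (((mul h i).compl₂ app).compr₂ rm)
      ((mul h i ∘ₗ rm).compl₂ (par ∘ₗ app) - (mul h i).compl₂ (diffT ∘ₗ app)) (fun p q => ?_) u v
    have := H p (q ++ [none]) (.inr ⟨q, rfl⟩)
    rw [← app_bas] at this
    simpa using this
  intro p
  induction p with
  | nil =>
    rintro Q (rfl | ⟨q, rfl⟩)
    · simp
    · rw [← app_bas, mul_nil_diffT]
      rcases q with _ | ⟨x, q⟩ <;> simp
  | cons x p ih =>
    intro Q hQ
    have ih' := ih Q hQ
    have key : rm (mul h i (bas p) (par (bas Q))) =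
        mul h i (rm (bas p)) (bas Q) - mul h i (bas p) (diffT (par (bas Q))) := by
      rw [par_bas] at ih' ⊢
      simp only [map_smul, ih', smul_sub, smul_smul, sgn_mul_self, one_smul]
    rcases x with _ | j
    · simp [key, par_diffT]
      abel
    by_cases hj : j = i
    · subst hj
      clear key ih'
      induction Q with
      | nil => simp
      | cons y Q ihQ =>
        have hQ' : Terminated Q := hQ.tail
        have ih' := ih Q hQ'
        have key : rm (mul h j (bas p) (par (bas Q))) =
            mul h j (rm (bas p)) (bas Q) - mul h j (bas p) (diffT (par (bas Q))) := by
          rw [par_bas] at ih' ⊢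
          simp only [map_smul, ih', smul_sub, smul_smul, sgn_mul_self, one_smul]
        rcases y with _ | y
        · simp [key, par_diffT]
        · have ihQ := ihQ hQ'
          rw [bas_cons] at ihQ
          simp [ihQ]
          abel
    · simp [mul_outer h i hj, key, par_diffT]
      abel

theorem mul_nil_left (v : Chain m) : mul h i (bas []) v = v [] • bas [] := by
  refine eq_of_bas (mul h i (bas [])) ((Finsupp.lapply []).smulRight (bas [])) (fun w => ?_) v
  rcases w with _ | ⟨x, w⟩
  · rw [mul_nil_nil]
    simp [bas]
  · rw [bas_cons, mul_nil_cons, ← bas_cons]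
    simp [bas]

@[simp] theorem mul_app (u : Chain n) (v : Chain m) : mul h i (app u) v = app (mul h i u v) := by
  suffices H : ∀ (p : Word n) v, mul h i (app (bas p)) v = app (mul h i (bas p) v) from
    eq_of_bas ((mul h i).flip v ∘ₗ app) (app ∘ₗ (mul h i).flip v) (fun p => H p v) u
  intro p
  induction p with
  | nil =>
    intro v
    simp only [app_nil, mul_none, mul_nil_left, map_smul]
    congr 1
    refine eq_of_bas (Finsupp.lapply [] ∘ₗ par) (Finsupp.lapply []) (fun w => ?_) v
    rcases w with _ | ⟨x, w⟩
    · simp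
    · simp only [LinearMap.comp_apply, par_bas]
      simp [bas]
  | cons x p ih =>
    intro v
    rcases x with _ | j
    · simp [ih]
    by_cases hj : j = i
    · subst hj
      refine eq_of_bas (mul h j (app (bas (some j :: p)))) (app ∘ₗ mul h j (bas (some j :: p)))
        (fun w => ?_) v
      induction w with
      | nil => simp
      | cons y Q ihQ => rcases y with _ | y <;> simp_all
    · simp [mul_outer h i hj, ih]

theorem mul_nil_app (v : Chain m) : mul h i (bas []) (app v) = 0 := by
  refine eq_of_bas (mul h i (bas []) ∘ₗ app) 0 (fun w => ?_) v
  rcases w with _ | ⟨x, w⟩ <;> simp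

end

/-! ### Associativity -/

section
variable {p s t : ℕ}

theorem innerIdx_innerIdx (h₁ : n + m = r + 1) (h₂ : r + p = t + 1) (h₃ : m + p = s + 1)
    (h₄ : n + s = t + 1) (i : Fin n) (j : Fin m) (z : Fin p) :
    innerIdx h₂ (innerIdx h₁ i j) z = innerIdx h₄ i (innerIdx h₃ j z) :=
  Fin.ext (by simp [innerIdx, add_assoc])

theorem innerIdx_injective (h : n + m = r + 1) (i : Fin n) :
    Function.Injective (innerIdx h i) := by
  intro j j' hj
  simpa [innerIdx, Fin.ext_iff] using hj

theorem outerIdx_injective (h : n + m = r + 1) (i : Fin n) {j j' : Fin n} (hj : j ≠ i)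
    (hj' : j' ≠ i) (H : outerIdx h i j hj = outerIdx h i j' hj') : j = j' := by
  have := Fin.val_ne_of_ne hj
  have := Fin.val_ne_of_ne hj'
  simp only [outerIdx, Fin.ext_iff, Fin.lt_def] at H ⊢
  split_ifs at H <;> omega

theorem outerIdx_ne_innerIdx (h : n + m = r + 1) (i : Fin n) {j : Fin n} (hj : j ≠ i)
    (y : Fin m) : outerIdx h i j hj ≠ innerIdx h i y := by
  have := Fin.val_ne_of_ne hj
  simp only [outerIdx, innerIdx, ne_eq, Fin.ext_iff, Fin.lt_def]
  split_ifs <;> omega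

theorem outerIdx_innerIdx (h₁ : n + m = r + 1) (h₂ : r + p = t + 1) (h₃ : m + p = s + 1)
    (h₄ : n + s = t + 1) (i : Fin n) (j : Fin m) {y : Fin m} (hy : y ≠ j) :
    outerIdx h₂ (innerIdx h₁ i j) (innerIdx h₁ i y) ((innerIdx_injective h₁ i).ne hy) =
      innerIdx h₄ i (outerIdx h₃ j y hy) := by
  have := Fin.val_ne_of_ne hy
  simp only [outerIdx, innerIdx, Fin.ext_iff, Fin.lt_def]
  split_ifs <;> omega

theorem outerIdx_outerIdx (h₁ : n + m = r + 1) (h₂ : r + p = t + 1) (h₃ : m + p = s + 1)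
    (h₄ : n + s = t + 1) (i : Fin n) (j : Fin m) {k : Fin n} (hk : k ≠ i) :
    outerIdx h₂ (innerIdx h₁ i j) (outerIdx h₁ i k hk) (outerIdx_ne_innerIdx h₁ i hk j) =
      outerIdx h₄ i k hk := by
  have := Fin.val_ne_of_ne hk
  simp only [outerIdx, innerIdx, Fin.ext_iff, Fin.lt_def]
  split_ifs <;> omega

theorem outerIdx_innerIdx_comm (h₁ : n + m = r + 1) (h₂ : r + p = t + 1) (h₃ : n + p = s + 1)
    (h₄ : s + m = t + 1) (i j : Fin n) (hij : i ≠ j) (y : Fin m) :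
    outerIdx h₂ (outerIdx h₁ i j hij.symm) (innerIdx h₁ i y)
        (outerIdx_ne_innerIdx h₁ i hij.symm y).symm =
      innerIdx h₄ (outerIdx h₃ j i hij) y := by
  have := Fin.val_ne_of_ne hij
  simp only [outerIdx, innerIdx, Fin.ext_iff, Fin.lt_def]
  split_ifs <;> omega

theorem outerIdx_outerIdx_comm (h₁ : n + m = r + 1) (h₂ : r + p = t + 1) (h₃ : n + p = s + 1)
    (h₄ : s + m = t + 1) (i j : Fin n) (hij : i ≠ j) {k : Fin n} (hi : k ≠ i) (hj : k ≠ j) :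
    outerIdx h₂ (outerIdx h₁ i j hij.symm) (outerIdx h₁ i k hi)
        ((outerIdx_injective h₁ i hi hij.symm).mt hj) =
      outerIdx h₄ (outerIdx h₃ j i hij) (outerIdx h₃ j k hj)
        ((outerIdx_injective h₃ j hj hij).mt hi) := by
  have := Fin.val_ne_of_ne hij
  have := Fin.val_ne_of_ne hi
  have := Fin.val_ne_of_ne hj
  simp only [outerIdx, Fin.ext_iff, Fin.lt_def]
  split_ifs <;> omega

/-- Sequential associativity. The parity of `w` is due to the letter `none` by which the inner
composition is terminated. -/
theorem mul_mul_app (h₁ : n + m = r + 1) (h₂ : r + p = t + 1)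
    (h₃ : m + p = s + 1) (h₄ : n + s = t + 1) (i : Fin n) (j : Fin m)
    (u : Chain n) (v : Chain m) (w : Chain p) :
    mul h₂ (innerIdx h₁ i j) (mul h₁ i u (app v)) w =
      mul h₄ i u (app (mul h₃ j v (par w))) := by
  suffices H : ∀ (a : Word n) (b : Word m), Terminated b → ∀ (w : Chain p),
      mul h₂ (innerIdx h₁ i j) (mul h₁ i (bas a) (bas b)) w =
        mul h₄ i (bas a) (mul h₃ j (bas b) (par w)) by
    refine eq_of_bas₂ (((mul h₁ i).compl₂ app).compr₂ ((mul h₂ (innerIdx h₁ i j)).flip w))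
      ((mul h₄ i).compl₂ (app ∘ₗ (mul h₃ j).flip (par w))) (fun a b => ?_) u v
    have := H a (b ++ [none]) (.inr ⟨b, rfl⟩) w
    rw [← app_bas, mul_app] at this
    simpa using this
  intro a
  induction a with
  | nil =>
    rintro b (rfl | ⟨b, rfl⟩) w
    · refine eq_of_bas (mul h₂ (innerIdx h₁ i j) (mul h₁ i (bas []) (bas [])))
        (mul h₄ i (bas []) ∘ₗ mul h₃ j (bas []) ∘ₗ par) (fun w => ?_) w
      rcases w with _ | ⟨x, w⟩ <;> simp
    · rw [← app_bas, mul_app, mul_nil_app, mul_nil_app, map_zero, LinearMap.zero_apply]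
  | cons x a ih =>
    have key : ∀ b, Terminated b → ∀ w,
        mul h₂ (innerIdx h₁ i j) (mul h₁ i (bas a) (par (bas b))) w =
          mul h₄ i (bas a) (mul h₃ j (par (bas b)) (par w)) := by
      intro b hb w
      simp [par_bas, ih b hb w]
    intro b hb w
    rcases x with _ | k
    · simp [key b hb, par_mul]
    by_cases hk : k = i
    · subst hk
      induction b generalizing w with
      | nil =>
        refine eq_of_bas (mul h₂ (innerIdx h₁ k j) (mul h₁ k (bas (some k :: a)) (bas [])))
          (mul h₄ k (bas (some k :: a)) ∘ₗ mul h₃ j (bas []) ∘ₗ par) (fun w => ?_) w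
        rcases w with _ | ⟨x, w⟩ <;> simp
      | cons y b ihb =>
        replace ihb := ihb hb.tail
        rcases y with _ | y
        · simp [key b hb.tail, par_mul]
        rw [bas_cons] at ihb ⊢
        by_cases hy : y = j
        · subst hy
          refine eq_of_bas (mul h₂ (innerIdx h₁ k y)
            (mul h₁ k (consL (some k) (bas a)) (bas (some y :: b))))
            (mul h₄ k (consL (some k) (bas a)) ∘ₗ mul h₃ y (bas (some y :: b)) ∘ₗ par)
            (fun c => ?_) w
          induction c with
          | nil => simp
          | cons z c ihc =>
            rcases z with _ | z
            · simp [ihb]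
            · simp only [LinearMap.comp_apply, bas_cons, mul_inner_some, map_neg,
                LinearMap.neg_apply, par_consL] at ihc ⊢
              rw [← ihc, map_neg, innerIdx_innerIdx h₁ h₂ h₃ h₄]
              simp only [neg_neg]
        · simp [mul_outer h₃ j hy, mul_outer h₂ _ ((innerIdx_injective h₁ k).ne hy), ihb,
            outerIdx_innerIdx h₁ h₂ h₃ h₄ k j hy]
    · simp [mul_outer h₁ i hk, mul_outer h₄ i hk, mul_outer h₂ _ (outerIdx_ne_innerIdx h₁ i hk j),
        key b hb, par_mul, outerIdx_outerIdx h₁ h₂ h₃ h₄ i j hk]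

/-- Parallel associativity: the two inner words are interchanged. -/
theorem mul_mul_comm (h₁ : n + m = r + 1) (h₂ : r + p = t + 1)
    (h₃ : n + p = s + 1) (h₄ : s + m = t + 1) (i j : Fin n) (hij : i ≠ j)
    (a : Word n) (b : Word m) (c : Word p) :
    mul h₂ (outerIdx h₁ i j hij.symm) (mul h₁ i (bas a) (bas b)) (bas c) =
      sgn (b.length * c.length) •
        mul h₄ (outerIdx h₃ j i hij) (mul h₃ j (bas a) (bas c)) (bas b) := by
  induction a generalizing b c with
  | nil => cases b <;> cases c <;> simp
  | cons x a ih =>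
    rcases x with _ | k
    · simp [par_bas, ih, smul_smul]
      congr 1
      ring
    by_cases hki : k = i
    · subst hki
      rw [bas_cons, mul_outer h₃ j hij]
      induction b with
      | nil => simp
      | cons y b ihb =>
        rcases y with _ | y
        · simp only [par_bas, ih, smul_smul, bas_cons, mul_inner_none, List.length_cons,
            Nat.cast_succ, map_smul, LinearMap.smul_apply]
          congr 1
          generalize (b.length : ZMod 2) = x
          generalize (c.length : ZMod 2) = y
          revert x y
          decide
        · simp only [bas_cons, mul_inner_some, map_neg, LinearMap.neg_apply,
            mul_outer h₂ _ (outerIdx_ne_innerIdx h₁ k hij.symm y).symm, par_bas c, map_smul,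
            LinearMap.smul_apply] at ihb ⊢
          rw [ihb, outerIdx_innerIdx_comm h₁ h₂ h₃ h₄ k j hij y]
          simp only [map_smul, smul_neg, smul_smul, List.length_cons, Nat.cast_succ]
          congr 2
          generalize (b.length : ZMod 2) = x
          generalize (c.length : ZMod 2) = y
          revert x y
          decide
    by_cases hkj : k = j
    · subst hkj
      rw [bas_cons, mul_outer h₁ i hij.symm]
      induction c with
      | nil => simp
      | cons y c ihc =>
        rcases y with _ | y
        · simp only [par_bas, ih, smul_smul, bas_cons, mul_inner_none, List.length_cons,
            Nat.cast_succ, map_smul, LinearMap.smul_apply]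
          congr 1
          generalize (b.length : ZMod 2) = x
          generalize (c.length : ZMod 2) = y
          revert x y
          decide
        · simp only [bas_cons, mul_inner_some, map_neg, LinearMap.neg_apply,
            mul_outer h₄ _ (outerIdx_ne_innerIdx h₃ k hij y).symm, par_bas b, map_smul,
            LinearMap.smul_apply] at ihc ⊢
          rw [smul_neg, ← LinearMap.map_smul, ihc,
            ← outerIdx_innerIdx_comm h₃ h₄ h₁ h₂ k i hij.symm y]
          simp only [map_smul, smul_neg, smul_smul, List.length_cons, Nat.cast_succ]
          congr 2
          generalize (b.length : ZMod 2) = x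
          generalize (c.length : ZMod 2) = y
          revert x y
          decide
    have hk₂ := (outerIdx_injective h₁ i hki hij.symm).mt hkj
    have hk₄ := (outerIdx_injective h₃ j hkj hij).mt hki
    rw [bas_cons, mul_outer h₁ i hki, mul_outer h₃ j hkj, mul_outer h₂ _ hk₂, mul_outer h₄ _ hk₄,
      outerIdx_outerIdx_comm h₁ h₂ h₃ h₄ i j hij hki hkj]
    simp only [par_bas, ih, smul_smul, map_smul, LinearMap.smul_apply]
    congr 1
    ring

/-! ### Equivariance -/

/-- The action of a permutation on the coordinates, without signs. -/
def rel (σ : Equiv.Perm (Fin n)) : Chain n →ₗ[ℤ] Chain n :=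
  Finsupp.lmapDomain ℤ ℤ (permWord σ)

theorem rel_bas (σ : Equiv.Perm (Fin n)) (w : Word n) : rel σ (bas w) = bas (permWord σ w) := by
  simp [rel, bas]

@[simp] theorem rel_nil (σ : Equiv.Perm (Fin n)) : rel σ (bas []) = bas [] := rel_bas σ []

@[simp] theorem rel_consL (σ : Equiv.Perm (Fin n)) (x : Option (Fin n)) (v : Chain n) :
    rel σ (consL x v) = consL (x.map σ) (rel σ v) :=
  eq_of_bas (rel σ ∘ₗ consL x) (consL (x.map σ) ∘ₗ rel σ)
    (fun w => by simp [← bas_cons, rel_bas, permWord]) v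

@[simp] theorem par_rel (σ : Equiv.Perm (Fin n)) (v : Chain n) :
    par (rel σ v) = rel σ (par v) :=
  eq_of_bas (par ∘ₗ rel σ) (rel σ ∘ₗ par) (fun w => by simp [rel_bas, par_bas, permWord]) v

theorem app_rel (σ : Equiv.Perm (Fin n)) (v : Chain n) : app (rel σ v) = rel σ (app v) :=
  eq_of_bas (app ∘ₗ rel σ) (rel σ ∘ₗ app) (fun w => by simp [rel_bas, app_bas, permWord]) v

theorem rm_rel (σ : Equiv.Perm (Fin n)) (v : Chain n) : rm (rel σ v) = rel σ (rm v) := by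
  refine eq_of_bas (rm ∘ₗ rel σ) (rel σ ∘ₗ rm) (fun w => ?_) v
  induction w with
  | nil => simp
  | cons x w ih => rcases x with _ | a <;> simp_all

theorem dup_rel (σ : Equiv.Perm (Fin n)) (v : Chain n) : dup (rel σ v) = rel σ (dup v) := by
  refine eq_of_bas (dup ∘ₗ rel σ) (rel σ ∘ₗ dup) (fun w => ?_) v
  induction w with
  | nil => simp
  | cons x w ih => rcases x with _ | a <;> simp_all

/-- Without the change of signs, the compositions are equivariant with no sign at all. -/
theorem mul_rel (h : n + m = r + 1) (i : Fin n) (σ : Equiv.Perm (Fin n))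
    (τ : Equiv.Perm (Fin m)) (ρ : Equiv.Perm (Fin r))
    (hin : ∀ j, ρ (innerIdx h i j) = innerIdx h (σ i) (τ j))
    (hout : ∀ j (hj : j ≠ i),
      ρ (outerIdx h i j hj) = outerIdx h (σ i) (σ j) (σ.injective.ne hj))
    (u : Chain n) (v : Chain m) :
    mul h (σ i) (rel σ u) (rel τ v) = rel ρ (mul h i u v) := by
  refine eq_of_bas₂ ((mul h (σ i) ∘ₗ rel σ).compl₂ (rel τ)) ((mul h i).compr₂ (rel ρ))
    (fun a b => ?_) u v
  simp only [LinearMap.compr₂_apply, LinearMap.compl₂_apply, LinearMap.comp_apply]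
  induction a generalizing b with
  | nil => cases b <;> simp
  | cons x a ih =>
    replace ih := eq_of_bas (mul h (σ i) (rel σ (bas a)) ∘ₗ rel τ) (rel ρ ∘ₗ mul h i (bas a)) ih
    simp only [LinearMap.comp_apply] at ih
    rcases x with _ | k
    · simp [ih]
    by_cases hk : k = i
    · subst hk
      induction b with
      | nil => simp
      | cons y b ihb => rcases y with _ | y <;> simp_all
    · simp [mul_outer h i hk, mul_outer h (σ i) (σ.injective.ne hk), ih, hout k hk]

end

/-! ### The whiskering -/

/-- The part with `s` letters `none` of the multiplicative extension of
`x ↦ x - x * none * x + x * none * x * none * x - ⋯ = (1 + x * none)⁻¹ * x`. -/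
def whW : ℕ → Word n → Chain n
  | 0, w => bas w
  | _ + 1, [] => 0
  | s + 1, x :: w => consL x (whW (s + 1) w - consL none (whW s (x :: w)))
termination_by s w => (s, w.length)

/-- The linear extension of `whW s`: up to a change of signs, the component `s` of the
whiskering. -/
def wh (s : ℕ) : Chain n →ₗ[ℤ] Chain n := lift (whW s)

@[simp] theorem wh_zero (v : Chain n) : wh 0 v = v :=
  eq_of_bas (wh 0) LinearMap.id (fun w => by simp [wh, whW]) v

@[simp] theorem wh_succ_nil (s : ℕ) : wh (s + 1) (bas ([] : Word n)) = 0 := by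
  simp [wh, whW]

theorem wh_succ_cons (s : ℕ) (x : Option (Fin n)) (v : Chain n) :
    wh (s + 1) (consL x v) = consL x (wh (s + 1) v) - consL x (consL none (wh s (consL x v))) :=
  eq_of_bas (wh (s + 1) ∘ₗ consL x)
    (consL x ∘ₗ wh (s + 1) - consL x ∘ₗ consL none ∘ₗ wh s ∘ₗ consL x)
    (fun w => by simp [wh, ← bas_cons, whW]) v

theorem par_wh (s : ℕ) (v : Chain n) : par (wh s v) = wh s (par v) := by
  refine eq_of_bas (par ∘ₗ wh s) (wh s ∘ₗ par) (fun w => ?_) v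
  simp only [LinearMap.comp_apply]
  induction s generalizing w with
  | zero => simp
  | succ s ihs =>
    induction w with
    | nil => simp
    | cons x w ih =>
      replace ihs := ihs (x :: w)
      rw [bas_cons] at ihs
      simp only [bas_cons, wh_succ_cons, map_sub, par_consL, ih, map_neg, ihs, neg_neg]
      abel

/-- The whiskering intertwines `rm` with `rm + dup`: the derivation `rm` applied to
`x * none * x` is `none * x + x * none`, the value of `dup` on the step `x`. -/
theorem wh_rm (s : ℕ) (p : List (Fin n)) :
    rm (wh (s + 1) (bas (p.map some))) + dup (wh s (bas (p.map some))) =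
      wh (s + 1) (rm (bas (p.map some))) := by
  induction s generalizing p with
  | zero =>
    induction p with
    | nil => simp
    | cons a p ih =>
      simp only [List.map_cons, bas_cons, wh_succ_cons, wh_zero, map_sub, rm_some, rm_none,
        dup_some, ← ih] at ih ⊢
      simp
      abel
  | succ s ihs =>
    induction p with
    | nil => simp
    | cons a p ih =>
      replace ihs := eq_sub_of_add_eq (ihs (a :: p))
      simp only [List.map_cons, bas_cons] at ihs
      rw [List.map_cons, bas_cons, wh_succ_cons, rm_some, map_sub, map_sub, rm_some, rm_some,
        rm_none, ihs, wh_succ_cons]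
      simp only [map_sub, ← ih, rm_some, dup_some, wh_succ_cons, map_add, dup_none, map_neg]
      generalize wh (s + 1 + 1) = W₂, wh (s + 1) = W₁, wh s = W₀
      abel

theorem mul_eq_zero_of_count_ne (h : n + m = r + 1) (i : Fin n) (p : Word n) (Q : Word m)
    (hpQ : p.count (some i) ≠ Q.count none) : mul h i (bas p) (bas Q) = 0 := by
  induction p generalizing Q with
  | nil =>
    rcases Q with _ | ⟨x, Q⟩
    · simp at hpQ
    · simp
  | cons x p ih =>
    rcases x with _ | j
    · simp [par_bas, ih Q (by simpa using hpQ)]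
    by_cases hj : j = i
    · subst hj
      induction Q with
      | nil => simp
      | cons y Q ihQ =>
        rcases y with _ | y
        · simp [par_bas, ih Q (by simpa using hpQ)]
        · have := ihQ (by simpa using hpQ)
          rw [bas_cons] at this
          simp [this]
    · have : p.count (some i) ≠ Q.count none := by
        rwa [List.count_cons_of_ne (by simpa using hj)] at hpQ
      simp [mul_outer h i hj, par_bas, ih Q this]

/-- The whiskering multiplied on the right by `none`, summed over the number of new points. -/
def whT (N : ℕ) (q : List (Fin m)) : Chain m :=
  ∑ j ∈ Finset.range N, app (wh j (bas (q.map some)))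

theorem whT_nil (N : ℕ) : whT (N + 1) ([] : List (Fin m)) = consL none (bas []) := by
  rw [whT, Finset.sum_range_succ']
  simp

theorem whT_cons (N : ℕ) (y : Fin m) (q : List (Fin m)) :
    whT (N + 1) (y :: q) =
      consL (some y) (whT (N + 1) q) - consL (some y) (consL none (whT N (y :: q))) := by
  simp only [whT, List.map_cons, bas_cons]
  rw [Finset.sum_range_succ', Finset.sum_range_succ' _ N]
  simp only [wh_succ_cons, map_sub, map_sum, map_add, app_consL, Finset.sum_sub_distrib, wh_zero]
  abel

theorem par_whT (N : ℕ) (q : List (Fin m)) :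
    par (whT N q) = sgn (q.length + 1) • whT N q := by
  have : ∀ v : Chain m, par (app v) = -app (par v) := fun v =>
    eq_of_bas (par ∘ₗ app) (-(app ∘ₗ par))
      (fun w => by simp [app_bas, par_bas, sgn_add_one]) v
  simp [whT, this, par_wh, par_bas, Finset.smul_sum, sgn_add_one]

theorem marks_cons (x : Option (Fin n)) (w : Word n) : marks (x :: w) = marks w + marks [x] := by
  rw [marks, ← List.singleton_append, List.count_append, add_comm, marks, marks]

theorem consL_mem_supported (x : Option (Fin n)) {k : ℕ} {v : Chain n}
    (hv : v ∈ Finsupp.supported ℤ ℤ {q : Word n | marks q = k}) :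
    consL x v ∈ Finsupp.supported ℤ ℤ {q : Word n | marks q = k + marks [x]} := by
  refine map_mem_supported (fun w hw => ?_) hv
  rw [← bas_cons]
  refine bas_mem_supported ?_
  rw [Set.mem_ofPred_eq] at hw ⊢
  rw [marks_cons, hw]

theorem wh_supported (s : ℕ) (p : List (Fin n)) :
    wh s (bas (p.map some)) ∈ Finsupp.supported ℤ ℤ {q | marks q = s} := by
  induction s generalizing p with
  | zero =>
    rw [wh_zero]
    exact bas_mem_supported (by simp [marks, List.count_eq_zero])
  | succ s ihs =>
    induction p with
    | nil => simp
    | cons a p ih =>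
      rw [List.map_cons, bas_cons, wh_succ_cons, ← bas_cons, ← List.map_cons]
      have h₁ := consL_mem_supported (some a) ih
      have h₂ := consL_mem_supported (some a) (consL_mem_supported none (ihs (a :: p)))
      rw [show marks [some a] = 0 from rfl] at h₁ h₂
      exact Submodule.sub_mem _ h₁ h₂

theorem marks_map_some (p : List (Fin n)) : marks (p.map some) = 0 := by
  simp [marks, List.count_eq_zero]

/-- Only finitely many of the terms `j` of the whiskering have a colour that matches a given
path. -/
theorem mul_whT (h : n + m = r + 1) (i : Fin n) {N : ℕ} {p : Word n} (hp : p.length ≤ N)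
    (q : List (Fin m)) : mul h i (bas p) (whT (N + 1) q) = mul h i (bas p) (whT N q) := by
  rw [whT, Finset.sum_range_succ, ← whT, map_add, add_eq_left]
  refine eq_of_bas_of_supported (mul h i (bas p) ∘ₗ app) 0 (fun w hw => ?_)
    (wh_supported N q)
  rw [LinearMap.comp_apply, app_bas, LinearMap.zero_apply]
  refine mul_eq_zero_of_count_ne h i p _ ?_
  rw [Set.mem_ofPred_eq, marks] at hw
  rw [List.count_append, hw]
  have : p.count (some i) ≤ p.length := List.count_le_length
  simp
  omega

theorem mul_nil_whT (h : n + m = r + 1) (i : Fin n) (N : ℕ) (q : List (Fin m)) :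
    mul h i (bas []) (whT N q) = 0 := by
  simp only [whT, map_sum, mul_nil_app, Finset.sum_const_zero]

theorem mul_wh_nil (h : n + m = r + 1) (i : Fin n) (l : ℕ) (p : List (Fin n)) :
    mul h i (wh l (bas (p.map some))) (bas []) = wh l (mul h i (bas (p.map some)) (bas [])) := by
  induction l generalizing p with
  | zero => simp
  | succ l ihl =>
    induction p with
    | nil => simp
    | cons a p ih =>
      replace ihl := ihl (a :: p)
      rw [List.map_cons, bas_cons] at ihl ⊢
      by_cases ha : a = i
      · subst ha
        simp [wh_succ_cons]
      · rw [mul_outer h i ha] at ihl ⊢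
        simp [wh_succ_cons, mul_outer h i ha, ih, ihl]

/-- The whiskering is multiplicative, so that it commutes with the substitution of whiskered
words. The bound on `N` makes sure that all terms with a matching number of segments occur. -/
theorem mul_wh_whT (h : n + m = r + 1) (i : Fin n) (l : ℕ) (p : List (Fin n)) (q : List (Fin m))
    {N : ℕ} (hN : p.length + l ≤ N) :
    mul h i (wh l (bas (p.map some))) (whT N q) =
      wh l (mul h i (bas (p.map some)) (whT N q)) := by
  induction l generalizing p q N with
  | zero => simp
  | succ l ihl =>
    obtain ⟨N, rfl⟩ : ∃ N', N = N' + 1 := ⟨N - 1, by omega⟩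
    induction p generalizing q N with
    | nil => simp [mul_nil_whT]
    | cons a p ih =>
      simp only [List.length_cons] at hN
      rw [List.map_cons, bas_cons]
      by_cases ha : a = i
      · subst ha
        induction q with
        | nil =>
          have h₁ := mul_wh_nil h a (l + 1) p
          have h₂ := mul_wh_nil h a l (a :: p)
          rw [List.map_cons, bas_cons] at h₂
          simp [whT_nil, wh_succ_cons, h₁, h₂]
        | cons y q ihq =>
          have hl := ihl (a :: p) (y :: q) (N := N) (by simp; omega)
          obtain ⟨N, rfl⟩ : ∃ N', N = N' + 1 := ⟨N - 1, by omega⟩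
          have hp := ih (y :: q) (N := N) (by omega)
          have hs := mul_whT h a (N := N + 1) (p := (a :: p).map some) (by simp; omega) (y :: q)
          rw [List.map_cons, bas_cons] at hl hs
          have hp' : mul h a (wh (l + 1) (bas (p.map some))) (par (whT (N + 1) (y :: q))) =
              wh (l + 1) (mul h a (bas (p.map some)) (par (whT (N + 1) (y :: q)))) := by
            rw [par_whT, map_smul, map_smul, map_smul, hp]
          have e : mul h a (consL (some a) (bas (p.map some))) (whT (N + 1 + 1) (y :: q)) =
              consL (some (innerIdx h a y))
                (mul h a (bas (p.map some)) (par (whT (N + 1) (y :: q))) -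
                  mul h a (consL (some a) (bas (p.map some))) (whT (N + 1 + 1) q)) := by
            rw [whT_cons, map_sub, mul_inner_some, mul_inner_some, mul_inner_none, map_sub]
            abel
          conv_rhs => rw [e, wh_succ_cons, ← e, hs, ← hl, map_sub (wh (l + 1)), ← hp', ← ihq,
            wh_succ_cons]
          conv_lhs => rw [wh_succ_cons, whT_cons]
          simp only [map_sub, LinearMap.sub_apply, mul_inner_some, mul_inner_none, mul_none,
            par_par]
          abel
      · have hp := ih q (N := N) (by omega)
        have hl := ihl (a :: p) q (N := N + 1) (by simp; omega)
        rw [List.map_cons, bas_cons, mul_outer h i ha, par_whT] at hl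
        rw [mul_outer h i ha, par_whT, wh_succ_cons]
        simp only [map_sub, LinearMap.sub_apply, map_smul, mul_outer h i ha, mul_none, hl,
          hp, par_whT, wh_succ_cons, smul_sub, smul_smul,
          sgn_mul_self, mul_one]

/-! ### The change of signs -/

/-- The number of steps in a direction smaller than `s`. -/
def numBelow (s : Fin n) (w : Word n) : ℕ :=
  w.countP fun x => x.elim false fun t => decide (t < s)

@[simp] theorem numBelow_nil (s : Fin n) : numBelow s [] = 0 := rfl

@[simp] theorem numBelow_none (s : Fin n) (w : Word n) : numBelow s (none :: w) = numBelow s w := by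
  simp [numBelow]

theorem numBelow_some (s a : Fin n) (w : Word n) :
    numBelow s (some a :: w) = numBelow s w + if a < s then 1 else 0 := by
  simp [numBelow, List.countP_cons]

@[simp] theorem numBelow_self (s : Fin n) (w : Word n) :
    numBelow s (some s :: w) = numBelow s w := by
  simp [numBelow_some]

/-- The exponent of the change of signs after which the differentials are derivations and all
letters are odd. It counts the pairs of steps in the wrong order, i.e. it contains the sign of the
rearrangement of the steps according to their directions; the remaining summands, one for each
letter, account for the `k + 1` steps that make up a coordinate of degree `k`, and for the
position of the marks. -/
def twist : Word n → ZMod 2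
  | [] => 0
  | none :: w => twist w + w.length + n + 1
  | some s :: w => twist w + s + numBelow s w

/-- The change of signs with exponent `twist`, an involution. -/
def tw : Chain n →ₗ[ℤ] Chain n := lift fun w => sgn (twist w) • bas w

theorem tw_bas (w : Word n) : tw (bas w) = sgn (twist w) • bas w := by simp [tw]

@[simp] theorem tw_tw (v : Chain n) : tw (tw v) = v :=
  eq_of_bas (tw ∘ₗ tw) LinearMap.id (fun w => by simp [tw_bas, smul_smul, sgn_mul_self]) v

/-- A path is full if it has a step in each direction. -/
def Full (w : Word n) : Prop := ∀ s, some s ∈ w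

instance (w : Word n) : Decidable (Full w) := inferInstanceAs (Decidable (∀ s, some s ∈ w))

/-- The projection that discards the words that are not full. -/
def pr : Chain n →ₗ[ℤ] Chain n := lift fun w => if Full w then bas w else 0

theorem pr_bas (w : Word n) : pr (bas w) = if Full w then bas w else 0 := by simp [pr]

theorem pr_bas_of_full {w : Word n} (hw : Full w) : pr (bas w) = bas w := by simp [pr, hw]

theorem pr_bas_of_not_full {w : Word n} (hw : ¬ Full w) : pr (bas w) = 0 := by simp [pr, hw]

theorem tw_pr (v : Chain n) : tw (pr v) = pr (tw v) :=
  eq_of_bas (tw ∘ₗ pr) (pr ∘ₗ tw)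
    (fun w => by by_cases hw : Full w <;> simp [tw_bas, pr_bas, hw]) v

theorem numBelow_eq_sum (s : Fin n) (w : Word n) :
    numBelow s w = ∑ t, if t < s then w.count (some t) else 0 := by
  induction w with
  | nil => simp [numBelow]
  | cons x w ih =>
    rw [numBelow, List.countP_cons, ← numBelow, ih]
    rcases x with _ | a
    · simp
    · simp only [List.count_cons, Option.elim, beq_iff_eq, Option.some.injEq]
      rw [← Finset.sum_filter, ← Finset.sum_filter, Finset.sum_add_distrib, Finset.sum_ite_eq]
      simp

theorem length_eq_sum (w : Word n) : w.length = marks w + ∑ t, w.count (some t) := by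
  induction w with
  | nil => simp [marks]
  | cons x w ih =>
    rcases x with _ | a
    · simp [marks] at ih ⊢
      omega
    · simp only [List.count_cons, marks, beq_iff_eq, Option.some.injEq, Finset.sum_add_distrib,
        Finset.sum_ite_eq, List.length_cons, ih]
      simp [add_assoc]

theorem Full.count {w : Word n} (hw : Full w) (s : Fin n) : w.count (some s) = dim w s + 1 := by
  have := List.count_pos_iff.2 (hw s)
  rw [dim]
  omega

theorem Full.sum_dim {w : Word n} (hw : Full w) (s : Fin n) :
    ∑ t ∈ Finset.Iio s, (dim w t : ZMod 2) = numBelow s w + s := by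
  rw [numBelow_eq_sum, ← Finset.sum_filter]
  have : Finset.univ.filter (· < s) = Finset.Iio s := by ext; simp
  rw [this]
  simp only [hw.count, Finset.sum_add_distrib, Finset.sum_const, Fin.card_Iio, smul_eq_mul, mul_one]
  push_cast
  rw [add_assoc, CharTwo.add_self_eq_zero, add_zero]

theorem Full.wdeg {w : Word n} (hw : Full w) : (wdeg w : ZMod 2) = w.length + n := by
  rw [length_eq_sum, LatticePath.wdeg]
  simp only [hw.count, Finset.sum_add_distrib]
  push_cast
  simp only [Finset.sum_const, Finset.card_univ, Fintype.card_fin, mul_one,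
    nsmul_eq_mul, CharTwo.sub_eq_add]
  rw [add_assoc, add_assoc, CharTwo.add_self_eq_zero, add_zero]

/-! ### Faces -/

theorem faceWord_perm {s : Fin n} {i : ℕ} {w : Word n} (hi : i < w.count (some s)) :
    w.Perm (some s :: faceWord s i w) := by
  induction w generalizing i with
  | nil => simp at hi
  | cons x w ih =>
    by_cases hx : x = some s
    · subst hx
      rcases i with _ | i
      · simp [faceWord]
      · rw [faceWord, if_pos rfl]
        rw [List.count_cons_self, Nat.succ_lt_succ_iff] at hi
        exact ((ih hi).cons _).trans (.swap _ _ _)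
    · rw [List.count_cons_of_ne hx] at hi
      rcases i with _ | i <;> rw [faceWord, if_neg hx] <;>
        exact ((ih hi).cons _).trans (.swap _ _ _)

/-- The exponent of the sign of the `i`-th face in the direction `s`, as a term of `rm`. -/
def faceExp (s : Fin n) (i : ℕ) (w : Word n) : ZMod 2 :=
  twist w + twist (faceWord s i w) + numBelow s w + s + i

theorem twist_cons_add_twist_cons {s : Fin n} {x : Option (Fin n)} {w w' : Word n}
    (hw : w.Perm (some s :: w')) :
    twist (x :: w) + twist (x :: w') + numBelow s (x :: w) =
      twist w + twist w' + numBelow s w + if x = some s then 0 else 1 := by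
  rcases x with _ | a
  · simp only [twist, hw.length_eq, numBelow, List.countP_cons]
    simp
    generalize twist w = a, twist w' = b, (w'.length : ZMod 2) = c, (n : ZMod 2) = d
    generalize ((w.countP _ : ℕ) : ZMod 2) = e
    revert a b c d e
    decide
  · have : numBelow a w = numBelow a w' + if s < a then 1 else 0 := by
      rw [numBelow, hw.countP_eq, List.countP_cons, ← numBelow]
      simp
    have h₂ : numBelow s (some a :: w) = numBelow s w + if a < s then 1 else 0 := by
      rw [numBelow, List.countP_cons, ← numBelow]
      simp
    simp only [twist, this, h₂, Option.some.injEq]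
    push_cast
    generalize twist w = x, twist w' = b, (a : ZMod 2) = c
    generalize (numBelow a w' : ZMod 2) = d, (numBelow s w : ZMod 2) = e
    rcases lt_trichotomy a s with h | rfl | h
    · simp [h, h.not_gt, h.ne]
      revert x b c d e; decide
    · simp
      revert x b c d e; decide
    · simp [h, h.not_gt, h.ne']
      revert x b c d e; decide

/-- The derivation `rm` as a signed sum of all faces, including those that are not full. -/
theorem rm_bas (w : Word n) :
    rm (bas w) = ∑ s, ∑ i ∈ Finset.range (w.count (some s)),
      sgn (faceExp s i w) • bas (faceWord s i w) := by
  induction w with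
  | nil => simp
  | cons x w ih =>
    have H : ∀ s, ∑ i ∈ Finset.range ((x :: w).count (some s)),
        sgn (faceExp s i (x :: w)) • bas (faceWord s i (x :: w)) =
        (if x = some s then bas w else 0) - consL x (∑ i ∈ Finset.range (w.count (some s)),
          sgn (faceExp s i w) • bas (faceWord s i w)) := by
      intro s
      rw [sub_eq_neg_add, map_sum, ← Finset.sum_neg_distrib]
      by_cases hx : x = some s
      · subst hx
        rw [List.count_cons_self, Finset.sum_range_succ']
        congr 1
        · refine Finset.sum_congr rfl fun i hi => ?_
          have := twist_cons_add_twist_cons (x := some s) (faceWord_perm (Finset.mem_range.1 hi))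
          rw [faceExp, faceWord, if_pos rfl, this, if_pos rfl, map_smul, ← bas_cons, ← neg_smul,
            ← sgn_add_one, faceExp]
          push_cast
          congr 2
          ring
        · have : numBelow s (some s :: w) = numBelow s w := by simp [numBelow]
          rw [faceExp, faceWord, if_pos rfl, if_pos rfl, this, twist]
          generalize twist w = a, (s : ZMod 2) = b, (numBelow s w : ZMod 2) = c
          have : ∀ a b c : ZMod 2, sgn (a + b + c + a + c + b + (0 : ℕ)) = 1 := by decide
          rw [this, one_smul]
      · rw [List.count_cons_of_ne hx, if_neg hx, add_zero]
        refine Finset.sum_congr rfl fun i hi => ?_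
        have := twist_cons_add_twist_cons (x := x) (faceWord_perm (Finset.mem_range.1 hi))
        have hf : faceWord s i (x :: w) = x :: faceWord s i w := by
          cases i <;> rw [faceWord, if_neg hx]
        rw [faceExp, hf, this, if_neg hx, map_smul, ← bas_cons, ← neg_smul, ← sgn_add_one, faceExp]
        congr 2
        ring
    rw [Finset.sum_congr rfl fun s _ => H s, Finset.sum_sub_distrib, ← map_sum, ← ih]
    rcases x with _ | a <;> simp

theorem bdry_eq_lift (x : Chain n) : bdry x = lift (fun w => bdry (bas w)) x := by
  simp only [bdry, lift, Finsupp.linearCombination_apply, bas, Finsupp.sum_single_index, zero_mul,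
    Finsupp.single_zero, Finset.sum_const_zero, ite_self, one_mul]
  refine Finsupp.sum_congr fun w _ => ?_
  rw [Finset.smul_sum]
  refine Finset.sum_congr rfl fun s _ => ?_
  split_ifs
  · simp
  · simp [Finset.smul_sum]

theorem cobdry_eq_lift (x : Chain n) : cobdry x = lift (fun w => cobdry (bas w)) x := by
  simp only [cobdry, lift, Finsupp.linearCombination_apply, bas, Finsupp.sum_single_index, zero_mul,
    Finsupp.single_zero, Finset.sum_const_zero, one_mul]
  refine Finsupp.sum_congr fun w _ => ?_
  simp [Finset.smul_sum]

theorem permLin_eq_lift (σ : Equiv.Perm (Fin n)) (x : Chain n) :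
    permLin σ x = lift (fun w => permLin σ (bas w)) x := by
  simp only [permLin, lift, Finsupp.linearCombination_apply, bas, Finsupp.sum_single_index,
    zero_mul, Finsupp.single_zero, one_mul]
  refine Finsupp.sum_congr fun w _ => ?_
  simp

theorem whiskS_eq_lift (ε : (n : ℕ) → Word n → Word n → ℤˣ) (s : ℕ) (x : Chain n) :
    whiskS ε s x = lift (fun w => whiskS ε s (bas w)) x := by
  simp only [whiskS, lift, Finsupp.linearCombination_apply, bas, Finsupp.sum_single_index,
    zero_mul, Finsupp.single_zero, Finset.sum_const_zero, one_mul]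
  refine Finsupp.sum_congr fun w _ => ?_
  simp [Finset.smul_sum]

theorem full_faceWord_iff {s : Fin n} {i : ℕ} {w : Word n} (hw : Full w)
    (hi : i < w.count (some s)) : Full (faceWord s i w) ↔ dim w s ≠ 0 := by
  have hp := faceWord_perm hi
  have hs : w.count (some s) = (faceWord s i w).count (some s) + 1 := by
    rw [hp.count_eq, List.count_cons_self]
  rw [hw.count] at hs
  constructor
  · intro h
    have := List.count_pos_iff.2 (h s)
    omega
  · intro h t
    by_cases hts : t = s
    · subst hts
      exact List.count_pos_iff.1 (by omega)
    · have := hw t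
      rw [hp.mem_iff, List.mem_cons] at this
      exact this.resolve_left (by simpa using hts)

/-- The faces that are not full are those in a direction `s` with `k_s = 0`, which do not occur in
the simplicial differential. -/
theorem bdry_bas {w : Word n} (hw : Full w) : bdry (bas w) = tw (pr (rm (tw (bas w)))) := by
  rw [tw_bas, map_smul, map_smul, map_smul, rm_bas]
  simp only [bdry, bas, Finsupp.sum_single_index, zero_mul,
    Finsupp.single_zero, Finset.sum_const_zero, ite_self, one_mul, map_sum, map_smul,
    Finset.smul_sum]
  refine Finset.sum_congr rfl fun s _ => ?_
  rw [← hw.count]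
  split_ifs with hs
  · refine (Finset.sum_eq_zero fun i hi => ?_).symm
    rw [Finset.mem_range] at hi
    rw [← bas, pr_bas_of_not_full (by rwa [full_faceWord_iff hw hi, not_not]), map_zero, smul_zero,
      smul_zero]
  · refine Finset.sum_congr rfl fun i hi => ?_
    rw [Finset.mem_range] at hi
    rw [← bas, pr_bas_of_full (by rwa [full_faceWord_iff hw hi]), tw_bas, single_eq_smul_bas,
      smul_smul, smul_smul, neg_one_pow_eq_sgn, ← sgn_add, ← sgn_add]
    push_cast
    rw [hw.sum_dim, faceExp]
    congr 2
    generalize twist w = a, twist (faceWord s i w) = b, (numBelow s w : ZMod 2) = c,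
      (s : ZMod 2) = d, (i : ZMod 2) = e
    revert a b c d e; decide

/-! ### Cofaces -/

theorem cofaceWord_perm (i : ℕ) (w : Word n) : (cofaceWord i w).Perm (none :: w) := by
  induction w generalizing i with
  | nil => cases i <;> rfl
  | cons x w ih =>
    rcases i with _ | i
    · rfl
    · rcases x with _ | a
      · exact (ih i).cons _
      · exact ((ih (i + 1)).cons _).trans (.swap _ _ _)

/-- The exponent of the sign of the `i`-th coface, as a term of `dup`. -/
def cofaceExp (i : ℕ) (w : Word n) : ZMod 2 :=
  twist w + twist (cofaceWord i w) + w.length + n + 1 + i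

/-- The derivation `dup` as a signed sum of all cofaces. The terms `none * a` and `a * none` of
the derivation at consecutive steps cancel, except at the marks and at the two ends. -/
theorem dup_bas (w : Word n) :
    dup (bas w) =
      ∑ i ∈ Finset.range (marks w + 2 : ℕ), sgn (cofaceExp i w) • bas (cofaceWord i w) := by
  have h0 : ∀ w : Word n, sgn (cofaceExp 0 w) • bas (cofaceWord 0 w) = bas (none :: w) := by
    intro w
    rw [cofaceExp, cofaceWord, twist]
    generalize twist w = a, (w.length : ZMod 2) = b, (n : ZMod 2) = c
    have : ∀ a b c : ZMod 2, sgn (a + (a + b + c + 1) + b + c + 1 + (0 : ℕ)) = 1 := by decide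
    rw [this, one_smul]
  induction w with
  | nil =>
    have h1 : cofaceExp 1 ([] : Word n) = 1 := by
      simp only [cofaceExp, cofaceWord, twist, List.length_nil]
      generalize (n : ZMod 2) = b
      revert b; decide
    rw [show marks ([] : Word n) + 2 = 2 from rfl, Finset.sum_range_succ, Finset.sum_range_one,
      h0, h1, cofaceWord, sgn_one]
    simp
  | cons x w ih =>
    rw [Finset.sum_range_succ', h0]
    rcases x with _ | a
    · have h1 : ∀ i, cofaceExp (i + 1) (none :: w) = cofaceExp i w + 1 := by
        intro i
        rw [cofaceExp, cofaceExp, cofaceWord, twist, twist, (cofaceWord_perm i w).length_eq]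
        push_cast [List.length_cons]
        generalize twist w = a, twist (cofaceWord i w) = b, (w.length : ZMod 2) = c,
          (n : ZMod 2) = d, (i : ZMod 2) = e
        revert a b c d e; decide
      have h2 : marks (none :: w) = marks w + 1 := by simp [marks]
      rw [bas_cons, dup_none, ih, map_sum, h2, sub_eq_neg_add, ← Finset.sum_neg_distrib, bas_cons,
        bas_cons]
      congr 1
      refine Finset.sum_congr rfl fun i _ => ?_
      rw [h1, cofaceWord, bas_cons, map_smul, sgn_add_one, neg_smul]
    · have h1 : ∀ i, cofaceExp (i + 1) (some a :: w) = cofaceExp (i + 1) w + 1 := by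
        intro i
        have : numBelow a (cofaceWord (i + 1) w) = numBelow a w := by
          rw [numBelow, (cofaceWord_perm (i + 1) w).countP_eq]
          simp [numBelow]
        rw [cofaceExp, cofaceExp, cofaceWord, twist, twist, this, List.length_cons]
        push_cast
        generalize twist w = a, twist (cofaceWord (i + 1) w) = b, (w.length : ZMod 2) = c,
          (n : ZMod 2) = d, (i : ZMod 2) = e, (a : ZMod 2) = f, (numBelow a w : ZMod 2) = g
        linear_combination (f + g) * (CharTwo.two_eq_zero : (2 : ZMod 2) = 0)
      have h2 : marks (some a :: w) = marks w := by simp [marks]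
      rw [Finset.sum_range_succ', h0] at ih
      rw [bas_cons, dup_some, ih, map_add, map_sum, h2]
      have : ∀ i ∈ Finset.range (marks w + 1),
          sgn (cofaceExp (i + 1) (some a :: w)) • bas (cofaceWord (i + 1) (some a :: w)) =
            -consL (some a) (sgn (cofaceExp (i + 1) w) • bas (cofaceWord (i + 1) w)) := by
        intro i _
        rw [h1, cofaceWord, bas_cons, map_smul, sgn_add_one, neg_smul]
      rw [Finset.sum_congr rfl this, Finset.sum_neg_distrib]
      simp only [bas_cons]
      abel

theorem cobdry_bas {w : Word n} (hw : Full w) : cobdry (bas w) = tw (dup (tw (bas w))) := by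
  rw [tw_bas, map_smul, map_smul, dup_bas]
  simp only [cobdry, bas, Finsupp.sum_single_index, zero_mul,
    Finsupp.single_zero, Finset.sum_const_zero, one_mul, map_sum, map_smul,
    Finset.smul_sum]
  refine Finset.sum_congr rfl fun i _ => ?_
  rw [← bas, tw_bas, single_eq_smul_bas, smul_smul, smul_smul, negOnePow_eq_sgn, ← sgn_add,
    ← sgn_add]
  push_cast
  rw [hw.wdeg, cofaceExp]
  congr 2
  generalize twist w = a, twist (cofaceWord i w) = b, (w.length : ZMod 2) = c, (n : ZMod 2) = d,
    (i : ZMod 2) = e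
  revert a b c d e; decide

/-! ### Permutations -/

/-- Whether the pair `i < j` is an inversion of `σ`. -/
def inv (σ : Equiv.Perm (Fin n)) (i j : Fin n) : ZMod 2 := if i < j ∧ σ j < σ i then 1 else 0

/-- The number of inversions of `σ`, modulo two. -/
def invCount (σ : Equiv.Perm (Fin n)) : ZMod 2 := ∑ i, ∑ j, inv σ i j

theorem inv_add_inv (σ : Equiv.Perm (Fin n)) (i j : Fin n) :
    inv σ i j + inv σ j i = (if j < i then 1 else 0) + if σ j < σ i then 1 else 0 := by
  rcases lt_trichotomy i j with h | rfl | h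
  · rcases (σ.injective.ne h.ne).lt_or_gt with h' | h' <;>
      simp [inv, h, h.not_gt, h', h'.not_gt]
  · simp [inv]
  · rcases (σ.injective.ne h.ne).lt_or_gt with h' | h' <;>
      simp [inv, h, h.not_gt, h', h'.not_gt]
    rfl

theorem sum_ite_lt (i : Fin n) : (∑ j, if j < i then 1 else 0 : ZMod 2) = i := by
  rw [Finset.sum_boole]
  congr 1
  have : Finset.univ.filter (· < i) = Finset.Iio i := by ext; simp
  rw [this, Fin.card_Iio]

theorem sum_inv_add_inv (σ : Equiv.Perm (Fin n)) (i : Fin n) :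
    ∑ j, (inv σ i j + inv σ j i) = i + σ i := by
  simp only [inv_add_inv, Finset.sum_add_distrib, sum_ite_lt]
  rw [Equiv.sum_comp σ (fun j => if j < σ i then (1 : ZMod 2) else 0), sum_ite_lt]

theorem permWord_cons (σ : Equiv.Perm (Fin n)) (x : Option (Fin n)) (w : Word n) :
    permWord σ (x :: w) = x.map σ :: permWord σ w := rfl

theorem count_permWord (σ : Equiv.Perm (Fin n)) (w : Word n) (s : Fin n) :
    (permWord σ w).count (some (σ s)) = w.count (some s) :=
  List.count_map_of_injective w _ (Option.map_injective σ.injective) (some s)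

/-- The twist changes by the Koszul sign of a permutation of groups of odd letters, and by the
change of the positions of the directions. -/
theorem twist_permWord (σ : Equiv.Perm (Fin n)) (w : Word n) :
    twist (permWord σ w) + twist w =
      (∑ i, ∑ j, inv σ i j * (w.count (some i) * w.count (some j))) +
        ∑ i, w.count (some i) * (i + σ i : ZMod 2) := by
  induction w with
  | nil => simp [permWord, twist]
  | cons x w ih =>
    rw [permWord_cons]
    rcases x with _ | a
    · have : ∀ i : Fin n, (((none :: w).count (some i) : ℕ) : ZMod 2) = w.count (some i) := by
        intro i
        rw [List.count_cons_of_ne (by simp)]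
      simp only [this]
      rw [← ih, Option.map_none, twist, twist,
        show (permWord σ w).length = w.length from List.length_map _]
      generalize twist w = a, twist (permWord σ w) = b, (w.length : ZMod 2) = c, (n : ZMod 2) = d
      revert a b c d; decide
    · have h1 : (numBelow (σ a) (permWord σ w) : ZMod 2) =
          ∑ t, w.count (some t) * if σ t < σ a then (1 : ZMod 2) else 0 := by
        rw [numBelow_eq_sum, ← Equiv.sum_comp σ]
        push_cast
        refine Finset.sum_congr rfl fun t _ => ?_
        rw [count_permWord]
        simp
      have h2 : (numBelow a w : ZMod 2) =
          ∑ t, w.count (some t) * if t < a then (1 : ZMod 2) else 0 := by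
        rw [numBelow_eq_sum]
        push_cast
        refine Finset.sum_congr rfl fun t _ => ?_
        simp
      have h3 : (numBelow a w + numBelow (σ a) (permWord σ w) : ZMod 2) =
          ∑ t, w.count (some t) * (inv σ a t + inv σ t a) := by
        rw [h1, h2, ← Finset.sum_add_distrib]
        simp only [inv_add_inv, mul_add]
      have h4 : ∀ i, ((some a :: w).count (some i) : ZMod 2) =
          w.count (some i) + if i = a then 1 else 0 := by
        intro i
        rw [List.count_cons]
        by_cases hi : i = a
        · simp [hi]
        · simp [hi, Ne.symm hi]
      rw [Option.map_some, twist, twist]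
      simp only [h4, add_mul, mul_add, Finset.sum_add_distrib, ite_mul, mul_ite, mul_one, mul_zero,
        one_mul, zero_mul, Finset.sum_ite_eq', Finset.mem_univ, if_true]
      have h5 : ∑ x, ∑ y, (if x = a then inv σ x y * (w.count (some y) : ZMod 2) else 0) =
          ∑ y, inv σ a y * (w.count (some y) : ZMod 2) := by
        rw [Finset.sum_comm]
        simp
      have h6 : inv σ a a = 0 := by simp [inv]
      simp only [mul_add, Finset.sum_add_distrib] at ih h3
      simp only [mul_comm _ (inv σ _ _)] at h3
      rw [h5]
      linear_combination ih + h3 - h6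

/-- The Koszul sign for `k + 1` odd letters in each direction differs from the one for an object of
degree `k` by the sign of the permutation and by a term that is absorbed in `twist_permWord`. -/
theorem permLin_bas (σ : Equiv.Perm (Fin n)) {w : Word n} (hw : Full w) :
    permLin σ (bas w) = sgn (invCount σ) • tw (rel σ (tw (bas w))) := by
  rw [tw_bas, map_smul, map_smul, rel_bas, tw_bas, smul_smul, smul_smul, permLin, bas,
    Finsupp.sum_single_index (by simp), one_mul, single_eq_smul_bas, neg_one_pow_eq_sgn, ← sgn_add,
    ← sgn_add]
  congr 2
  have h := twist_permWord σ w
  have h1 : ∀ i j, (((if i < j ∧ σ j < σ i then dim w i * dim w j else 0 : ℕ)) : ZMod 2) =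
      inv σ i j * (dim w i * dim w j) := by
    intro i j
    rw [inv]
    split_ifs <;> simp
  have h2 : ∑ i, ∑ j, inv σ i j * (dim w i + dim w j : ZMod 2) =
      ∑ i, dim w i * (i + σ i : ZMod 2) := by
    simp only [← sum_inv_add_inv, mul_add, Finset.sum_add_distrib, Finset.mul_sum]
    rw [Finset.sum_comm (f := fun i j => inv σ i j * (dim w j : ZMod 2))]
    simp only [mul_comm (dim w _ : ZMod 2)]
  have h3 : ∑ i : Fin n, (i + σ i : ZMod 2) = 0 := by
    rw [Finset.sum_add_distrib, Equiv.sum_comp σ fun i => (i : ZMod 2), CharTwo.add_self_eq_zero]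
  have h4 : ∀ i j, inv σ i j * ((dim w i + 1 : ZMod 2) * (dim w j + 1)) =
      inv σ i j * (dim w i * dim w j) + inv σ i j * (dim w i + dim w j) + inv σ i j := by
    intro i j; ring
  push_cast [h1]
  push_cast [hw.count, h4] at h
  have hN : invCount σ = ∑ i, ∑ j, inv σ i j := rfl
  rw [hN]
  simp only [Finset.sum_add_distrib, h2, add_mul, one_mul] at h h3 ⊢
  generalize (∑ x, ∑ y, inv σ x y) = N at h ⊢
  generalize (∑ i, (dim w i : ZMod 2) * (i + σ i)) = S at h
  linear_combination -h - h3 - (N + S) * (CharTwo.two_eq_zero : (2 : ZMod 2) = 0)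

theorem sgn_invCount (σ : Equiv.Perm (Fin n)) : sgn (invCount σ) = Equiv.Perm.sign σ := by
  have hsum : ∀ (s : Finset (Fin n)) (f : Fin n → ZMod 2),
      sgn (∑ i ∈ s, f i) = ∏ i ∈ s, sgn (f i) := by
    intro s f
    induction s using Finset.induction_on with
    | empty => simp
    | insert a s ha ih => rw [Finset.sum_insert ha, Finset.prod_insert ha, sgn_add, ih]
  rw [Equiv.Perm.sign_eq_prod_prod_Ioi, invCount, hsum]
  push_cast
  refine Finset.prod_congr rfl fun i _ => ?_
  rw [hsum, ← Finset.prod_subset (Finset.subset_univ (Finset.Ioi i))]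
  · refine Finset.prod_congr rfl fun j hj => ?_
    rw [Finset.mem_Ioi] at hj
    rcases (σ.injective.ne hj.ne).lt_or_gt with h | h <;> simp [inv, hj, h, h.not_gt, sgn_one]
  · intro j _ hj
    rw [Finset.mem_Ioi] at hj
    simp [inv, hj]

theorem invCount_mul (σ τ : Equiv.Perm (Fin n)) :
    sgn (invCount (σ * τ)) = sgn (invCount σ) * sgn (invCount τ) := by
  simp [sgn_invCount]

theorem invCount_one : invCount (1 : Equiv.Perm (Fin n)) = 0 := by
  refine Finset.sum_eq_zero fun i _ => Finset.sum_eq_zero fun j _ => if_neg fun h => ?_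
  exact lt_asymm h.1 h.2

/-! ### Inputs of a composition -/

theorem sum_innerIdx_outerIdx {M : Type*} [AddCommMonoid M] (h : n + m = r + 1) (i : Fin n)
    (F : Fin r → M) :
    ∑ x, F x = ∑ j, F (innerIdx h i j) + ∑ j : {j // j ≠ i}, F (outerIdx h i j j.2) := by
  let e : Fin m ⊕ {j // j ≠ i} → Fin r :=
    Sum.elim (innerIdx h i) fun j => outerIdx h i j j.2
  have he : Function.Bijective e := by
    rw [Fintype.bijective_iff_injective_and_card]
    constructor
    · rintro (j | j) (k | k) H
      · exact congrArg _ (innerIdx_injective h i H)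
      · exact (outerIdx_ne_innerIdx h i k.2 j H.symm).elim
      · exact (outerIdx_ne_innerIdx h i j.2 k H).elim
      · exact congrArg _ (Subtype.ext (outerIdx_injective h i j.2 k.2 H))
    · have := i.pos
      simp [Fintype.card_subtype_compl]
      omega
  rw [← he.sum_comp, Fintype.sum_sum_type]
  rfl

theorem innerIdx_lt_innerIdx (h : n + m = r + 1) (i : Fin n) (j k : Fin m) :
    innerIdx h i j < innerIdx h i k ↔ j < k := by
  rw [Fin.lt_def, Fin.lt_def]
  simp [innerIdx]

theorem innerIdx_lt_outerIdx (h : n + m = r + 1) (i : Fin n) (j : Fin m) {k : Fin n}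
    (hk : k ≠ i) : innerIdx h i j < outerIdx h i k hk ↔ i < k := by
  have := Fin.val_ne_of_ne hk
  simp only [innerIdx, outerIdx, Fin.lt_def]
  split_ifs <;> omega

theorem outerIdx_lt_innerIdx (h : n + m = r + 1) (i : Fin n) (j : Fin m) {k : Fin n}
    (hk : k ≠ i) : outerIdx h i k hk < innerIdx h i j ↔ k < i := by
  have := Fin.val_ne_of_ne hk
  simp only [innerIdx, outerIdx, Fin.lt_def]
  split_ifs <;> omega

theorem outerIdx_lt_outerIdx (h : n + m = r + 1) (i : Fin n) {j k : Fin n} (hj : j ≠ i)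
    (hk : k ≠ i) : outerIdx h i j hj < outerIdx h i k hk ↔ j < k := by
  have := Fin.val_ne_of_ne hk
  have := Fin.val_ne_of_ne hj
  simp only [outerIdx, Fin.lt_def]
  split_ifs <;> omega

/-- The parity of the permutation of the inputs of a composition. -/
theorem invCount_comp (h : n + m = r + 1) (i : Fin n) (σ : Equiv.Perm (Fin n))
    (τ : Equiv.Perm (Fin m)) (ρ : Equiv.Perm (Fin r))
    (hin : ∀ j, ρ (innerIdx h i j) = innerIdx h (σ i) (τ j))
    (hout : ∀ j (hj : j ≠ i),
      ρ (outerIdx h i j hj) = outerIdx h (σ i) (σ j) (σ.injective.ne hj)) :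
    invCount ρ = invCount σ + invCount τ + (m + 1) * (i + σ i) := by
  have hii : ∀ j k, inv ρ (innerIdx h i j) (innerIdx h i k) = inv τ j k := by
    intro j k
    simp only [inv, hin, innerIdx_lt_innerIdx]
  have hio : ∀ j (k : {k // k ≠ i}),
      inv ρ (innerIdx h i j) (outerIdx h i k k.2) = inv σ i k := by
    intro j k
    simp only [inv, hin, hout k k.2, innerIdx_lt_outerIdx, outerIdx_lt_innerIdx]
  have hoi : ∀ j (k : {k // k ≠ i}),
      inv ρ (outerIdx h i k k.2) (innerIdx h i j) = inv σ k i := by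
    intro j k
    simp only [inv, hin, hout k k.2, innerIdx_lt_outerIdx, outerIdx_lt_innerIdx]
  have hoo : ∀ (j k : {k // k ≠ i}),
      inv ρ (outerIdx h i j j.2) (outerIdx h i k k.2) = inv σ j k := by
    intro j k
    simp only [inv, hout j j.2, hout k k.2, outerIdx_lt_outerIdx]
  have hself : inv σ i i = 0 := by simp [inv]
  have hsub : ∀ f : Fin n → ZMod 2, ∑ k, f k = f i + ∑ k : {k // k ≠ i}, f k := fun f => by
    rw [Fintype.sum_eq_add_sum_subtype_ne f i]
  have hI := sum_inv_add_inv σ i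
  rw [hsub, hself, add_zero, zero_add, Finset.sum_add_distrib] at hI
  have hσ : invCount σ = (∑ k : {k // k ≠ i}, inv σ i k + ∑ k : {k // k ≠ i}, inv σ k i) +
      ∑ j : {k // k ≠ i}, ∑ k : {k // k ≠ i}, inv σ j k := by
    rw [invCount, hsub, hsub, hself, zero_add]
    simp only [hsub (inv σ _), Finset.sum_add_distrib]
    ring
  have hρ : invCount ρ = invCount τ + m * ((∑ k : {k // k ≠ i}, inv σ i k) +
      ∑ k : {k // k ≠ i}, inv σ k i) +
      ∑ j : {k // k ≠ i}, ∑ k : {k // k ≠ i}, inv σ j k := by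
    rw [invCount, sum_innerIdx_outerIdx h i, show invCount τ = ∑ i, ∑ j, inv τ i j from rfl]
    simp only [sum_innerIdx_outerIdx h i (inv ρ _), hii, hio, hoi, hoo, Finset.sum_add_distrib,
      Finset.sum_const, Finset.card_univ, Fintype.card_fin, nsmul_eq_mul,
      ← Finset.mul_sum]
    ring
  rw [hI] at hσ hρ
  rw [hσ, hρ]
  linear_combination -(i + σ i : ZMod 2) * (CharTwo.two_eq_zero : (2 : ZMod 2) = 0)

/-! ### Signs of compositions -/

theorem cast_eq_of_add_eq (h : n + m = r + 1) : (r : ZMod 2) = n + m + 1 := by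
  have : ((n + m : ℕ) : ZMod 2) = ((r + 1 : ℕ) : ZMod 2) := by rw [h]
  push_cast at this
  rw [this]
  linear_combination -(CharTwo.two_eq_zero : (2 : ZMod 2) = 0)

theorem cast_innerIdx (h : n + m = r + 1) (i : Fin n) (y : Fin m) :
    ((innerIdx h i y : Fin r) : ZMod 2) = i + y := by simp [innerIdx]

theorem cast_outerIdx (h : n + m = r + 1) (i : Fin n) {k : Fin n} (hk : k ≠ i) :
    ((outerIdx h i k hk : Fin r) : ZMod 2) = k + if i < k then (m + 1 : ZMod 2) else 0 := by
  rcases hk.lt_or_gt with hk' | hk'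
  · simp [outerIdx, hk', hk'.not_gt]
  · have : (outerIdx h i k hk : ℕ) + 1 = k + m := by
      have := Fin.lt_def.1 hk'
      simp [outerIdx, hk'.not_gt]
      omega
    have : (((outerIdx h i k hk : ℕ) + 1 : ℕ) : ZMod 2) = ((k + m : ℕ) : ZMod 2) := by rw [this]
    push_cast at this
    rw [if_pos hk']
    linear_combination this - (CharTwo.two_eq_zero : (2 : ZMod 2) = 0)

/-- `Substitutes h i p Q c` means that `c` is obtained from `p` by replacing the successive steps in
the direction `i` by the successive segments of `Q`, the number of segments being the right one,
and every segment of `Q` ending with `none`. -/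
inductive Substitutes (h : n + m = r + 1) (i : Fin n) : Word n → Word m → Word r → Prop
  | nil : Substitutes h i [] [] []
  | mark {p Q c} : Substitutes h i p Q c → Substitutes h i (none :: p) Q (none :: c)
  | outer {p Q c} (j : Fin n) (hj : j ≠ i) : Substitutes h i p Q c →
      Substitutes h i (some j :: p) Q (some (outerIdx h i j hj) :: c)
  | inner {p Q c} (y : Fin m) : Substitutes h i (some i :: p) Q c →
      Substitutes h i (some i :: p) (some y :: Q) (some (innerIdx h i y) :: c)
  | cut {p Q c} : Substitutes h i p Q c → Substitutes h i (some i :: p) (none :: Q) c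

section
variable {h : n + m = r + 1} {i : Fin n}

theorem substitutes_substWord_nil {p : Word n} (hp : p.count (some i) = 0) (S : List (Word m)) :
    Substitutes h i p [] (substWord h i p S) := by
  induction p generalizing S with
  | nil => exact .nil
  | cons x p ih =>
    rcases x with _ | j
    · exact .mark (ih (by simpa using hp) S)
    by_cases hj : j = i
    · subst hj
      simp at hp
    · rw [List.count_cons_of_ne (by simpa using hj)] at hp
      rw [substWord, dif_neg hj]
      exact .outer j hj (ih hp S)

theorem splitOn_cons_none (q : Word m) :
    (none :: q : Word m).splitOn none = [] :: q.splitOn none := by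
  simp [List.splitOn, List.splitOnP_cons_eq_if_splitOnPPrepend]

theorem splitOn_cons_some (y : Fin m) (q : Word m) :
    (some y :: q : Word m).splitOn none =
      (some y :: (q.splitOn none).headD []) :: (q.splitOn none).tail := by
  have : List.splitOn none q ≠ [] := List.splitOnPPrepend_ne_nil _ _ []
  rw [List.splitOn, List.splitOnP_cons_eq_if_splitOnPPrepend, if_neg (by simp),
    List.splitOnPPrepend_eq_modifyHead, ← List.splitOn]
  generalize List.splitOn none q = S at *
  cases S
  · contradiction
  · rfl

theorem substitutes_compWord {p : Word n} {q : Word m} (hpq : p.count (some i) = marks q + 1) :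
    Substitutes h i p (q ++ [none]) (compWord h i p q) := by
  rw [compWord]
  induction p generalizing q with
  | nil => simp at hpq
  | cons x p ih =>
    rcases x with _ | j
    · exact .mark (ih (by simpa using hpq))
    by_cases hj : j = i
    · subst hj
      induction q with
      | nil =>
        rw [List.splitOn_nil, substWord, dif_pos rfl]
        exact .cut (substitutes_substWord_nil (by simpa [marks] using hpq) _)
      | cons y q ihq =>
        rcases y with _ | y
        · rw [splitOn_cons_none, substWord, dif_pos rfl]
          exact .cut (ih (by simpa [marks] using hpq))
        · have := ihq (by simpa [marks] using hpq)
          rw [substWord, dif_pos rfl] at this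
          rw [splitOn_cons_some, substWord, dif_pos rfl]
          exact .inner y this
    · rw [List.count_cons_of_ne (by simpa using hj)] at hpq
      rw [substWord, dif_neg hj]
      exact .outer j hj (ih hpq)

namespace Substitutes
variable {p : Word n} {Q : Word m} {c : Word r}

theorem length (H : Substitutes h i p Q c) : (c.length : ZMod 2) = p.length + Q.length := by
  induction H with
  | nil => simp
  | cut _ ih => simp [ih]; linear_combination -(CharTwo.two_eq_zero : (2 : ZMod 2) = 0)
  | _ => simp_all; ring

theorem marks (H : Substitutes h i p Q c) : marks c = marks p := by
  induction H <;> simp_all [LatticePath.marks]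

theorem count_inner (H : Substitutes h i p Q c) (y : Fin m) :
    c.count (some (innerIdx h i y)) = Q.count (some y) := by
  induction H with
  | inner z _ ih => 
    simp [List.count_cons, ih, (innerIdx_injective h i).eq_iff]
  | _ => simp_all [outerIdx_ne_innerIdx]

theorem count_outer (H : Substitutes h i p Q c) {j : Fin n} (hj : j ≠ i) :
    c.count (some (outerIdx h i j hj)) = p.count (some j) := by
  induction H with
  | outer k hk _ ih => 
    have : outerIdx h i k hk = outerIdx h i j hj ↔ k = j :=
      ⟨outerIdx_injective h i hk hj, fun H => by subst H; rfl⟩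
    simp [List.count_cons, ih, this]
  | _ => simp_all [hj.symm, (outerIdx_ne_innerIdx h i hj _).symm]

theorem numBelow_outer (H : Substitutes h i p Q c) {j : Fin n} (hj : j ≠ i) :
    (numBelow (outerIdx h i j hj) c : ZMod 2) =
      numBelow j p + if i < j then (Q.length : ZMod 2) else 0 := by
  induction H with
  | nil => simp
  | mark _ ih => simpa using ih
  | outer k hk _ ih =>
    simp only [numBelow_some, outerIdx_lt_outerIdx, Nat.cast_add, ih]
    ring
  | inner z _ ih =>
    simp only [numBelow_some, innerIdx_lt_outerIdx, Nat.cast_add, ih, List.length_cons]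
    split_ifs <;> push_cast <;> ring
  | cut _ ih =>
    simp only [numBelow_some, Nat.cast_add, ih, List.length_cons]
    split_ifs
    · push_cast
      linear_combination -(CharTwo.two_eq_zero : (2 : ZMod 2) = 0)
    · push_cast
      ring

theorem numBelow_inner (H : Substitutes h i p Q c) (y : Fin m) :
    (numBelow (innerIdx h i y) c : ZMod 2) = numBelow y Q + numBelow i p := by
  induction H with
  | nil => simp
  | mark _ ih => simpa using ih
  | outer k hk _ ih =>
    simp only [numBelow_some, outerIdx_lt_innerIdx, Nat.cast_add, ih]
    ring
  | inner z _ ih =>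
    simp only [numBelow_some _ (innerIdx h i z), innerIdx_lt_innerIdx,
      Nat.cast_add, ih, numBelow_some y z]
    ring
  | cut _ ih => simpa using ih

/-- The sign of the Koszul substitution in terms of the twists of the words. -/
theorem mul_eq (H : Substitutes h i p Q c) : mul h i (bas p) (bas Q) =
    sgn (twist p + twist Q + twist c + Q.length * (numBelow i p + i + 1) +
      (m + 1) * (p.length + numBelow i p) + p.count (some i)) • bas c := by
  have hr := cast_eq_of_add_eq h
  have two : (2 : ZMod 2) = 0 := CharTwo.two_eq_zero
  induction H with
  | nil => simp [twist, numBelow]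
  | @mark p Q c H ih =>
    rw [bas_cons, mul_none, par_bas, map_smul, ih, smul_smul, ← sgn_add, map_smul, bas_cons]
    congr 2
    have h1 : numBelow i (none :: p) = numBelow i p := by simp [numBelow]
    have h2 : (none :: p).count (some i) = p.count (some i) := List.count_cons_of_ne (by simp)
    simp only [twist, h1, h2, H.length, hr, List.length_cons]
    push_cast
    linear_combination (-(p.length + n + m + 1 : ZMod 2) - 1) * two
  | @outer p Q c k hk H ih =>
    rw [bas_cons, mul_outer h i hk, par_bas, map_smul, ih, smul_smul, ← sgn_add, map_smul, bas_cons]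
    congr 2
    have h1 : (numBelow i (some k :: p) : ZMod 2) = numBelow i p + if k < i then 1 else 0 := by
      simp [numBelow, List.countP_cons]
    have h2 : (some k :: p).count (some i) = p.count (some i) :=
      List.count_cons_of_ne (by simpa using hk)
    simp only [twist, h1, h2, cast_outerIdx, H.numBelow_outer hk, List.length_cons]
    push_cast
    rcases hk.lt_or_gt with hk' | hk'
    · simp only [hk', hk'.not_gt, if_true, if_false]
      linear_combination -(m + 1 + k + numBelow k p : ZMod 2) * two
    · simp only [hk', hk'.not_gt, if_true, if_false]
      linear_combination -(m + 1 + k + numBelow k p : ZMod 2) * two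
  | @inner p Q c z H ih =>
    rw [bas_cons (some i) p] at ih ⊢
    rw [bas_cons, mul_inner_some, ih, map_smul, ← bas_cons, ← neg_smul, ← sgn_add_one]
    congr 2
    simp only [twist, cast_innerIdx, H.numBelow_inner, List.length_cons, numBelow_self]
    push_cast
    linear_combination (-(i + z + numBelow i p + numBelow z Q) : ZMod 2) * two
  | @cut p Q c H ih =>
    rw [bas_cons, bas_cons, mul_inner_none, par_bas, map_smul, ih, smul_smul, ← sgn_add]
    congr 2
    simp only [twist, List.length_cons, numBelow_self, List.count_cons_self]
    push_cast
    linear_combination (-(i + numBelow i p + m + 2) : ZMod 2) * two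

end Substitutes

theorem innerIdx_or_outerIdx (h : n + m = r + 1) (i : Fin n) (x : Fin r) :
    (∃ y, innerIdx h i y = x) ∨ ∃ j, ∃ hj : j ≠ i, outerIdx h i j hj = x := by
  by_cases h₁ : (x : ℕ) < i
  · refine .inr ⟨⟨x, by omega⟩, Fin.ne_of_val_ne h₁.ne, ?_⟩
    simp [outerIdx, Fin.lt_def, h₁]
  by_cases h₂ : (x : ℕ) < i + m
  · exact .inl ⟨⟨x - i, by omega⟩, Fin.ext (by simp [innerIdx]; omega)⟩
  · refine .inr ⟨⟨x + 1 - m, by omega⟩, Fin.ne_of_val_ne (by simp; omega), ?_⟩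
    have : ¬ (x : ℕ) + 1 - m < i := by omega
    simp [outerIdx, Fin.lt_def, Fin.ext_iff, this]
    omega

theorem Full.of_substitutes {p : Word n} {q : Word m} {c : Word r}
    (H : Substitutes h i p (q ++ [none]) c) : Full c ↔ (∀ j ≠ i, some j ∈ p) ∧ Full q := by
  have hq : ∀ y, some y ∈ q ↔ some (innerIdx h i y) ∈ c := by
    intro y
    rw [← List.count_pos_iff, ← List.count_pos_iff, H.count_inner, List.count_append]
    simp
  have hp : ∀ j (hj : j ≠ i), some j ∈ p ↔ some (outerIdx h i j hj) ∈ c := by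
    intro j hj
    rw [← List.count_pos_iff, ← List.count_pos_iff, H.count_outer]
  constructor
  · exact fun hc => ⟨fun j hj => (hp j hj).2 (hc _), fun y => (hq y).2 (hc _)⟩
  · rintro ⟨h₁, h₂⟩ x
    obtain ⟨y, rfl⟩ | ⟨j, hj, rfl⟩ := innerIdx_or_outerIdx h i x
    · exact (hq y).1 (h₂ y)
    · exact (hp j hj).1 (h₁ j hj)

end

theorem mul_eq_zero_or (h : n + m = r + 1) (i : Fin n) (p : Word n) (q : Word m) :
    (mul h i (bas p) (bas (q ++ [none])) = 0) ∨ p.count (some i) = marks q + 1 := by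
  by_cases hpq : p.count (some i) = (q ++ [none]).count none
  · right
    rw [hpq, List.count_append, marks]
    rfl
  · exact .inl (mul_eq_zero_of_count_ne h i p _ hpq)

/-- If the product is full, the outer word can lack steps in the direction `i` only; but without
such steps the product is `0`, since the inner word has at least one segment. -/
theorem pr_mul_left (h : n + m = r + 1) (i : Fin n) (u : Chain n) (v : Chain m) :
    pr (mul h i (pr u) (app v)) = pr (mul h i u (app v)) := by
  refine eq_of_bas₂ ((mul h i ∘ₗ pr).compl₂ app |>.compr₂ pr) ((mul h i).compl₂ app |>.compr₂ pr)
    (fun p q => ?_) u v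
  simp only [LinearMap.compr₂_apply, LinearMap.compl₂_apply, LinearMap.comp_apply, app_bas]
  by_cases hp : Full p
  · rw [pr_bas_of_full hp]
  rw [pr_bas_of_not_full hp]
  rcases mul_eq_zero_or h i p q with H | H
  · simp [H]
  · have hc := substitutes_compWord (h := h) H
    rw [hc.mul_eq, map_smul, pr_bas_of_not_full]
    · simp
    · rw [Full.of_substitutes hc]
      refine fun hf => hp fun j => ?_
      by_cases hj : j = i
      · subst hj
        exact List.count_pos_iff.1 (by omega)
      · exact hf.1 j hj

theorem pr_mul_right (h : n + m = r + 1) (i : Fin n) (u : Chain n) (v : Chain m) :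
    pr (mul h i u (app (pr v))) = pr (mul h i u (app v)) := by
  refine eq_of_bas₂ ((mul h i).compl₂ (app ∘ₗ pr) |>.compr₂ pr) ((mul h i).compl₂ app |>.compr₂ pr)
    (fun p q => ?_) u v
  simp only [LinearMap.compr₂_apply, LinearMap.compl₂_apply, LinearMap.comp_apply]
  by_cases hq : Full q
  · rw [pr_bas_of_full hq]
  rw [pr_bas_of_not_full hq, app_bas]
  rcases mul_eq_zero_or h i p q with H | H
  · simp [H]
  · have hc := substitutes_compWord (h := h) H
    rw [hc.mul_eq, map_smul, pr_bas_of_not_full]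
    · simp
    · rw [Full.of_substitutes hc]
      exact fun hf => hq hf.2

/-- The exponent of the sign by which the composition of elements of degrees `a` and `b` differs
from the Koszul substitution `mul` after the change of signs `tw`. -/
def compSign (n m : ℕ) (i : Fin n) (a b : ℤ) : ZMod 2 :=
  b * (a + 1) + (m + 1) * (a + n + i + 1) + m

theorem twist_append_none (q : Word m) :
    twist (q ++ [none]) = twist q + marks q + m + 1 := by
  induction q with
  | nil => simp [twist, marks]
  | cons x q ih =>
    rcases x with _ | y
    · have : marks (none :: q) = marks q + 1 := by simp [marks]
      simp only [List.cons_append, twist, ih, List.length_append, this, List.length_singleton]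
      push_cast
      ring
    · have : numBelow y (q ++ [none]) = numBelow y q := by simp [numBelow]
      have h2 : marks (some y :: q) = marks q := by simp [marks]
      simp only [List.cons_append, twist, ih, this, h2]
      ring

/-- The comparison of the sign in the definition of `circ` with that of `mul`. -/
theorem single_compWord (h : n + m = r + 1) (i : Fin n) {p : Word n} {q : Word m} (hp : Full p)
    (hq : Full q) (hpq : marks q = dim p i) :
    sgn (wdeg q * (wdeg p + ∑ j ∈ Finset.Iio i, (dim p j : ZMod 2))) • bas (compWord h i p q) =
      sgn (compSign n m i (wdeg p) (wdeg q)) •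
        tw (pr (mul h i (tw (bas p)) (app (tw (bas q))))) := by
  have H : p.count (some i) = marks q + 1 := by rw [hp.count, hpq]
  have hc := substitutes_compWord (h := h) H
  have hf := (Full.of_substitutes hc).2 ⟨fun j _ => hp j, hq⟩
  rw [tw_bas, tw_bas, map_smul, map_smul, map_smul, LinearMap.smul_apply, app_bas, hc.mul_eq]
  simp only [map_smul, pr_bas_of_full hf, tw_bas, smul_smul, ← sgn_add]
  congr 2
  rw [twist_append_none, hp.sum_dim, compSign, hp.wdeg, hq.wdeg, H, List.length_append,
    List.length_singleton]
  push_cast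
  have two : (2 : ZMod 2) = 0 := CharTwo.two_eq_zero
  generalize twist p = t₁, twist q = t₂, twist (compWord h i p q) = t₃
  generalize (p.length : ZMod 2) = a, (q.length : ZMod 2) = b, (numBelow i p : ZMod 2) = c,
    (marks q : ZMod 2) = d, (n : ZMod 2) = e, (m : ZMod 2) = f, (i : ZMod 2) = g
  have key : ∀ a b c d e f g : ZMod 2, (b + f) * (a + e + (c + g)) =
      (b + f) * (a + e + 1) + (f + 1) * (a + e + e + g + 1) + f +
        (d + f + 1 + (b + 1) * (c + g + 1) + (f + 1) * (a + c) + (d + 1)) := by decide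
  linear_combination key a b c d e f g - (t₁ + t₂ + t₃) * two

/-- The composition in terms of `mul`. The sum over all colours of `y` may be truncated, since only
finitely many colours match the terms of `x`; the matching colours are selected by `mul`, which
vanishes if the number of segments is wrong. -/
theorem circ_eq (h : n + m = r + 1) (i : Fin n) {x : Chain n} {y : ℕ → Chain m} {a b : ℤ}
    (hx : x ∈ Finsupp.supported ℤ ℤ {p | Full p ∧ wdeg p = a})
    (hy : ∀ l, y l ∈ Finsupp.supported ℤ ℤ {q | Full q ∧ marks q = l ∧ wdeg q = b}) :
    ∀ᶠ N in Filter.atTop, circ h i x y = sgn (compSign n m i a b) •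
      tw (pr (mul h i (tw x) (app (tw (∑ j ∈ Finset.range N, y j))))) := by
  have hN : ∀ᶠ N in Filter.atTop, ∀ p ∈ x.support, dim p i < N :=
    (Finset.eventually_all x.support).2 fun p _ => Filter.eventually_gt_atTop _
  filter_upwards [hN] with N hN
  have hx' : tw (pr (mul h i (tw x) (app (tw (∑ j ∈ Finset.range N, y j))))) =
      x.sum fun p a => a •
        tw (pr (mul h i (tw (bas p)) (app (tw (∑ j ∈ Finset.range N, y j))))) :=
    eq_of_bas ((tw ∘ₗ pr ∘ₗ (mul h i).flip (app (tw (∑ j ∈ Finset.range N, y j)))) ∘ₗ tw)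
      (lift fun p => tw (pr (mul h i (tw (bas p)) (app (tw (∑ j ∈ Finset.range N, y j))))))
      (fun p => by simp) x
  rw [hx', Finsupp.smul_sum, circ]
  refine Finsupp.sum_congr fun p hp => ?_
  obtain ⟨hpf, rfl⟩ : Full p ∧ wdeg p = a := (Finsupp.mem_supported _ _).1 hx hp
  have hsum : mul h i (tw (bas p)) (app (tw (∑ j ∈ Finset.range N, y j))) =
      mul h i (tw (bas p)) (app (tw (y (dim p i)))) := by
    simp only [map_sum]
    refine Finset.sum_eq_single _ (fun j _ hj => ?_)
      (fun hj => (hj (Finset.mem_range.2 (hN p hp))).elim)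
    refine eq_of_bas_of_supported (mul h i (tw (bas p)) ∘ₗ app ∘ₗ tw) 0 (fun q hq => ?_) (hy j)
    have := (mul_eq_zero_or h i p q).resolve_right (by rw [hpf.count, hq.2.1]; omega)
    simp [tw_bas, app_bas, this]
  rw [hsum]
  generalize x p = k
  have hk : (y (dim p i)).sum (fun q b => Finsupp.single (compWord h i p q)
      (k * b * ((wdeg q * (wdeg p + ∑ j ∈ Finset.Iio i, (dim p j : ℤ))).negOnePow : ℤ))) =
      (lift fun q => (k * ((wdeg q * (wdeg p + ∑ j ∈ Finset.Iio i, (dim p j : ℤ))).negOnePow : ℤ)) •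
        bas (compWord h i p q)) (y (dim p i)) := by
    rw [lift, Finsupp.linearCombination_apply]
    refine Finsupp.sum_congr fun q _ => ?_
    rw [single_eq_smul_bas, smul_smul]
    congr 1
    ring
  rw [hk]
  refine eq_of_bas_of_supported _ (sgn (compSign n m i (wdeg p) b) • k •
    (tw ∘ₗ pr ∘ₗ mul h i (tw (bas p)) ∘ₗ app ∘ₗ tw)) (fun q hq => ?_) (hy (dim p i))
  obtain ⟨hqf, hqm, rfl⟩ := hq
  have := single_compWord h i hpf hqf hqm
  rw [lift_bas, mul_smul, negOnePow_eq_sgn]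
  push_cast
  rw [this, smul_comm]
  rfl

/-! ### The complexity of lattice paths -/

@[simp] theorem angles_nil : angles ([] : Word n) = 0 := rfl

@[simp] theorem angles_singleton (x : Option (Fin n)) : angles [x] = 0 := rfl

theorem angles_cons_cons (x y : Option (Fin n)) (w : Word n) :
    angles (x :: y :: w) = angles (y :: w) + if x ≠ y then 1 else 0 := by
  simp [angles, List.countP_cons]

theorem angles_le_cons (x : Option (Fin n)) (w : Word n) : angles w ≤ angles (x :: w) := by
  cases w with
  | nil => simp
  | cons y w => rw [angles_cons_cons]; omega

theorem angles_cons_le (x y : Option (Fin n)) (w : Word n) :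
    angles (x :: w) ≤ angles (x :: y :: w) := by
  cases w with
  | nil => simp
  | cons z w =>
    simp only [angles_cons_cons]
    by_cases hxz : x = z
    · rw [if_neg (not_not.2 hxz)]
      omega
    · by_cases hxy : x = y
      · subst hxy; simp
      · simp [hxz, hxy]

/-- `Thins f p c` means that `c` is obtained from `p` by deleting or repeating letters and applying
`f`. This does not increase the number of angles. -/
inductive Thins (f : Option (Fin n) → Option (Fin r)) : Word n → Word r → Prop
  | nil : Thins f [] []
  | keep {p c} (x) : Thins f p c → Thins f (x :: p) (f x :: c)
  | skip {p c} (x) : Thins f p c → Thins f (x :: p) c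
  | dup {p c} (x) : Thins f (x :: p) c → Thins f (x :: p) (f x :: c)

theorem Thins.angles_le {f : Option (Fin n) → Option (Fin r)} {p : Word n} {c : Word r}
    (H : Thins f p c) : angles c ≤ angles p := by
  suffices angles c ≤ angles p ∧ ∀ x, angles (f x :: c) ≤ angles (x :: p) from this.1
  have hf : ∀ x y, (if f x ≠ f y then 1 else 0) ≤ if x ≠ y then 1 else 0 := by
    intro x y
    by_cases hxy : x = y
    · simp [hxy]
    · simp only [ne_eq, hxy, not_false_eq_true, if_true]
      split_ifs <;> omega
  induction H with
  | nil => simp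
  | keep y _ ih =>
    refine ⟨ih.2 y, fun x => ?_⟩
    rw [angles_cons_cons, angles_cons_cons]
    exact add_le_add (ih.2 y) (hf x y)
  | skip y _ ih =>
    exact ⟨ih.1.trans (angles_le_cons _ _), fun x => (ih.2 x).trans (angles_cons_le _ _ _)⟩
  | @dup p c y _ ih =>
    have h := ih.2 y
    rw [angles_cons_cons, if_neg (by simp), add_zero] at h
    refine ⟨h, fun x => ?_⟩
    rw [angles_cons_cons, angles_cons_cons]
    exact add_le_add h (hf x y)

theorem proj_comm (i j : Fin n) (w : Word n) : proj i j w = proj j i w := by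
  simp only [proj, or_comm]

theorem proj_cons_none (i j : Fin n) (w : Word n) : proj i j (none :: w) = proj i j w := by
  simp [proj]

theorem proj_cons_some (i j k : Fin n) (w : Word n) :
    proj i j (some k :: w) = if k = i ∨ k = j then some k :: proj i j w else proj i j w := by
  simp [proj, List.filter_cons]

/-- The condition that the complexity of a path is at most `c`, in a symmetric form. -/
def Bounded (c : ℕ∞) (w : Word n) : Prop := ∀ i j, i ≠ j → (angles (proj i j w) : ℕ∞) ≤ c

theorem mem_latDeg {c : ℕ∞} {l : ℕ} {a : ℤ} {w : Word n} :
    w ∈ LatDeg c n l a ↔ Full w ∧ marks w = l ∧ wdeg w = a ∧ Bounded c w := by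
  have hB : Bounded c w ↔ ∀ i j, i < j → (angles (proj i j w) : ℕ∞) ≤ c := by
    refine ⟨fun h i j hij => h i j hij.ne, fun h i j hij => ?_⟩
    rcases hij.lt_or_gt with hij | hij
    · exact h i j hij
    · rw [proj_comm]; exact h j i hij
  rw [hB]
  constructor
  · rintro ⟨k, hk, h₁, h₂, h₃⟩
    have hf : Full w := fun s => List.count_pos_iff.1 (by rw [h₁ s]; omega)
    have hd : ∀ s, dim w s = k s := fun s => by rw [dim, h₁]; rfl
    refine ⟨hf, h₂, ?_, h₃⟩
    simp only [LatticePath.wdeg, hd]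
    rw [marks, h₂, hk]
  · rintro ⟨hf, rfl, hw, h₃⟩
    exact ⟨dim w, hw, hf.count, rfl, h₃⟩

theorem Thins.of_sublist {p q : Word n} (H : q.Sublist p) : Thins id p q := by
  induction H with
  | slnil => exact .nil
  | cons x _ ih => exact .skip x ih
  | cons_cons x _ ih => exact .keep x ih

theorem faceWord_sublist (s : Fin n) (i : ℕ) (w : Word n) : (faceWord s i w).Sublist w := by
  induction w generalizing i with
  | nil => rw [faceWord]
  | cons x w ih =>
    by_cases hx : x = some s
    · rcases i with _ | i
      · rw [faceWord, if_pos hx]; exact List.sublist_cons_self _ _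
      · rw [faceWord, if_pos hx]; exact (ih i).cons_cons _
    · cases i <;> rw [faceWord, if_neg hx] <;> exact (ih _).cons_cons _

theorem Bounded.faceWord {c : ℕ∞} {w : Word n} (hw : Bounded c w) (s : Fin n) (i : ℕ) :
    Bounded c (faceWord s i w) := fun j k hjk =>
  (Nat.cast_le.2 (Thins.of_sublist ((faceWord_sublist s i w).filter _)).angles_le).trans
    (hw j k hjk)

theorem proj_cofaceWord (j k : Fin n) (i : ℕ) (w : Word n) :
    proj j k (cofaceWord i w) = proj j k w := by
  induction w generalizing i with
  | nil => cases i <;> simp [cofaceWord, proj]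
  | cons x w ih =>
    rcases i with _ | i
    · rw [cofaceWord, proj_cons_none]
    · rcases x with _ | a
      · rw [cofaceWord, proj_cons_none, proj_cons_none, ih]
      · rw [cofaceWord, proj_cons_some, proj_cons_some, ih]

theorem Bounded.cofaceWord {c : ℕ∞} {w : Word n} (hw : Bounded c w) (i : ℕ) :
    Bounded c (cofaceWord i w) := fun j k hjk => by
  rw [proj_cofaceWord]
  exact hw j k hjk

theorem Bounded.permWord {c : ℕ∞} {w : Word n} (hw : Bounded c w) (σ : Equiv.Perm (Fin n)) :
    Bounded c (permWord σ w) := fun j k hjk => by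
  refine le_trans (Nat.cast_le.2 (Thins.angles_le (f := Option.map σ) ?_))
    (hw (σ.symm j) (σ.symm k) (σ.symm.injective.ne hjk))
  clear hw
  induction w with
  | nil => exact .nil
  | cons x w ih =>
    rcases x with _ | a
    · rwa [permWord_cons, Option.map_none, proj_cons_none, proj_cons_none]
    · rw [permWord_cons, Option.map_some, proj_cons_some, proj_cons_some]
      simp only [← Equiv.eq_symm_apply]
      split_ifs
      · exact .keep _ ih
      · exact ih

namespace Substitutes
variable {h : n + m = r + 1} {i : Fin n} {p : Word n} {Q : Word m} {w : Word r}

theorem thins_inner (H : Substitutes h i p Q w) (y z : Fin m) :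
    Thins (Option.map (innerIdx h i)) (proj y z Q) (proj (innerIdx h i y) (innerIdx h i z) w) := by
  induction H with
  | nil => exact .nil
  | mark _ ih => rwa [proj_cons_none]
  | outer k hk _ ih =>
    rw [proj_cons_some, if_neg (by simp [outerIdx_ne_innerIdx])]
    exact ih
  | inner x _ ih =>
    rw [proj_cons_some, proj_cons_some]
    simp only [(innerIdx_injective h i).eq_iff]
    split_ifs
    · exact .keep (some x) ih
    · exact ih
  | cut _ ih => rwa [proj_cons_none]

/-- The value `none` at steps in the direction `i` is irrelevant, since such steps do not occur in
these projections. -/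
theorem thins_outer (H : Substitutes h i p Q w) {j k : Fin n} (hj : j ≠ i) (hk : k ≠ i) :
    Thins (fun x => x.bind fun a => if ha : a ≠ i then some (outerIdx h i a ha) else none)
      (proj j k p) (proj (outerIdx h i j hj) (outerIdx h i k hk) w) := by
  induction H with
  | nil => exact .nil
  | mark _ ih => rwa [proj_cons_none, proj_cons_none]
  | outer a ha _ ih =>
    have hinj : ∀ b (hb : b ≠ i), outerIdx h i a ha = outerIdx h i b hb ↔ a = b := fun b hb =>
      ⟨outerIdx_injective h i ha hb, fun H => by subst H; rfl⟩
    rw [proj_cons_some, proj_cons_some]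
    simp only [hinj]
    split_ifs
    · have := Thins.keep (some a) ih
      simpa [ha] using this
    · exact ih
  | inner x _ ih =>
    rw [proj_cons_some _ _ (innerIdx h i x), if_neg (by simp [(outerIdx_ne_innerIdx h i _ x).symm])]
    exact ih
  | cut _ ih =>
    rwa [proj_cons_some, if_neg (by simp [hj.symm, hk.symm])]

/-- In the projection to an inner and an outer coordinate, each step of `p` in the direction `i` is
repeated or deleted. -/
theorem thins_mixed (H : Substitutes h i p Q w) (y : Fin m) {j : Fin n} (hj : j ≠ i) :
    Thins (fun x => if x = some i then some (innerIdx h i y) else some (outerIdx h i j hj))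
      (proj i j p) (proj (innerIdx h i y) (outerIdx h i j hj) w) := by
  induction H with
  | nil => exact .nil
  | mark _ ih => rwa [proj_cons_none, proj_cons_none]
  | outer a ha _ ih =>
    have hinj : ∀ b (hb : b ≠ i), outerIdx h i a ha = outerIdx h i b hb ↔ a = b := fun b hb =>
      ⟨outerIdx_injective h i ha hb, fun H => by subst H; rfl⟩
    rw [proj_cons_some, proj_cons_some]
    simp only [hinj, outerIdx_ne_innerIdx, ha, false_or]
    split_ifs with haj
    · subst haj
      have := Thins.keep (some a) ih
      simpa [ha] using this
    · exact ih
  | inner x _ ih =>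
    rw [proj_cons_some _ _ (innerIdx h i x)]
    simp only [(outerIdx_ne_innerIdx h i hj x).symm, (innerIdx_injective h i).eq_iff, or_false]
    split_ifs with hxy
    · subst hxy
      rw [proj_cons_some, if_pos (.inl rfl)] at ih ⊢
      have := Thins.dup (some i) ih
      simpa using this
    · exact ih
  | cut _ ih =>
    rw [proj_cons_some, if_pos (.inl rfl)]
    exact .skip _ ih

theorem bounded {q : Word m} (H : Substitutes h i p (q ++ [none]) w) {c : ℕ∞} (hp : Bounded c p)
    (hq : Bounded c q) : Bounded c w := by
  have hq' : ∀ y z, proj y z (q ++ [none]) = proj y z q := by simp [proj]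
  have hmix : ∀ y j (hj : j ≠ i),
      (angles (proj (innerIdx h i y) (outerIdx h i j hj) w) : ℕ∞) ≤ c := fun y j hj =>
    (Nat.cast_le.2 (H.thins_mixed y hj).angles_le).trans (hp _ _ hj.symm)
  intro a b hab
  obtain ⟨y, rfl⟩ | ⟨j, hj, rfl⟩ := innerIdx_or_outerIdx h i a <;>
    obtain ⟨z, rfl⟩ | ⟨k, hk, rfl⟩ := innerIdx_or_outerIdx h i b
  · refine (Nat.cast_le.2 (H.thins_inner y z).angles_le).trans ?_
    rw [hq']
    exact hq y z (by rintro rfl; exact hab rfl)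
  · exact hmix y k hk
  · rw [proj_comm]
    exact hmix z j hj
  · exact (Nat.cast_le.2 (H.thins_outer hj hk).angles_le).trans
      (hp j k (by rintro rfl; exact hab rfl))

end Substitutes

/-! ### Operations and degrees -/

theorem compWord_mem {c : ℕ∞} {l : ℕ} {a b : ℤ} (h : n + m = r + 1) (i : Fin n) {p : Word n}
    {q : Word m} (hp : p ∈ LatDeg c n l a) (hq : q ∈ LatDeg c m (dim p i) b) :
    compWord h i p q ∈ LatDeg c r l (a + b) := by
  rw [mem_latDeg] at hp hq ⊢
  obtain ⟨hp₁, hp₂, rfl, hp₄⟩ := hp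
  obtain ⟨hq₁, hq₂, rfl, hq₄⟩ := hq
  have H := substitutes_compWord (h := h) (i := i) (p := p) (q := q) (by rw [hp₁.count, hq₂])
  refine ⟨(Full.of_substitutes H).2 ⟨fun j _ => hp₁ j, hq₁⟩, H.marks.trans hp₂, ?_,
    H.bounded hp₄ hq₄⟩
  have h₁ : ∀ y, dim (compWord h i p q) (innerIdx h i y) = dim q y := fun y => by
    rw [dim, H.count_inner, List.count_append, dim]
    simp
  have h₂ : ∀ j : {j // j ≠ i}, dim (compWord h i p q) (outerIdx h i j j.2) = dim p j := fun j => by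
    rw [dim, H.count_outer, dim]
  rw [wdeg, sum_innerIdx_outerIdx h i, H.marks, wdeg, wdeg, hq₂]
  simp only [h₁, h₂]
  rw [Fintype.sum_eq_add_sum_subtype_ne _ i]
  ring

theorem marks_faceWord (s : Fin n) (i : ℕ) (w : Word n) : marks (faceWord s i w) = marks w := by
  induction w generalizing i with
  | nil => rw [faceWord]
  | cons x w ih =>
    by_cases hx : x = some s
    · subst hx
      cases i <;> simp_all [faceWord, marks]
    · cases i <;> rw [faceWord, if_neg hx] <;> simp_all [marks, List.count_cons]

theorem bdry_mem {c : ℕ∞} {l : ℕ} {a : ℤ} {x : Chain n}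
    (hx : x ∈ Finsupp.supported ℤ ℤ (LatDeg c n l a)) :
    bdry x ∈ Finsupp.supported ℤ ℤ (LatDeg c n l (a + 1)) := by
  rw [bdry_eq_lift]
  refine map_mem_supported (fun w hw => ?_) hx
  rw [lift_bas, bdry, bas, Finsupp.sum_single_index (by simp)]
  refine Submodule.sum_mem _ fun s _ => ?_
  split_ifs with hs
  · exact Submodule.zero_mem _
  refine Submodule.sum_mem _ fun i hi => Finsupp.single_mem_supported _ _ ?_
  rw [mem_latDeg] at hw ⊢
  obtain ⟨h₁, h₂, rfl, h₄⟩ := hw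
  rw [← h₁.count, Finset.mem_range] at hi
  refine ⟨(full_faceWord_iff h₁ hi).2 hs, (marks_faceWord s i w).trans h₂, ?_, h₄.faceWord s i⟩
  have hd : ∀ t, (dim w t : ℤ) = dim (faceWord s i w) t + if t = s then 1 else 0 := by
    intro t
    rw [dim, dim, (faceWord_perm hi).count_eq, List.count_cons]
    by_cases hts : t = s
    · subst hts
      have : (faceWord t i w).count (some t) ≠ 0 := by
        have := (faceWord_perm hi).count_eq (some t)
        rw [List.count_cons_self, h₁.count] at this
        omega
      simp
      omega
    · simp [hts, Ne.symm hts]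
  rw [wdeg, wdeg, marks_faceWord]
  simp only [hd, Finset.sum_add_distrib, Finset.sum_ite_eq', Finset.mem_univ, if_true]
  ring

theorem cobdry_mem {c : ℕ∞} {l : ℕ} {a : ℤ} {x : Chain n}
    (hx : x ∈ Finsupp.supported ℤ ℤ (LatDeg c n l a)) :
    cobdry x ∈ Finsupp.supported ℤ ℤ (LatDeg c n (l + 1) (a + 1)) := by
  rw [cobdry_eq_lift]
  refine map_mem_supported (fun w hw => ?_) hx
  rw [lift_bas, cobdry, bas, Finsupp.sum_single_index (by simp)]
  refine Submodule.sum_mem _ fun i hi => Finsupp.single_mem_supported _ _ ?_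
  rw [mem_latDeg] at hw ⊢
  obtain ⟨h₁, rfl, rfl, h₄⟩ := hw
  have hp := cofaceWord_perm i w
  have hm : marks (cofaceWord i w) = marks w + 1 := by
    rw [marks, hp.count_eq, List.count_cons_self, marks]
  have hd : ∀ t, dim (cofaceWord i w) t = dim w t := by
    intro t
    rw [dim, dim, hp.count_eq, List.count_cons_of_ne (by simp)]
  refine ⟨fun s => hp.mem_iff.2 (List.mem_cons_of_mem _ (h₁ s)), hm, ?_, h₄.cofaceWord i⟩
  rw [wdeg, wdeg, hm]
  simp only [hd]
  push_cast
  ring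

theorem permWord_mem {c : ℕ∞} {l : ℕ} {a : ℤ} (σ : Equiv.Perm (Fin n)) {w : Word n}
    (hw : w ∈ LatDeg c n l a) : permWord σ w ∈ LatDeg c n l a := by
  rw [mem_latDeg] at hw ⊢
  obtain ⟨h₁, rfl, rfl, h₄⟩ := hw
  have hm : marks (permWord σ w) = marks w :=
    List.count_map_of_injective w _ (Option.map_injective σ.injective) none
  refine ⟨fun s => ?_, hm, ?_, h₄.permWord σ⟩
  · rw [← List.count_pos_iff, ← σ.apply_symm_apply s, count_permWord, List.count_pos_iff]
    exact h₁ _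
  · rw [wdeg, wdeg, hm, ← Equiv.sum_comp σ]
    simp only [dim, count_permWord]

theorem permLin_mem {c : ℕ∞} {l : ℕ} {a : ℤ} (σ : Equiv.Perm (Fin n)) {x : Chain n}
    (hx : x ∈ Finsupp.supported ℤ ℤ (LatDeg c n l a)) :
    permLin σ x ∈ Finsupp.supported ℤ ℤ (LatDeg c n l a) := by
  rw [permLin_eq_lift]
  refine map_mem_supported (fun w hw => ?_) hx
  rw [lift_bas, permLin, bas, Finsupp.sum_single_index (by simp)]
  exact Finsupp.single_mem_supported _ _ (permWord_mem σ hw)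

theorem circ_mem {c : ℕ∞} {l : ℕ} {a b : ℤ} (h : n + m = r + 1) (i : Fin n) {x : Chain n}
    {y : ℕ → Chain m} (hx : x ∈ Finsupp.supported ℤ ℤ (LatDeg c n l a))
    (hy : ∀ k, y k ∈ Finsupp.supported ℤ ℤ (LatDeg c m k b)) :
    circ h i x y ∈ Finsupp.supported ℤ ℤ (LatDeg c r l (a + b)) := by
  refine Submodule.sum_mem _ fun p hp => Submodule.sum_mem _ fun q hq =>
    Finsupp.single_mem_supported _ _ ?_
  exact compWord_mem h i ((Finsupp.mem_supported _ _).1 hx hp)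
    ((Finsupp.mem_supported _ _).1 (hy _) hq)

/-! ### The operations on chains of full paths -/

@[simp] theorem pr_pr (v : Chain n) : pr (pr v) = pr v :=
  eq_of_bas (pr ∘ₗ pr) pr (fun w => by by_cases hw : Full w <;> simp [pr_bas, hw]) v

theorem pr_eq_self {S : Set (Word n)} (hS : ∀ w ∈ S, Full w) {v : Chain n}
    (hv : v ∈ Finsupp.supported ℤ ℤ S) : pr v = v :=
  eq_of_bas_of_supported pr LinearMap.id (fun w hw => pr_bas_of_full (hS w hw)) hv

theorem pr_dup (v : Chain n) : pr (dup v) = dup (pr v) := by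
  refine eq_of_bas (pr ∘ₗ dup) (dup ∘ₗ pr) (fun w => ?_) v
  have hf : ∀ i, Full (cofaceWord i w) ↔ Full w := fun i =>
    forall_congr' fun s => by simp [(cofaceWord_perm i w).mem_iff]
  by_cases hw : Full w <;> simp [pr_bas, dup_bas, hf, hw]

theorem pr_rm_pr (v : Chain n) : pr (rm (pr v)) = pr (rm v) := by
  refine eq_of_bas (pr ∘ₗ rm ∘ₗ pr) (pr ∘ₗ rm) (fun w => ?_) v
  by_cases hw : Full w
  · simp [pr_bas, hw]
  · have hf : ∀ s i, ¬ Full (faceWord s i w) := fun s i hf =>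
      hw fun t => (faceWord_sublist s i w).subset (hf t)
    simp [pr_bas, rm_bas, hw, hf]

theorem pr_rel (σ : Equiv.Perm (Fin n)) (v : Chain n) : pr (rel σ v) = rel σ (pr v) := by
  refine eq_of_bas (pr ∘ₗ rel σ) (rel σ ∘ₗ pr) (fun w => ?_) v
  have hf : Full (permWord σ w) ↔ Full w := by
    rw [Full, ← σ.forall_congr_right]
    refine forall_congr' fun s => ?_
    rw [← List.count_pos_iff, count_permWord, List.count_pos_iff]
  by_cases hw : Full w <;> simp [pr_bas, rel_bas, hf, hw]

theorem rel_mul (σ τ : Equiv.Perm (Fin n)) (v : Chain n) : rel (σ * τ) v = rel σ (rel τ v) := by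
  refine eq_of_bas (rel (σ * τ)) (rel σ ∘ₗ rel τ) (fun w => ?_) v
  simp only [LinearMap.comp_apply, rel_bas]
  congr 1
  induction w with
  | nil => rfl
  | cons x w ih => rcases x with _ | a <;> simp_all [permWord]

theorem rel_one (v : Chain n) : rel 1 v = v := by
  refine eq_of_bas (rel 1) LinearMap.id (fun w => ?_) v
  rw [rel_bas, LinearMap.id_apply]
  congr 1
  induction w with
  | nil => rfl
  | cons x w ih => rcases x with _ | a <;> simp_all [permWord]

theorem bdry_eq {x : Chain n} (hx : pr x = x) : bdry x = tw (pr (rm (tw x))) := by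
  have := eq_of_bas (lift (fun w => bdry (bas w)) ∘ₗ pr) (tw ∘ₗ pr ∘ₗ rm ∘ₗ tw ∘ₗ pr)
    (fun w => by by_cases hw : Full w <;> simp [pr_bas, hw, bdry_bas]) x
  simpa only [LinearMap.comp_apply, hx, ← bdry_eq_lift] using this

theorem cobdry_eq {x : Chain n} (hx : pr x = x) : cobdry x = tw (dup (tw x)) := by
  have := eq_of_bas (lift (fun w => cobdry (bas w)) ∘ₗ pr) (tw ∘ₗ dup ∘ₗ tw ∘ₗ pr)
    (fun w => by by_cases hw : Full w <;> simp [pr_bas, hw, cobdry_bas]) x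
  simpa only [LinearMap.comp_apply, hx, ← cobdry_eq_lift] using this

theorem permLin_eq (σ : Equiv.Perm (Fin n)) {x : Chain n} (hx : pr x = x) :
    permLin σ x = sgn (invCount σ) • tw (rel σ (tw x)) := by
  have := eq_of_bas (lift (fun w => permLin σ (bas w)) ∘ₗ pr)
    (sgn (invCount σ) • tw ∘ₗ rel σ ∘ₗ tw ∘ₗ pr)
    (fun w => by by_cases hw : Full w <;> simp [pr_bas, hw, permLin_bas]) x
  simpa only [LinearMap.smul_apply, LinearMap.comp_apply, hx, ← permLin_eq_lift] using this

theorem pr_bdry {x : Chain n} (hx : pr x = x) : pr (bdry x) = bdry x := by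
  rw [bdry_eq hx, ← tw_pr, pr_pr]

theorem pr_tw {x : Chain n} (hx : pr x = x) : pr (tw x) = tw x := by rw [← tw_pr, hx]

theorem pr_cobdry {x : Chain n} (hx : pr x = x) : pr (cobdry x) = cobdry x := by
  rw [cobdry_eq hx, ← tw_pr, pr_dup, pr_tw hx]

theorem pr_permLin (σ : Equiv.Perm (Fin n)) {x : Chain n} (hx : pr x = x) :
    pr (permLin σ x) = permLin σ x := by
  rw [permLin_eq σ hx, map_smul, ← tw_pr, pr_rel, pr_tw hx]

theorem bdry_bdry {x : Chain n} (hx : pr x = x) : bdry (bdry x) = 0 := by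
  rw [bdry_eq (pr_bdry hx), bdry_eq hx, tw_tw, pr_rm_pr, rm_rm, map_zero, map_zero]

theorem cobdry_cobdry {x : Chain n} (hx : pr x = x) : cobdry (cobdry x) = 0 := by
  rw [cobdry_eq (pr_cobdry hx), cobdry_eq hx, tw_tw, dup_dup, map_zero]

theorem bdry_cobdry {x : Chain n} (hx : pr x = x) : bdry (cobdry x) = -cobdry (bdry x) := by
  rw [bdry_eq (pr_cobdry hx), cobdry_eq hx, cobdry_eq (pr_bdry hx), bdry_eq hx, tw_tw, tw_tw,
    ← pr_dup, rm_dup, map_neg, map_neg]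

theorem bdry_add (x y : Chain n) : bdry (x + y) = bdry x + bdry y := by
  rw [bdry_eq_lift, map_add, ← bdry_eq_lift, ← bdry_eq_lift]

theorem cobdry_add (x y : Chain n) : cobdry (x + y) = cobdry x + cobdry y := by
  rw [cobdry_eq_lift, map_add, ← cobdry_eq_lift, ← cobdry_eq_lift]

theorem cobdry_zero : cobdry (0 : Chain n) = 0 := by rw [cobdry_eq_lift, map_zero]

theorem permLin_add (σ : Equiv.Perm (Fin n)) (x y : Chain n) :
    permLin σ (x + y) = permLin σ x + permLin σ y := by
  rw [permLin_eq_lift, map_add, ← permLin_eq_lift, ← permLin_eq_lift]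

theorem permLin_mul (σ τ : Equiv.Perm (Fin n)) {x : Chain n} (hx : pr x = x) :
    permLin (σ * τ) x = permLin σ (permLin τ x) := by
  rw [permLin_eq σ (pr_permLin τ hx), permLin_eq τ hx, permLin_eq _ hx, rel_mul, invCount_mul]
  simp [mul_smul]

theorem permLin_one {x : Chain n} (hx : pr x = x) : permLin 1 x = x := by
  rw [permLin_eq _ hx, invCount_one, rel_one, tw_tw, sgn_zero, one_smul]

theorem bdry_permLin (σ : Equiv.Perm (Fin n)) {x : Chain n} (hx : pr x = x) :
    bdry (permLin σ x) = permLin σ (bdry x) := by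
  rw [permLin_eq σ (pr_bdry hx), bdry_eq (pr_permLin σ hx), permLin_eq σ hx, bdry_eq hx]
  simp only [map_smul, tw_tw, rm_rel, pr_rel]

theorem cobdry_permLin (σ : Equiv.Perm (Fin n)) {x : Chain n} (hx : pr x = x) :
    cobdry (permLin σ x) = permLin σ (cobdry x) := by
  rw [permLin_eq σ (pr_cobdry hx), cobdry_eq (pr_permLin σ hx), permLin_eq σ hx, cobdry_eq hx]
  simp only [map_smul, tw_tw, dup_rel]

theorem circ_add_left (h : n + m = r + 1) (i : Fin n) (x x' : Chain n) (y : ℕ → Chain m) :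
    circ h i (x + x') y = circ h i x y + circ h i x' y :=
  Finsupp.sum_add_index' (by simp) (by intros; simp [add_mul, Finsupp.sum_add])

theorem circ_zero_left (h : n + m = r + 1) (i : Fin n) (y : ℕ → Chain m) :
    circ h i 0 y = 0 := Finsupp.sum_zero_index

theorem circ_add_right (h : n + m = r + 1) (i : Fin n) (x : Chain n) (y y' : ℕ → Chain m) :
    circ h i x (y + y') = circ h i x y + circ h i x y' := by
  rw [circ, circ, circ, ← Finsupp.sum_add]
  refine Finsupp.sum_congr fun p _ => ?_
  rw [Pi.add_apply]
  exact Finsupp.sum_add_index' (by simp) (by intros; simp [mul_add, add_mul])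

/-! ### The operations on chains of marked paths -/

section
variable {c : ℕ∞} {a b : ℤ} {l : ℕ}

theorem pr_of_mem {x : Chain n} (hx : x ∈ Finsupp.supported ℤ ℤ (LatDeg c n l a)) : pr x = x :=
  pr_eq_self (fun _ hw => (mem_latDeg.1 hw).1) hx

theorem circ_eq_of_mem (h : n + m = r + 1) (i : Fin n) {x : Chain n} {y : ℕ → Chain m}
    (hx : x ∈ Finsupp.supported ℤ ℤ (LatDeg c n l a))
    (hy : ∀ k, y k ∈ Finsupp.supported ℤ ℤ (LatDeg c m k b)) :
    ∀ᶠ N in Filter.atTop, circ h i x y = sgn (compSign n m i a b) •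
      tw (pr (mul h i (tw x) (app (tw (∑ j ∈ Finset.range N, y j))))) :=
  circ_eq h i
    (Finsupp.supported_mono
      (fun _ hw => by obtain ⟨h₁, -, h₂, -⟩ := mem_latDeg.1 hw; exact ⟨h₁, h₂⟩) hx)
    fun k => Finsupp.supported_mono
      (fun _ hw => by obtain ⟨h₁, h₂, h₃, -⟩ := mem_latDeg.1 hw; exact ⟨h₁, h₂, h₃⟩) (hy k)

/-- The degree determines the parity of the length of a full word. -/
theorem app_tw_mem {y : ℕ → Chain m} (hy : ∀ k, y k ∈ Finsupp.supported ℤ ℤ (LatDeg c m k b))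
    (N : ℕ) : app (tw (∑ j ∈ Finset.range N, y j)) ∈
      Finsupp.supported ℤ ℤ {q : Word m | (q.length : ZMod 2) = b + m + 1} := by
  rw [map_sum, map_sum]
  refine Submodule.sum_mem _ fun k _ =>
    map_mem_supported (f := app ∘ₗ tw) (fun q hq => ?_) (hy k)
  rw [mem_latDeg] at hq
  obtain ⟨hq, -, rfl, -⟩ := hq
  rw [LinearMap.comp_apply, tw_bas, map_smul, app_bas]
  refine Submodule.smul_mem _ _ (bas_mem_supported ?_)
  simp only [Set.mem_ofPred_eq, List.length_append, List.length_singleton, hq.wdeg]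
  push_cast
  linear_combination -(m : ZMod 2) * (CharTwo.two_eq_zero : (2 : ZMod 2) = 0)

theorem par_of_mem {v : Chain n} {e : ZMod 2}
    (hv : v ∈ Finsupp.supported ℤ ℤ {q : Word n | (q.length : ZMod 2) = e}) :
    par v = sgn e • v :=
  eq_of_bas_of_supported par (sgn e • LinearMap.id)
    (fun w hw => by rw [par_bas, hw]; rfl) hv

theorem bdry_sum {ι : Type*} (s : Finset ι) (f : ι → Chain n) :
    bdry (∑ j ∈ s, f j) = ∑ j ∈ s, bdry (f j) := by
  simp only [bdry_eq_lift (∑ j ∈ s, f j), map_sum, ← bdry_eq_lift]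

theorem cobdry_sum {ι : Type*} (s : Finset ι) (f : ι → Chain n) :
    cobdry (∑ j ∈ s, f j) = ∑ j ∈ s, cobdry (f j) := by
  simp only [cobdry_eq_lift (∑ j ∈ s, f j), map_sum, ← cobdry_eq_lift]

theorem pr_sum_of_mem {y : ℕ → Chain m} (hy : ∀ k, y k ∈ Finsupp.supported ℤ ℤ (LatDeg c m k b))
    (N : ℕ) : pr (∑ j ∈ Finset.range N, y j) = ∑ j ∈ Finset.range N, y j := by
  rw [map_sum]
  exact Finset.sum_congr rfl fun k _ => pr_of_mem (hy k)

/-- The sequence shifted by one, with `0` as its first term, so that both cases of the differential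
`totDiff` are `bdry (x l) + cobdry (prev x l)`. -/
def prev (x : ℕ → Chain n) : ℕ → Chain n
  | 0 => 0
  | l + 1 => x l

theorem cobdry_prev_mem {y : ℕ → Chain m}
    (hy : ∀ k, y k ∈ Finsupp.supported ℤ ℤ (LatDeg c m k b)) (k : ℕ) :
    cobdry (prev y k) ∈ Finsupp.supported ℤ ℤ (LatDeg c m k (b + 1)) := by
  cases k with
  | zero => rw [prev, cobdry_zero]; exact Submodule.zero_mem _
  | succ k => exact cobdry_mem (hy k)

/-- The Leibniz rule for `∂`, with the total differential of the inner elements. -/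
theorem bdry_circ (h : n + m = r + 1) (i : Fin n) {x : Chain n} {y : ℕ → Chain m}
    (hx : x ∈ Finsupp.supported ℤ ℤ (LatDeg c n l a))
    (hy : ∀ k, y k ∈ Finsupp.supported ℤ ℤ (LatDeg c m k b)) :
    bdry (circ h i x y) = circ h i (bdry x) y +
      sgn a • circ h i x ((fun k => bdry (y k)) + fun k => cobdry (prev y k)) := by
  have e₁ := circ_eq_of_mem h i hx hy
  have e₂ := circ_eq_of_mem h i (bdry_mem hx) hy
  have e₃ := circ_eq_of_mem h i hx fun k => bdry_mem (hy k)
  -- One more term than in `e₃`, since the shift produces an additional zero in front.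
  have e₄ := (Filter.tendsto_add_atTop_nat 1).eventually
    (circ_eq_of_mem h i hx (cobdry_prev_mem hy))
  obtain ⟨N, ⟨⟨e₁, e₂⟩, e₃⟩, e₄⟩ := (((e₁.and e₂).and e₃).and e₄).exists
  rw [circ_add_right, e₂, e₃, e₄, bdry_eq (pr_of_mem (circ_mem h i hx hy)), e₁,
    Finset.sum_range_succ', ← bdry_sum, ← cobdry_sum]
  have hY := pr_sum_of_mem hy N
  have hpar := par_of_mem (app_tw_mem hy N)
  simp only [prev, add_zero, cobdry_zero]
  rw [bdry_eq hY, cobdry_eq hY, bdry_eq (pr_of_mem hx)]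
  simp only [map_smul, tw_tw, pr_mul_left, pr_mul_right, pr_rm_pr, rm_mul_app, hpar, ← app_diff,
    map_add, map_sub]
  generalize tw (pr (mul h i (rm (tw x)) _)) = A, tw (pr (mul h i (tw x) (app (rm _)))) = B,
    tw (pr (mul h i (tw x) (app (dup _)))) = C
  simp only [smul_sub, smul_add, sgn_smul_sgn_smul]
  have h₁ : compSign n m i a b + (b + m + 1) = compSign n m i (a + 1) b := by
    simp only [compSign]
    push_cast
    ring
  have h₂ : a + compSign n m i a (b + 1) = compSign n m i a b + 1 := by
    simp only [compSign]
    push_cast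
    linear_combination (a : ZMod 2) * (CharTwo.two_eq_zero : (2 : ZMod 2) = 0)
  rw [h₁, h₂, sgn_add_one]
  simp only [neg_smul]
  abel

/-- The cosimplicial structure of a composition is that of the outer element. -/
theorem cobdry_circ (h : n + m = r + 1) (i : Fin n) {x : Chain n} {y : ℕ → Chain m}
    (hx : x ∈ Finsupp.supported ℤ ℤ (LatDeg c n l a))
    (hy : ∀ k, y k ∈ Finsupp.supported ℤ ℤ (LatDeg c m k b)) :
    cobdry (circ h i x y) = circ h i (cobdry x) y := by
  obtain ⟨N, e₁, e₂⟩ :=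
    ((circ_eq_of_mem h i hx hy).and (circ_eq_of_mem h i (cobdry_mem hx) hy)).exists
  rw [e₂, cobdry_eq (pr_of_mem (circ_mem h i hx hy)), e₁, cobdry_eq (pr_of_mem hx)]
  simp only [map_smul, tw_tw, ← pr_dup, dup_mul, par_of_mem (app_tw_mem hy N), sgn_smul_sgn_smul]
  congr 2
  simp only [compSign]
  push_cast
  ring

end

/-! ### Associativity and equivariance of the compositions -/

section
variable {c : ℕ∞} {a b e : ℤ} {l p s t : ℕ}

/-- `circ_eq_of_mem` for a sum over finitely many colours of the outer operation. -/
theorem sum_circ_eq (h : n + m = r + 1) (i : Fin n) {x : ℕ → Chain n} {y : ℕ → Chain m}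
    (hx : ∀ k, x k ∈ Finsupp.supported ℤ ℤ (LatDeg c n k a))
    (hy : ∀ k, y k ∈ Finsupp.supported ℤ ℤ (LatDeg c m k b)) (M : ℕ) :
    ∀ᶠ N in Filter.atTop, ∑ k ∈ Finset.range M, circ h i (x k) y = sgn (compSign n m i a b) •
      tw (pr (mul h i (tw (∑ k ∈ Finset.range M, x k))
        (app (tw (∑ j ∈ Finset.range N, y j))))) := by
  have := (Finset.range M).eventually_all.2 fun k _ => circ_eq_of_mem h i (hx k) hy
  filter_upwards [this] with N hN
  rw [Finset.sum_congr rfl hN]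
  generalize app (tw (∑ j ∈ Finset.range N, y j)) = V
  simp only [map_sum, Finset.smul_sum, LinearMap.sum_apply]

theorem circ_circ (h₁ : n + m = r + 1) (h₂ : r + p = t + 1) (h₃ : m + p = s + 1)
    (h₄ : n + s = t + 1) (i : Fin n) (j : Fin m) {x : Chain n} {y : ℕ → Chain m}
    {z : ℕ → Chain p} (hx : x ∈ Finsupp.supported ℤ ℤ (LatDeg c n l a))
    (hy : ∀ k, y k ∈ Finsupp.supported ℤ ℤ (LatDeg c m k b))
    (hz : ∀ k, z k ∈ Finsupp.supported ℤ ℤ (LatDeg c p k e)) :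
    circ h₂ (innerIdx h₁ i j) (circ h₁ i x y) z =
      circ h₄ i x fun k => circ h₃ j (y k) z := by
  obtain ⟨N, e₁, e₂⟩ := ((circ_eq_of_mem h₁ i hx hy).and
    (circ_eq_of_mem h₄ i hx fun k => circ_mem h₃ j (hy k) hz)).exists
  obtain ⟨M, e₃, e₄⟩ := ((circ_eq_of_mem h₂ (innerIdx h₁ i j) (circ_mem h₁ i hx hy) hz).and
    (sum_circ_eq h₃ j hy hz N)).exists
  rw [e₂, e₃, e₁, e₄]
  simp only [map_smul, LinearMap.smul_apply, tw_tw, pr_mul_left, pr_mul_right,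
    mul_mul_app h₁ h₂ h₃ h₄,
    par_of_mem (app_tw_mem hz M), sgn_smul_sgn_smul]
  congr 2
  simp only [compSign, cast_innerIdx, cast_eq_of_add_eq h₁, cast_eq_of_add_eq h₃]
  push_cast
  generalize (a : ZMod 2) = a, (b : ZMod 2) = b, (e : ZMod 2) = e, (n : ZMod 2) = n,
    (m : ZMod 2) = m, (p : ZMod 2) = p, ((i : ℕ) : ZMod 2) = i, ((j : ℕ) : ZMod 2) = j
  revert a b e n m p i j
  decide

theorem mul_mul_comm_of_mem (h₁ : n + m = r + 1) (h₂ : r + p = t + 1)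
    (h₃ : n + p = s + 1) (h₄ : s + m = t + 1) (i j : Fin n) (hij : i ≠ j) {β ω : ZMod 2}
    (u : Chain n) {v : Chain m} {w : Chain p}
    (hv : v ∈ Finsupp.supported ℤ ℤ {q : Word m | (q.length : ZMod 2) = β})
    (hw : w ∈ Finsupp.supported ℤ ℤ {q : Word p | (q.length : ZMod 2) = ω}) :
    mul h₂ (outerIdx h₁ i j hij.symm) (mul h₁ i u v) w =
      sgn (β * ω) • mul h₄ (outerIdx h₃ j i hij) (mul h₃ j u w) v := by
  refine eq_of_bas ((mul h₂ (outerIdx h₁ i j hij.symm)).flip w ∘ₗ (mul h₁ i).flip v)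
    (sgn (β * ω) • (mul h₄ (outerIdx h₃ j i hij)).flip v ∘ₗ (mul h₃ j).flip w) (fun x => ?_) u
  refine eq_of_bas_of_supported ((mul h₂ (outerIdx h₁ i j hij.symm)).flip w ∘ₗ mul h₁ i (bas x))
    (sgn (β * ω) • mul h₄ (outerIdx h₃ j i hij) (mul h₃ j (bas x) w)) (fun y hy => ?_) hv
  refine eq_of_bas_of_supported (mul h₂ (outerIdx h₁ i j hij.symm) (mul h₁ i (bas x) (bas y)))
    (sgn (β * ω) • (mul h₄ (outerIdx h₃ j i hij)).flip (bas y) ∘ₗ mul h₃ j (bas x))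
    (fun z hz => ?_) hw
  rw [mul_mul_comm h₁ h₂ h₃ h₄ i j hij, hy, hz]
  rfl

theorem circ_circ_comm (h₁ : n + m = r + 1) (h₂ : r + p = t + 1) (h₃ : n + p = s + 1)
    (h₄ : s + m = t + 1) (i j : Fin n) (hij : i ≠ j) {x : Chain n} {y : ℕ → Chain m}
    {z : ℕ → Chain p} (hx : x ∈ Finsupp.supported ℤ ℤ (LatDeg c n l a))
    (hy : ∀ k, y k ∈ Finsupp.supported ℤ ℤ (LatDeg c m k b))
    (hz : ∀ k, z k ∈ Finsupp.supported ℤ ℤ (LatDeg c p k e)) :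
    circ h₂ (outerIdx h₁ i j hij.symm) (circ h₁ i x y) z =
      sgn (b * e) • circ h₄ (outerIdx h₃ j i hij) (circ h₃ j x z) y := by
  obtain ⟨N, e₁, e₂⟩ := ((circ_eq_of_mem h₁ i hx hy).and
    (circ_eq_of_mem h₄ (outerIdx h₃ j i hij) (circ_mem h₃ j hx hz) hy)).exists
  obtain ⟨M, e₃, e₄⟩ := ((circ_eq_of_mem h₃ j hx hz).and
    (circ_eq_of_mem h₂ (outerIdx h₁ i j hij.symm) (circ_mem h₁ i hx hy) hz)).exists
  rw [e₂, e₃, e₄, e₁]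
  simp only [map_smul, LinearMap.smul_apply, tw_tw, pr_mul_left,
    mul_mul_comm_of_mem h₁ h₂ h₃ h₄ i j hij _ (app_tw_mem hy N) (app_tw_mem hz M),
    sgn_smul_sgn_smul]
  congr 2
  simp only [compSign, cast_outerIdx, cast_eq_of_add_eq h₁, cast_eq_of_add_eq h₃]
  push_cast
  rcases hij.lt_or_gt with hij | hij <;> simp only [hij, hij.not_gt, if_true, if_false] <;>
  · generalize (a : ZMod 2) = a, (b : ZMod 2) = b, (e : ZMod 2) = e, (n : ZMod 2) = n,
      (m : ZMod 2) = m, (p : ZMod 2) = p, ((i : ℕ) : ZMod 2) = i, ((j : ℕ) : ZMod 2) = j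
    revert a b e n m p i j
    decide

theorem circ_permLin (h : n + m = r + 1) (i : Fin n) (σ : Equiv.Perm (Fin n))
    (τ : Equiv.Perm (Fin m)) (ρ : Equiv.Perm (Fin r))
    (hin : ∀ j, ρ (innerIdx h i j) = innerIdx h (σ i) (τ j))
    (hout : ∀ j (hj : j ≠ i),
      ρ (outerIdx h i j hj) = outerIdx h (σ i) (σ j) (σ.injective.ne hj))
    {x : Chain n} {y : ℕ → Chain m} (hx : x ∈ Finsupp.supported ℤ ℤ (LatDeg c n l a))
    (hy : ∀ k, y k ∈ Finsupp.supported ℤ ℤ (LatDeg c m k b)) :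
    circ h (σ i) (permLin σ x) (fun k => permLin τ (y k)) = permLin ρ (circ h i x y) := by
  obtain ⟨N, e₁, e₂⟩ := ((circ_eq_of_mem h i hx hy).and
    (circ_eq_of_mem h (σ i) (permLin_mem σ hx) fun k => permLin_mem τ (hy k))).exists
  have hτ : ∑ k ∈ Finset.range N, permLin τ (y k) = permLin τ (∑ k ∈ Finset.range N, y k) := by
    simp only [permLin_eq_lift τ (∑ k ∈ Finset.range N, y k), map_sum, ← permLin_eq_lift]
  rw [e₂, permLin_eq ρ (pr_of_mem (circ_mem h i hx hy)), e₁, hτ, permLin_eq σ (pr_of_mem hx),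
    permLin_eq τ (pr_sum_of_mem hy N)]
  simp only [map_smul, LinearMap.smul_apply, tw_tw, app_rel, mul_rel h i σ τ ρ hin hout, pr_rel,
    sgn_smul_sgn_smul]
  congr 2
  rw [invCount_comp h i σ τ ρ hin hout]
  simp only [compSign]
  linear_combination -((m + 1) * i : ZMod 2) * (CharTwo.two_eq_zero : (2 : ZMod 2) = 0)

end

/-! ### The unit -/

theorem unitWord_succ (l : ℕ) : unitWord (l + 1) = some 0 :: none :: unitWord l := by
  simp [unitWord, List.replicate_succ]

theorem marks_unitWord (l : ℕ) : marks (unitWord l) = l := by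
  induction l with
  | zero => rfl
  | succ l ih => rw [unitWord_succ]; simpa [marks] using ih

theorem dim_unitWord (l : ℕ) : dim (unitWord l) 0 = l := by
  have : (unitWord l).count (some 0) = l + 1 := by
    induction l with
    | zero => rfl
    | succ l ih => rw [unitWord_succ]; simpa using ih
  rw [dim, this, Nat.add_sub_cancel]

theorem wdeg_unitWord (l : ℕ) : wdeg (unitWord l) = 0 := by
  simp [wdeg, marks_unitWord, dim_unitWord]

theorem unitWord_mem (c : ℕ∞) (l : ℕ) : unitWord l ∈ LatDeg c 1 l 0 := by
  refine mem_latDeg.2 ⟨fun s => ?_, marks_unitWord l, wdeg_unitWord l, fun i j hij => ?_⟩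
  · rw [Subsingleton.elim s 0]
    exact List.mem_cons_self
  · exact (hij (Subsingleton.elim i j)).elim

theorem compWord_unitWord_left (h : 1 + n = n + 1) (q : Word n) :
    compWord h 0 (unitWord (marks q)) q = q := by
  have hid : ∀ y : Fin n, innerIdx h 0 y = y := fun y => Fin.ext (by simp [innerIdx])
  induction q with
  | nil => rfl
  | cons x q ih =>
    rcases x with _ | y
    · have : marks (none :: q) = marks q + 1 := by simp [marks]
      rw [compWord, splitOn_cons_none, this, unitWord_succ, substWord, dif_pos rfl,
        List.tail_cons, substWord]
      exact congrArg (none :: ·) ih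
    · have : marks (some y :: q) = marks q := by simp [marks]
      rw [compWord, unitWord, substWord, dif_pos rfl] at ih
      rw [compWord, splitOn_cons_some, this, unitWord, substWord, dif_pos rfl]
      simp only [List.headD_cons, List.map_cons, Option.map_some, hid, List.cons_append,
        List.tail_cons]
      exact congrArg _ ih

theorem splitOn_unitWord (l : ℕ) :
    (unitWord l).splitOn none = List.replicate (l + 1) [some 0] := by
  induction l with
  | zero => rfl
  | succ l ih =>
    rw [unitWord_succ, splitOn_cons_some, splitOn_cons_none, ih, List.replicate_succ (n := l + 1)]
    rfl

theorem compWord_unitWord_right (i : Fin n) {p : Word n} (hp : Full p) :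
    compWord (rfl : n + 1 = n + 1) i p (unitWord (dim p i)) = p := by
  rw [compWord, splitOn_unitWord, ← hp.count]
  clear hp
  induction p with
  | nil => rfl
  | cons x p ih =>
    rcases x with _ | j
    · rw [List.count_cons_of_ne (by simp), substWord, ih]
    · by_cases hj : j = i
      · subst hj
        rw [List.count_cons_self, List.replicate_succ, substWord, dif_pos rfl, List.tail_cons, ih]
        rfl
      · have : outerIdx (rfl : n + 1 = n + 1) i j hj = j := Fin.ext (by simp [outerIdx])
        rw [List.count_cons_of_ne (by simpa using hj), substWord, dif_neg hj, ih, this]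

/-- The unit is the whiskering of the path that consists of one step. -/
theorem tw_unitWord (l : ℕ) : tw (bas (unitWord l)) = wh l (bas [some 0]) := by
  have hlen : ∀ l, ((unitWord l).length : ZMod 2) = 1 := by
    intro l
    induction l with
    | zero => rfl
    | succ l ih =>
      rw [unitWord_succ, List.length_cons, List.length_cons]
      push_cast
      rw [ih]
      rfl
  induction l with
  | zero =>
    have : twist (unitWord 0) = 0 := by simp [unitWord, twist]
    rw [tw_bas, wh_zero, this, sgn_zero, one_smul]
    rfl
  | succ l ih =>
    have ht : twist (unitWord (l + 1)) = twist (unitWord l) + 1 := by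
      have : ∀ w : Word 1, numBelow 0 w = 0 := fun w => by
        rw [numBelow_eq_sum]; simp
      rw [unitWord_succ, twist, twist, hlen, this]
      simp
      linear_combination (CharTwo.two_eq_zero : (2 : ZMod 2) = 0)
    rw [bas_cons] at ih ⊢
    rw [wh_succ_cons, wh_succ_nil, map_zero, zero_sub, ← ih, tw_bas, tw_bas, ht, sgn_add_one,
      neg_smul, unitWord_succ, bas_cons, bas_cons, map_smul, map_smul]

theorem diff_unit (l : ℕ) :
    bdry (bas (unitWord (l + 1))) + cobdry (bas (unitWord l)) = 0 := by
  have hf : ∀ k, Full (unitWord k) := fun k => (mem_latDeg.1 (unitWord_mem ⊤ k)).1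
  have hd := pr_dup (tw (bas (unitWord l)))
  rw [← tw_pr, pr_bas_of_full (hf l)] at hd
  rw [bdry_bas (hf _), cobdry_bas (hf _), ← hd, ← map_add, ← map_add, tw_unitWord, tw_unitWord]
  have := wh_rm l [(0 : Fin 1)]
  rw [List.map_singleton] at this
  rw [this, bas_cons, rm_some, rm_nil, map_zero, sub_zero, wh_succ_nil, map_zero, map_zero]

theorem bdry_unitWord_zero : bdry (bas (unitWord 0)) = 0 := by
  rw [bdry_bas (mem_latDeg.1 (unitWord_mem ⊤ 0)).1, tw_unitWord, wh_zero, bas_cons, rm_some,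
    rm_nil, map_zero, sub_zero, pr_bas_of_not_full, map_zero]
  exact fun h => by simpa using h 0

/-! ### The operad of marked lattice paths -/

section
variable {c : ℕ∞} {a b : ℤ}

theorem prev_mem {x : ℕ → Chain n}
    (hx : ∀ l, x l ∈ Finsupp.supported ℤ ℤ (LatDeg c n l a)) (l : ℕ) :
    prev x l ∈ Finsupp.supported ℤ ℤ (LatDeg c n (l - 1) a) := by
  cases l with
  | zero => exact Submodule.zero_mem _
  | succ l => exact hx l

/-- The total differential `∂ + δ`. -/
def totDiff (x : ℕ → Chain n) : ℕ → Chain n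
  | 0 => bdry (x 0)
  | l + 1 => bdry (x (l + 1)) + cobdry (x l)

theorem totDiff_apply (x : ℕ → Chain n) (l : ℕ) :
    totDiff x l = bdry (x l) + cobdry (prev x l) := by
  cases l with
  | zero => rw [totDiff, prev, cobdry_zero, add_zero]
  | succ l => rfl

theorem totDiff_mem {x : ℕ → Chain n}
    (hx : ∀ l, x l ∈ Finsupp.supported ℤ ℤ (LatDeg c n l a)) (l : ℕ) :
    totDiff x l ∈ Finsupp.supported ℤ ℤ (LatDeg c n l (a + 1)) := by
  rw [totDiff_apply]
  exact Submodule.add_mem _ (bdry_mem (hx l)) (cobdry_prev_mem hx l)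

theorem totDiff_add (x y : ℕ → Chain n) : totDiff (x + y) = totDiff x + totDiff y := by
  funext l
  cases l with
  | zero => exact bdry_add _ _
  | succ l =>
    rw [Pi.add_apply, totDiff, totDiff, totDiff, Pi.add_apply, Pi.add_apply, bdry_add, cobdry_add]
    abel

theorem totDiff_totDiff {x : ℕ → Chain n} (hx : ∀ l, pr (x l) = x l) :
    totDiff (totDiff x) = 0 := by
  funext l
  rcases l with _ | _ | l
  · exact bdry_bdry (hx 0)
  · rw [totDiff, totDiff, totDiff, bdry_add, bdry_bdry (hx _), bdry_cobdry (hx _), zero_add,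
      neg_add_cancel]
    rfl
  · rw [totDiff, totDiff, totDiff, bdry_add, bdry_bdry (hx _), bdry_cobdry (hx _), zero_add,
      cobdry_add, cobdry_cobdry (hx _), add_zero, neg_add_cancel]
    rfl

theorem totDiff_permLin (σ : Equiv.Perm (Fin n)) {x : ℕ → Chain n} (hx : ∀ l, pr (x l) = x l) :
    (totDiff fun l => permLin σ (x l)) = fun l => permLin σ (totDiff x l) := by
  funext l
  cases l with
  | zero => exact bdry_permLin σ (hx 0)
  | succ l =>
    rw [totDiff, totDiff, permLin_add, bdry_permLin σ (hx _), cobdry_permLin σ (hx _)]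

theorem totDiff_circ (h : n + m = r + 1) (i : Fin n) {x : ℕ → Chain n} {y : ℕ → Chain m}
    (hx : ∀ l, x l ∈ Finsupp.supported ℤ ℤ (LatDeg c n l a))
    (hy : ∀ l, y l ∈ Finsupp.supported ℤ ℤ (LatDeg c m l b)) (l : ℕ) :
    totDiff (fun l => circ h i (x l) y) l =
      circ h i (totDiff x l) y + sgn a • circ h i (x l) (totDiff y) := by
  have hd : totDiff y = (fun k => bdry (y k)) + fun k => cobdry (prev y k) :=
    funext (totDiff_apply y)
  have hprev : prev (fun l => circ h i (x l) y) l = circ h i (prev x l) y := by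
    cases l
    · exact (circ_zero_left h i y).symm
    · rfl
  rw [totDiff_apply, totDiff_apply, hprev, bdry_circ h i (hx l) hy,
    cobdry_circ h i (prev_mem hx l) hy, circ_add_left, hd]
  abel

theorem circ_unitWord_left (h : 1 + n = n + 1) {x : ℕ → Chain n}
    (hx : ∀ l, x l ∈ Finsupp.supported ℤ ℤ (LatDeg c n l a)) (l : ℕ) :
    circ h 0 (Finsupp.single (unitWord l) 1) x = x l := by
  unfold circ
  rw [Finsupp.sum_single_index (by simp), dim_unitWord]
  refine (Finsupp.sum_congr fun q hq => ?_).trans (Finsupp.sum_single (x l))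
  obtain ⟨-, hq, -⟩ := mem_latDeg.1 ((Finsupp.mem_supported _ _).1 (hx l) hq)
  have hc := compWord_unitWord_left h q
  have h0 : Finset.Iio (0 : Fin 1) = ∅ := by decide
  rw [hq] at hc
  rw [wdeg_unitWord, hc, h0]
  simp

theorem circ_unitWord_right (i : Fin n) {x : Chain n} {l : ℕ}
    (hx : x ∈ Finsupp.supported ℤ ℤ (LatDeg c n l a)) :
    circ (rfl : n + 1 = n + 1) i x (fun l => Finsupp.single (unitWord l) 1) = x := by
  refine (Finsupp.sum_congr fun p hp => ?_).trans (Finsupp.sum_single x)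
  obtain ⟨hp, -⟩ := mem_latDeg.1 ((Finsupp.mem_supported _ _).1 hx hp)
  rw [Finsupp.sum_single_index (by simp), compWord_unitWord_right i hp, wdeg_unitWord]
  simp

theorem mem_latTot_deg {x : ℕ → Chain n} :
    x ∈ (latTot c).deg n a ↔ ∀ l, x l ∈ Finsupp.supported ℤ ℤ (LatDeg c n l a) :=
  (AddSubgroup.mem_pi _).trans ⟨fun h l => h l trivial, fun h l _ => h l⟩

end

theorem isDGOperad_latTot (c : ℕ∞) : IsDGOperad (latTot c) where
  d_mem hx := mem_latTot_deg.2 (totDiff_mem (mem_latTot_deg.1 hx))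
  d_add {n a x y} _ _ := totDiff_add x y
  d_d hx := totDiff_totDiff fun l => pr_of_mem (mem_latTot_deg.1 hx l)
  perm_mem {n a} σ {x} hx := mem_latTot_deg.2 fun l => permLin_mem σ (mem_latTot_deg.1 hx l)
  perm_add {n a} σ {x y} _ _ := funext fun l => permLin_add σ (x l) (y l)
  perm_one hx := funext fun l => permLin_one (pr_of_mem (mem_latTot_deg.1 hx l))
  perm_mul {n a} σ τ {x} hx :=
    funext fun l => permLin_mul σ τ (pr_of_mem (mem_latTot_deg.1 hx l))
  d_perm {n a} σ {x} hx := totDiff_permLin σ fun l => pr_of_mem (mem_latTot_deg.1 hx l)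
  comp_mem {n m r a b} h i {x y} hx hy :=
    mem_latTot_deg.2 fun l => circ_mem h i (mem_latTot_deg.1 hx l) (mem_latTot_deg.1 hy)
  comp_add_left {n m r a b} h i {x x' y} _ _ _ :=
    funext fun l => circ_add_left h i (x l) (x' l) y
  comp_add_right {n m r a b} h i {x y y'} _ _ _ := funext fun l => circ_add_right h i (x l) y y'
  d_comp {n m r a b} h i {x y} hx hy := by
    rw [negOnePow_eq_sgn]
    exact funext fun l => totDiff_circ h i (mem_latTot_deg.1 hx) (mem_latTot_deg.1 hy) l
  one_mem := mem_latTot_deg.2 fun l => bas_mem_supported (unitWord_mem c l)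
  d_one := funext fun l => by
    cases l with
    | zero => exact bdry_unitWord_zero
    | succ l => exact diff_unit l
  one_comp {n a} h {x} hx := funext fun l => circ_unitWord_left h (mem_latTot_deg.1 hx) l
  comp_one {n a} i {x} hx := funext fun l => circ_unitWord_right i (mem_latTot_deg.1 hx l)
  assoc_seq {n m p r s t a b e} h₁ h₂ h₃ h₄ i j {x y z} hx hy hz := funext fun l =>
    circ_circ h₁ h₂ h₃ h₄ i j (mem_latTot_deg.1 hx l) (mem_latTot_deg.1 hy) (mem_latTot_deg.1 hz)
  assoc_par {n m p r s t a b e} h₁ h₂ h₃ h₄ i j hij {x y z} hx hy hz := by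
    rw [negOnePow_eq_sgn, Int.cast_mul]
    exact funext fun l => circ_circ_comm h₁ h₂ h₃ h₄ i j hij (mem_latTot_deg.1 hx l)
      (mem_latTot_deg.1 hy) (mem_latTot_deg.1 hz)
  equivariance {n m r a b} h i σ τ ρ hin hout {x y} hx hy := funext fun l =>
    circ_permLin h i σ τ ρ hin hout (mem_latTot_deg.1 hx l) (mem_latTot_deg.1 hy)

/-! ### Whiskers -/

theorem insertPoints_cons (x : Option (Fin n)) (p : Word n) (f : Fin (x :: p).length → ℕ) :
    insertPoints (x :: p) f = x :: (List.replicate (f 0) [none, x]).flatten ++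
      insertPoints p fun j => f j.succ := by
  simp [insertPoints, List.ofFn_succ]

theorem mem_whiskers {s : ℕ} {p q : Word n} :
    q ∈ whiskers s p ↔ ∃ f, ∑ j, f j = s ∧ insertPoints p f = q := by
  simp [whiskers]

theorem whiskers_zero (p : Word n) : whiskers 0 p = {p} := by
  rw [whiskers, Finset.piAntidiag_zero, Finset.image_singleton]
  congr 1
  induction p with
  | nil => rfl
  | cons x p ih =>
    rw [insertPoints_cons]
    exact congrArg (x :: ·) ih

theorem whiskers_succ_nil (s : ℕ) : whiskers (s + 1) ([] : Word n) = ∅ := by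
  ext q
  rw [mem_whiskers]
  simp

theorem whiskers_succ_cons (s : ℕ) (x : Option (Fin n)) (p : Word n) :
    whiskers (s + 1) (x :: p) = (whiskers (s + 1) p).image (x :: ·) ∪
      (whiskers s (x :: p)).image (fun q => x :: none :: q) := by
  ext q
  simp only [Finset.mem_union, Finset.mem_image, mem_whiskers]
  constructor
  · rintro ⟨f, hf, rfl⟩
    rw [insertPoints_cons]
    have hsum : f 0 + ∑ j : Fin p.length, f j.succ = s + 1 := by
      rw [← hf]; exact (Fin.sum_univ_succ f).symm
    rcases hk : f 0 with _ | k
    · exact .inl ⟨_, ⟨fun j => f j.succ, by rwa [hk, zero_add] at hsum, rfl⟩, rfl⟩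
    · refine .inr ⟨_, ⟨(Fin.cons k fun j => f j.succ : Fin (p.length + 1) → ℕ), ?_, rfl⟩, ?_⟩
      · refine (Fin.sum_univ_succ _).trans ?_
        simp only [Fin.cons_zero, Fin.cons_succ]
        omega
      · rw [insertPoints_cons, List.replicate_succ]
        rfl
  · rintro (⟨_, ⟨f, hf, rfl⟩, rfl⟩ | ⟨_, ⟨f, hf, rfl⟩, rfl⟩)
    · refine ⟨(Fin.cons 0 f : Fin (p.length + 1) → ℕ), ?_, ?_⟩
      · refine (Fin.sum_univ_succ _).trans ?_
        simp only [Fin.cons_zero, Fin.cons_succ]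
        omega
      · rw [insertPoints_cons]
        rfl
    · refine ⟨(Fin.cons (f 0 + 1) fun j => f j.succ : Fin (p.length + 1) → ℕ), ?_, ?_⟩
      · refine (Fin.sum_univ_succ _).trans ?_
        have hsum : f 0 + ∑ j : Fin p.length, f j.succ = s := by
          rw [← hf]; exact (Fin.sum_univ_succ f).symm
        simp only [Fin.cons_zero, Fin.cons_succ]
        omega
      · rw [insertPoints_cons, insertPoints_cons, Fin.cons_zero, List.replicate_succ]
        rfl

/-- Whiskers of an unmarked path are built from the path letter by letter. -/
theorem whiskers_induction {P : ℕ → List (Fin n) → Word n → Prop}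
    (zero : ∀ p, P 0 p (p.map some))
    (keep : ∀ s x p q, P (s + 1) p q → P (s + 1) (x :: p) (some x :: q))
    (insert : ∀ s x p q, P s (x :: p) q → P (s + 1) (x :: p) (some x :: none :: q))
    {s : ℕ} {p : List (Fin n)} {q : Word n} (hq : q ∈ whiskers s (p.map some)) : P s p q := by
  induction s generalizing p q with
  | zero =>
    rw [whiskers_zero, Finset.mem_singleton] at hq
    exact hq ▸ zero p
  | succ s ihs =>
    induction p generalizing q with
    | nil =>
      rw [List.map_nil, whiskers_succ_nil] at hq
      simp at hq
    | cons x p ihp =>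
      rw [List.map_cons, whiskers_succ_cons, Finset.mem_union, Finset.mem_image,
        Finset.mem_image] at hq
      rcases hq with ⟨q, hq, rfl⟩ | ⟨q, hq, rfl⟩
      · exact keep s x p q (ihp hq)
      · exact insert s x p q (ihs hq)

theorem marks_whiskers {s : ℕ} {p : List (Fin n)} {q : Word n} (hq : q ∈ whiskers s (p.map some)) :
    marks q = s :=
  whiskers_induction (P := fun s _ q => marks q = s) marks_map_some
    (fun s x p q h => by simpa [marks] using h) (fun s x p q h => by simpa [marks] using h) hq

theorem length_whiskers {s : ℕ} {p : List (Fin n)} {q : Word n}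
    (hq : q ∈ whiskers s (p.map some)) : q.length = p.length + 2 * s :=
  whiskers_induction (P := fun s p q => q.length = p.length + 2 * s) (by simp)
    (fun s x p q h => by simp only [List.length_cons, h]; ring)
    (fun s x p q h => by simp only [List.length_cons, h]; ring) hq

theorem full_whiskers {s : ℕ} {p : List (Fin n)} {q : Word n}
    (hq : q ∈ whiskers s (p.map some)) : Full q ↔ Full (p.map some) :=
  forall_congr' fun a => whiskers_induction
    (P := fun _ p q => some a ∈ q ↔ some a ∈ p.map some) (fun _ => Iff.rfl)
    (fun s x p q h => by rw [List.map_cons, List.mem_cons, List.mem_cons, h])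
    (fun s x p q h => by
      rw [List.mem_cons, List.mem_cons, h, List.map_cons, List.mem_cons]
      simp) hq

theorem Bounded.whiskers {c : ℕ∞} {s : ℕ} {p : List (Fin n)} {q : Word n}
    (hp : Bounded c (p.map some)) (hq : q ∈ whiskers s (p.map some)) : Bounded c q := by
  intro j k hjk
  refine (Nat.cast_le.2 (Thins.angles_le (f := id) ?_)).trans (hp j k hjk)
  refine whiskers_induction (P := fun _ p q => Thins id (proj j k (p.map some)) (proj j k q))
    (fun p => .of_sublist (List.Sublist.refl _)) (fun s x p q h => ?_) (fun s x p q h => ?_) hq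
  · rw [List.map_cons, proj_cons_some, proj_cons_some]
    split_ifs
    · exact .keep (some x) h
    · exact h
  · rw [List.map_cons, proj_cons_some] at h ⊢
    rw [proj_cons_some, proj_cons_none]
    split_ifs with hx
    · rw [if_pos hx] at h
      exact .dup (some x) h
    · rwa [if_neg hx] at h

theorem Full.wdeg_eq {w : Word n} (hw : Full w) :
    LatticePath.wdeg w = 2 * marks w + n - w.length := by
  rw [length_eq_sum, LatticePath.wdeg]
  simp only [hw.count, Finset.sum_add_distrib]
  push_cast
  simp
  ring

theorem whiskers_mem {c : ℕ∞} {a : ℤ} {s : ℕ} {p : List (Fin n)} {q : Word n}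
    (hp : p.map some ∈ LatDeg c n 0 a) (hq : q ∈ whiskers s (p.map some)) :
    q ∈ LatDeg c n s a := by
  rw [mem_latDeg] at hp ⊢
  obtain ⟨h₁, h₂, rfl, h₄⟩ := hp
  have hf := (full_whiskers hq).2 h₁
  refine ⟨hf, marks_whiskers hq, ?_, h₄.whiskers hq⟩
  rw [h₁.wdeg_eq, hf.wdeg_eq, h₂, marks_whiskers hq, length_whiskers hq, List.length_map]
  push_cast
  ring

/-- `wh s` is the sum of all whiskers with `s` new points, up to the sign `(-1) ^ s`. -/
theorem wh_bas (s : ℕ) (p : List (Fin n)) :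
    wh s (bas (p.map some)) = sgn s • ∑ q ∈ whiskers s (p.map some), bas q := by
  induction s generalizing p with
  | zero => simp [whiskers_zero]
  | succ s ihs =>
    induction p with
    | nil => rw [List.map_nil, wh_succ_nil, whiskers_succ_nil, Finset.sum_empty, smul_zero]
    | cons x p ihp =>
      have hdisj : Disjoint ((whiskers (s + 1) (p.map some)).image (some x :: ·))
          ((whiskers s (some x :: p.map some)).image fun q => some x :: none :: q) := by
        rw [Finset.disjoint_left]
        intro q hq hq'
        rw [Finset.mem_image] at hq hq'
        obtain ⟨q₁, h₁, rfl⟩ := hq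
        obtain ⟨q₂, -, h₂⟩ := hq'
        have : q₁.head? ≠ some none := whiskers_induction (P := fun _ _ q => q.head? ≠ some none)
          (fun p => by cases p <;> simp) (fun _ _ _ _ _ => by simp) (fun _ _ _ _ _ => by simp) h₁
        rw [List.cons.injEq] at h₂
        rw [← h₂.2] at this
        exact this rfl
      rw [List.map_cons, whiskers_succ_cons, Finset.sum_union hdisj,
        Finset.sum_image (fun _ _ _ _ => by simp), Finset.sum_image (fun _ _ _ _ => by simp),
        bas_cons, wh_succ_cons, ihp, ← bas_cons, ← List.map_cons, ihs]
      push_cast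
      simp only [bas_cons, map_smul, map_sum, sgn_add_one, smul_add, neg_smul,
        sub_eq_add_neg, map_neg]

/-! ### Whiskering of chains of unmarked paths -/

theorem exists_map_some {w : Word n} (hw : marks w = 0) : ∃ p : List (Fin n), w = p.map some := by
  induction w with
  | nil => exact ⟨[], rfl⟩
  | cons x w ih =>
    rcases x with _ | a
    · simp [marks] at hw
    · obtain ⟨p, rfl⟩ := ih (by simpa [marks] using hw)
      exact ⟨a :: p, rfl⟩

/-- The chains of unmarked words. -/
def unmarked (n : ℕ) : Submodule ℤ (Chain n) := Finsupp.supported ℤ ℤ {w | marks w = 0}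

/-- A linear map on chains of unmarked words is determined by its values on such words. -/
theorem eq_of_map_some {M : Type*} [AddCommGroup M] (f g : Chain n →ₗ[ℤ] M)
    (h : ∀ p : List (Fin n), f (bas (p.map some)) = g (bas (p.map some))) {v : Chain n}
    (hv : v ∈ unmarked n) : f v = g v :=
  eq_of_bas_of_supported f g (fun w hw => by
    obtain ⟨p, rfl⟩ := exists_map_some hw
    exact h p) hv

theorem tw_mem_unmarked {v : Chain n} (hv : v ∈ unmarked n) : tw v ∈ unmarked n :=
  map_mem_supported (fun w hw => by
    rw [tw_bas]
    exact Submodule.smul_mem _ _ (bas_mem_supported hw)) hv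

theorem rm_mem_unmarked {v : Chain n} (hv : v ∈ unmarked n) : rm v ∈ unmarked n :=
  map_mem_supported (fun w hw => by
    rw [rm_bas]
    refine Submodule.sum_mem _ fun s _ => Submodule.sum_mem _ fun i _ =>
      Submodule.smul_mem _ _ (bas_mem_supported ?_)
    exact (marks_faceWord s i w).trans hw) hv

theorem mul_app_mem_unmarked (h : n + m = r + 1) (i : Fin n) {u : Chain n} (hu : u ∈ unmarked n)
    (v : Chain m) : mul h i u (app v) ∈ unmarked r := by
  refine map_mem_supported (f := (mul h i).flip (app v)) (fun p hp => ?_) hu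
  have : v ∈ Finsupp.supported ℤ ℤ Set.univ := by simp
  refine map_mem_supported (f := mul h i (bas p) ∘ₗ app) (fun q _ => ?_) this
  rw [LinearMap.comp_apply, app_bas]
  rcases mul_eq_zero_or h i p q with H | H
  · rw [H]; exact Submodule.zero_mem _
  · have hc := substitutes_compWord (h := h) H
    rw [hc.mul_eq]
    exact Submodule.smul_mem _ _ (bas_mem_supported (hc.marks.trans hp))

theorem pr_wh (s : ℕ) {v : Chain n} (hv : v ∈ unmarked n) : pr (wh s v) = wh s (pr v) := by
  refine eq_of_map_some (pr ∘ₗ wh s) (wh s ∘ₗ pr) (fun p => ?_) hv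
  rw [LinearMap.comp_apply, LinearMap.comp_apply, wh_bas, map_smul, map_sum, pr_bas,
    Finset.sum_congr rfl fun q hq => by rw [pr_bas, if_congr (full_whiskers hq) rfl rfl]]
  split_ifs
  · rw [wh_bas]
  · simp

theorem wh_rel (s : ℕ) (σ : Equiv.Perm (Fin n)) (v : Chain n) :
    wh s (rel σ v) = rel σ (wh s v) := by
  refine eq_of_bas (wh s ∘ₗ rel σ) (rel σ ∘ₗ wh s) (fun w => ?_) v
  simp only [LinearMap.comp_apply]
  induction s generalizing w with
  | zero => simp
  | succ s ihs =>
    induction w with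
    | nil => rw [rel_nil, wh_succ_nil, map_zero]
    | cons x w ihw =>
      have := ihs (x :: w)
      rw [bas_cons, rel_consL] at this
      simp only [bas_cons, rel_consL, wh_succ_cons, ihw, this, map_sub, Option.map_none]

theorem rm_wh (s : ℕ) {v : Chain n} (hv : v ∈ unmarked n) :
    rm (wh (s + 1) v) + dup (wh s v) = wh (s + 1) (rm v) :=
  eq_of_map_some (rm ∘ₗ wh (s + 1) + dup ∘ₗ wh s) (wh (s + 1) ∘ₗ rm) (wh_rm s) hv

theorem mul_wh (h : n + m = r + 1) (i : Fin n) (l : ℕ) {u : Chain n} {v : Chain m}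
    (hu : u ∈ unmarked n) (hv : v ∈ unmarked m) :
    ∀ᶠ N in Filter.atTop, mul h i (wh l u) (app (∑ j ∈ Finset.range N, wh j v)) =
      wh l (mul h i u (app (∑ j ∈ Finset.range N, wh j v))) := by
  have hN : ∀ᶠ N in Filter.atTop, ∀ p ∈ u.support, p.length + l ≤ N :=
    (Finset.eventually_all u.support).2 fun p _ => Filter.eventually_ge_atTop _
  filter_upwards [hN] with N hN
  have hu' : u ∈ Finsupp.supported ℤ ℤ {p : Word n | marks p = 0 ∧ p.length + l ≤ N} :=
    (Finsupp.mem_supported _ _).2 fun p hp => ⟨(Finsupp.mem_supported _ _).1 hu hp, hN p hp⟩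
  refine eq_of_bas_of_supported
    ((mul h i).flip (app (∑ j ∈ Finset.range N, wh j v)) ∘ₗ wh l)
    (wh l ∘ₗ (mul h i).flip (app (∑ j ∈ Finset.range N, wh j v))) (fun w hw => ?_) hu'
  obtain ⟨hw, hwN⟩ := hw
  obtain ⟨p, rfl⟩ := exists_map_some hw
  rw [List.length_map] at hwN
  have hsum : ∀ v : Chain m, (app ∘ₗ ∑ j ∈ Finset.range N, wh j) v =
      app (∑ j ∈ Finset.range N, wh j v) := fun v => by simp
  simp only [LinearMap.comp_apply, LinearMap.flip_apply, ← hsum]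
  refine eq_of_map_some (mul h i (wh l (bas (p.map some))) ∘ₗ app ∘ₗ ∑ j ∈ Finset.range N, wh j)
    (wh l ∘ₗ mul h i (bas (p.map some)) ∘ₗ app ∘ₗ ∑ j ∈ Finset.range N, wh j) (fun q => ?_) hv
  have := mul_wh_whT h i l p q hwN
  simpa [whT] using this

/-! ### The brace operad -/

/-- The sign of the term `q` of the whiskering of `p`: the sign of `q` in the expansion `wh_bas`,
which is `(-1) ^ marks q`, combined with the changes of signs `tw` of `p` and `q`. -/
def whiskerSign (n : ℕ) (p q : Word n) : ℤˣ :=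
  if twist p + twist q + marks q = 0 then 1 else -1

theorem coe_whiskerSign (p q : Word n) :
    (whiskerSign n p q : ℤ) = sgn (twist p + twist q + marks q) := by
  rw [whiskerSign, sgn]
  split_ifs <;> rfl

theorem whiskS_bas (s : ℕ) (p : List (Fin n)) :
    whiskS whiskerSign s (bas (p.map some)) = tw (wh s (tw (bas (p.map some)))) := by
  rw [tw_bas, map_smul, map_smul, wh_bas, map_smul, map_sum, sgn_smul_sgn_smul, Finset.smul_sum,
    whiskS, bas, Finsupp.sum_single_index (by simp)]
  refine Finset.sum_congr rfl fun q hq => ?_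
  rw [one_mul, coe_whiskerSign, marks_whiskers hq, single_eq_smul_bas, tw_bas, sgn_smul_sgn_smul]
  congr 2
  ring

section
variable {c : ℕ∞} {a b : ℤ}

theorem mem_unmarked {x : Chain n} (hx : x ∈ Finsupp.supported ℤ ℤ (LatDeg c n 0 a)) :
    x ∈ unmarked n :=
  Finsupp.supported_mono (fun _ hw => (mem_latDeg.1 hw).2.1) hx

theorem whiskS_eq (s : ℕ) {x : Chain n} (hx : x ∈ unmarked n) :
    whiskS whiskerSign s x = tw (wh s (tw x)) := by
  rw [whiskS_eq_lift]
  exact eq_of_map_some _ (tw ∘ₗ wh s ∘ₗ tw) (fun p => by rw [lift_bas, whiskS_bas]; rfl) hx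

theorem whiskS_add (s : ℕ) (x y : Chain n) :
    whiskS whiskerSign s (x + y) = whiskS whiskerSign s x + whiskS whiskerSign s y := by
  rw [whiskS_eq_lift, map_add, ← whiskS_eq_lift, ← whiskS_eq_lift]

theorem whiskS_mem {x : Chain n} (hx : x ∈ Finsupp.supported ℤ ℤ (LatDeg c n 0 a)) (s : ℕ) :
    whiskS whiskerSign s x ∈ Finsupp.supported ℤ ℤ (LatDeg c n s a) := by
  rw [whiskS_eq_lift]
  refine map_mem_supported (fun w hw => ?_) hx
  rw [lift_bas, whiskS, bas, Finsupp.sum_single_index (by simp)]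
  refine Submodule.sum_mem _ fun q hq => Finsupp.single_mem_supported _ _ ?_
  obtain ⟨p, rfl⟩ := exists_map_some (mem_latDeg.1 hw).2.1
  exact whiskers_mem hw hq

theorem whiskS_zero {x : Chain n} (hx : x ∈ unmarked n) : whiskS whiskerSign 0 x = x := by
  rw [whiskS_eq 0 hx, wh_zero, tw_tw]

theorem whisk_bdry {x : Chain n} (hx : x ∈ Finsupp.supported ℤ ℤ (LatDeg c n 0 a)) :
    whisk whiskerSign n (bdry x) = totDiff (whisk whiskerSign n x) := by
  have hu := mem_unmarked hx
  have hbu := mem_unmarked (bdry_mem hx)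
  funext l
  cases l with
  | zero =>
    change whiskS whiskerSign 0 (bdry x) = bdry (whiskS whiskerSign 0 x)
    rw [whiskS_zero hu, whiskS_zero hbu]
  | succ l =>
    change whiskS whiskerSign (l + 1) (bdry x) =
      bdry (whiskS whiskerSign (l + 1) x) + cobdry (whiskS whiskerSign l x)
    have hp := pr_of_mem (whiskS_mem hx l)
    have hd := pr_dup (tw (whiskS whiskerSign l x))
    rw [pr_tw hp] at hd
    rw [bdry_eq (pr_of_mem (whiskS_mem hx (l + 1))), cobdry_eq hp, ← hd, whiskS_eq _ hu,
      whiskS_eq _ hu, whiskS_eq _ hbu, bdry_eq (pr_of_mem hx), tw_tw, tw_tw, tw_tw,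
      ← pr_wh _ (rm_mem_unmarked (tw_mem_unmarked hu)), ← rm_wh l (tw_mem_unmarked hu), map_add,
      map_add]

theorem whiskS_permLin (s : ℕ) (σ : Equiv.Perm (Fin n)) {x : Chain n}
    (hx : x ∈ Finsupp.supported ℤ ℤ (LatDeg c n 0 a)) :
    whiskS whiskerSign s (permLin σ x) = permLin σ (whiskS whiskerSign s x) := by
  rw [permLin_eq σ (pr_of_mem (whiskS_mem hx s)), whiskS_eq _ (mem_unmarked hx),
    whiskS_eq _ (mem_unmarked (permLin_mem σ hx)), permLin_eq σ (pr_of_mem hx)]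
  simp only [map_smul, tw_tw, wh_rel]

theorem whiskS_unit (s : ℕ) :
    whiskS whiskerSign s (bas ([some 0] : Word 1)) = bas (unitWord s) := by
  have h0 : tw (bas ([some 0] : Word 1)) = bas [some 0] :=
    (tw_unitWord 0).trans (wh_zero _)
  rw [show ([some 0] : Word 1) = [(0 : Fin 1)].map some from rfl, whiskS_bas,
    List.map_singleton, h0, ← tw_unitWord, tw_tw]

theorem whiskS_circ (l : ℕ) (h : n + m = r + 1) (i : Fin n) {x : Chain n} {y : Chain m}
    (hx : x ∈ Finsupp.supported ℤ ℤ (LatDeg c n 0 a))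
    (hy : y ∈ Finsupp.supported ℤ ℤ (LatDeg c m 0 b)) :
    whiskS whiskerSign l (circ h i x (whisk whiskerSign m y)) =
      circ h i (whiskS whiskerSign l x) (whisk whiskerSign m y) := by
  have hw : ∀ k, whisk whiskerSign m y k ∈ Finsupp.supported ℤ ℤ (LatDeg c m k b) := whiskS_mem hy
  have hx' := tw_mem_unmarked (mem_unmarked hx)
  have hy' := tw_mem_unmarked (mem_unmarked hy)
  obtain ⟨N, ⟨e₁, e₂⟩, e₃⟩ := (((circ_eq_of_mem h i hx hw).and
    (circ_eq_of_mem h i (whiskS_mem hx l) hw)).and (mul_wh h i l hx' hy')).exists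
  have hsum : tw (∑ j ∈ Finset.range N, whisk whiskerSign m y j) =
      ∑ j ∈ Finset.range N, wh j (tw y) := by
    rw [map_sum]
    refine Finset.sum_congr rfl fun j _ => ?_
    rw [whisk, whiskS_eq j (mem_unmarked hy), tw_tw]
  rw [whiskS_eq l (mem_unmarked (circ_mem h i hx hw)), e₂, e₁, hsum,
    whiskS_eq l (mem_unmarked hx)]
  simp only [map_smul, tw_tw]
  rw [e₃, pr_wh l (mul_app_mem_unmarked h i hx' _)]

end

theorem isDGOperadInclusion_whisk (c : ℕ∞) :
    IsDGOperadInclusion (brace c whiskerSign) (latTot c) (whisk whiskerSign) where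
  map_mem hx := mem_latTot_deg.2 (whiskS_mem hx)
  map_add {n a x y} _ _ := funext fun s => whiskS_add s x y
  map_d hx := whisk_bdry hx
  map_one := funext whiskS_unit
  map_perm {n a} σ {x} hx := funext fun s => whiskS_permLin s σ hx
  map_comp {n m r a b} h i {x y} hx hy := funext fun l => whiskS_circ l h i hx hy
  injOn n a x hx y hy hxy := by
    have := congrFun hxy 0
    change whiskS whiskerSign 0 x = whiskS whiskerSign 0 y at this
    rwa [whiskS_zero (mem_unmarked hx), whiskS_zero (mem_unmarked hy)] at this

/-- The laws hold in `brace` since they hold for the whiskered elements, and `whisk` is injective: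
its component `0` is the identity. -/
theorem isDGOperad_brace (c : ℕ∞) : IsDGOperad (brace c whiskerSign) :=
  (isDGOperadInclusion_whisk c).isDGOperad (isDGOperad_latTot c) bdry_mem permLin_mem
    (fun {_ _ _ _ _} h i {_ _} hx hy => circ_mem h i hx (whiskS_mem hy))
    (bas_mem_supported (unitWord_mem c 0))

end
end LatticePath

theorem proposition3 (c : ℕ∞) :
    Operadic.IsDGOperad (LatticePath.latTot c) ∧
    ∃ ε : (n : ℕ) → LatticePath.Word n → LatticePath.Word n → ℤˣ,
      Operadic.IsDGOperad (LatticePath.brace c ε) ∧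
      Operadic.IsDGOperadInclusion (LatticePath.brace c ε) (LatticePath.latTot c)
        (LatticePath.whisk ε) :=
  ⟨LatticePath.isDGOperad_latTot c, LatticePath.whiskerSign, LatticePath.isDGOperad_brace c,
    LatticePath.isDGOperadInclusion_whisk c⟩
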